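/- **Theorem 3.1.** Let $N\ge 1$ and let $q\in\mathbb C$ with $q\ne 0$, $q^2\neq 1$. Let $E_{ij}$ be the $N\times N$ matrix units and $$R(u,v)=(qu-q^{-1}v)\sum_{i}E_{ii}\otimes E_{ii}+(u-v)\sum_{i<j}(E_{ii}\otimes E_{jj}+E_{jj}\otimes E_{ii})+(q-q^{-1})\sum_{i<j}(v\,E_{ij}\otimes E_{ji}+u\,E_{ji}\otimes E_{ij}).$$ Let $U_q(\widehat{\mathfrak{gl}}_N)$ be the unital associative $\mathbb C$-algebra generated by the coefficients of $T_{ij}(u)=\sum_{r\ge0}T_{ij}[r]u^{-r}$ and $\bar T_{ij}(u)=\sum_{r\ge0}\bar T_{ij}[r]u^{r}$, subject to $R(u,v)X_1(u)Y_2(v)=Y_2(v)X_1(u)R(u,v)$ for $(X,Y)=(T,T),(\bar T,\bar T),(T,\bar T)$, where $X_1=X\otimes 1$, $Y_2=1\otimes Y$. For a colouring $\boldsymbol I=(i_1,\dots,i_L)$ of $\{1,\dots,L\}$ with colours $1,\dots,N$, let $\boldsymbol I^p=\{c: i_c\le p\}$, $k_p=|\boldsymbol I^p|$, and let $\widetilde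 I^p_1<\dots<\widetilde I^p_{k_p}$ be the positions of the elements of $\boldsymbol I^p$ inside the ordered set $\boldsymbol I^{p+1}$. For sets of variables $\bar x^p=\{x^p_1,\dots,x^p_{k_p}\}$ ($1\le p\le N-1$) and a sequence $\bar y=(y_1,\dots,y_L)$, put $x^N_i:=y_i$, $\sigma_N:=\mathrm{id}$ and $$W(\bar x^1,\dots,\bar x^{N-1}|\bar y|\boldsymbol I)=\sum_{\sigma_1\in S_{k_1}}\cdots\sum_{\sigma_{N-1}\in S_{k_{N-1}}}\ \prod_{p=1}^{N-1}\Bigg\{\prod_{a=1}^{k_p}\Bigg(\prod_{i=1}^{\widetilde I^p_a-1}\big(x^p_{\sigma_p(a)}-x^{p+1}_{\sigma_{p+1}(i)}\big)\,(q-q^{-1})x^p_{\sigma_p(a)}\prod_{i=\widetilde I^p_a+1}^{k_{p+1}}\big(qx^p_{\sigma_p(a)}-q^{-1}x^{p+1}_{\sigma_{p+1}(i)}\big)\Bigg)\prod_{1\le a<b\le k_p}\frac{q^{-1}x^p_{\sigma_p(a)}-qx^p_{\sigma_p(b)}}{x^p_{\sigma_p(a)}-x^p_{\sigma_p(b)}}\Bigg\}.$$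 Let $\bar u^1,\dots,\bar u^N$ be finite, possibly empty, disjoint sets of indeterminates. For sets, $T_{Nj}(\bar w)=\prod_{w\in\bar w}T_{Nj}(w)$ (the factors commute), $\bar x-\bar y=\prod_{x\in\bar x,\,y\in\bar y}(x-y)$ and $q\bar x-q^{-1}\bar y=\prod_{x\in\bar x,\,y\in\bar y}(qx-q^{-1}y)$. Then $$T_{N1}(\bar u^1)\cdots T_{NN}(\bar u^N)=\sum_{\{\bar u^1,\dots,\bar u^N\}\mapsto\{\bar v^1,\dots,\bar v^N\}}G(\bar u|\bar v)\;T_{NN}(\bar v^N)\cdots T_{N2}(\bar v^2)T_{N1}(\bar v^1),$$ where the sum is over all partitions of $\bar u^1\cup\dots\cup\bar u^N$ into subsets $\bar v^1,\dots,\bar v^N$ with $|\bar v^j|=|\bar u^j|$, and $$G(\bar u|\bar v)=\frac{1}{\prod_{1\le j<k\le N}(\bar v^k-\bar v^j)(q\bar v^j-q^{-1}\bar v^{k-1})}\cdot\frac{\prod_{j=1}^{N-1}(q\bar u^N-q^{-1}\bar v^j)}{\prod_{j=1}^{N-1}(q\bar u^j-q^{-1}\bar v^N)\prod_{\ell=1}^{N-2}\prod_{j=1}^{\ell}\prod_{k=1}^{\ell+1}(q\bar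 u^j-q^{-1}\bar u^k)}$$ $$\times\;W(\bar u^1,\bar u^1\cup\bar u^2,\dots,\bar u^1\cup\cdots\cup\bar u^{N-1}\,|\,\bar v^1,\dots,\bar v^N\,|\,1^{|\bar u^1|},2^{|\bar u^2|},\dots,N^{|\bar u^N|}),$$ for any choice of the ordering of the variables inside each $\bar v^j$. This is an identity of formal series over $U_q(\widehat{\mathfrak{gl}}_N)$ after multiplication by any common denominator of the rational functions $G(\bar u|\bar v)$. The coefficients do not depend on the representation of the $L$-operator: the same identity, with the same $G$, holds (a) for the image of $T(u)$ under every homomorphism from $U_q(\widehat{\mathfrak{gl}}_N)$ to a unital associative $\mathbb C$-algebra $A$, and (b) for every family of matrices $T(u)$, $u\in\Omega\subseteq\mathbb C$, with entries in such an algebra $A$ that satisfies $R(u,v)T_1(u)T_2(v)=T_2(v)T_1(u)R(u,v)$ for $u,v\in\Omega$, whenever the variables in $\bar u^1,\dots,\bar u^N$ are pairwise distinct elements of $\Omega$ with $qx\ne q^{-1}y$ for all $x,y\in\bar u^1\cup\dots\cup\bar u^N$ (including $x=y$). -/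

import Mathlib

open scoped Kronecker

noncomputable section

namespace QAffine

/-! ### The trigonometric R-matrix and the RTT relation -/

/-- The trigonometric R-matrix `R(u,v) ∈ End(V ⊗ V)`, `dim V = N`. The row index is the output
pair `(k,l)` and the column index the input pair `(i,j)`, so that
`R(u,v) (e_i ⊗ e_j) = ∑_{k,l} R (k,l) (i,j) • e_k ⊗ e_l`; `Matrix.single i j 1` is `E_{ij}`. -/
def trigR (N : ℕ) {K : Type*} [Field K] (q u v : K) :
    Matrix (Fin N × Fin N) (Fin N × Fin N) K :=
  (q * u - q⁻¹ * v) • (∑ i : Fin N, Matrix.single i i (1 : K) ⊗ₖ Matrix.single i i (1 : K))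
  + (u - v) • (∑ i : Fin N, ∑ j : Fin N with i < j,
      (Matrix.single i i (1 : K) ⊗ₖ Matrix.single j j (1 : K)
        + Matrix.single j j (1 : K) ⊗ₖ Matrix.single i i (1 : K)))
  + ((q - q⁻¹) * v) • (∑ i : Fin N, ∑ j : Fin N with i < j,
      Matrix.single i j (1 : K) ⊗ₖ Matrix.single j i (1 : K))
  + ((q - q⁻¹) * u) • (∑ i : Fin N, ∑ j : Fin N with i < j,
      Matrix.single j i (1 : K) ⊗ₖ Matrix.single i j (1 : K))

/-- `R(u,v)` is linear homogeneous in `(u,v)`. -/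
theorem trigR_eq (N : ℕ) {K : Type*} [Field K] (q u v : K) :
    trigR N q u v = u • trigR N q 1 0 + v • trigR N q 0 1 := by
  unfold trigR
  module

/-- The R-matrix with its scalar entries regarded in a `ℂ`-algebra `A`. -/
def trigRIn (N : ℕ) (A : Type*) [Ring A] [Algebra ℂ A] (q u v : ℂ) :
    Matrix (Fin N × Fin N) (Fin N × Fin N) A :=
  (trigR N q u v).map (algebraMap ℂ A)

/-- The relation `R(u,v) T₁(u) T₂(v) = T₂(v) T₁(u) R(u,v)` between two matrices `X = T(u)` and
`Y = T(v)` with entries in `A`; here `X₁ = X ⊗ 1` and `Y₂ = 1 ⊗ Y`. -/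
def RTT {N : ℕ} {A : Type*} [Ring A] [Algebra ℂ A] (q u v : ℂ)
    (X Y : Matrix (Fin N) (Fin N) A) : Prop :=
  trigRIn N A q u v * (X ⊗ₖ (1 : Matrix (Fin N) (Fin N) A)) * ((1 : Matrix (Fin N) (Fin N) A) ⊗ₖ Y)
    = ((1 : Matrix (Fin N) (Fin N) A) ⊗ₖ Y) * (X ⊗ₖ (1 : Matrix (Fin N) (Fin N) A))
      * trigRIn N A q u v

/-! ### The quantum affine algebra -/

/-- The generators `T_{ij}[r]` and `T̄_{ij}[r]`, `r ≥ 0`. -/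
inductive Gen (N : ℕ) : Type
  | T (i j : Fin N) (r : ℕ) : Gen N
  | Tbar (i j : Fin N) (r : ℕ) : Gen N

/-- The coefficient matrix of `u^r` in `T(u) = ∑_{r ≥ 0} T[r] u^{-r}`. -/
def modeT (N : ℕ) (r : ℤ) : Matrix (Fin N) (Fin N) (FreeAlgebra ℂ (Gen N)) :=
  Matrix.of fun i j => if r ≤ 0 then FreeAlgebra.ι ℂ (Gen.T i j (-r).toNat) else 0

/-- The coefficient matrix of `u^r` in `T̄(u) = ∑_{r ≥ 0} T̄[r] u^r`. -/
def modeTbar (N : ℕ) (r : ℤ) : Matrix (Fin N) (Fin N) (FreeAlgebra ℂ (Gen N)) :=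
  Matrix.of fun i j => if 0 ≤ r then FreeAlgebra.ι ℂ (Gen.Tbar i j r.toNat) else 0

/-- The coefficient of `u^r v^s` in `R(u,v) X₁(u) Y₂(v)`, for formal series
`X(u) = ∑ X[r] u^r` and `Y(v) = ∑ Y[s] v^s`; recall `R(u,v) = u R(1,0) + v R(0,1)`. -/
def rttLeft {N : ℕ} {A : Type*} [Ring A] [Algebra ℂ A] (q : ℂ)
    (X Y : ℤ → Matrix (Fin N) (Fin N) A) (r s : ℤ) :
    Matrix (Fin N × Fin N) (Fin N × Fin N) A :=
  trigRIn N A q 1 0 * (X (r - 1) ⊗ₖ (1 : Matrix (Fin N) (Fin N) A))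
      * ((1 : Matrix (Fin N) (Fin N) A) ⊗ₖ Y s)
  + trigRIn N A q 0 1 * (X r ⊗ₖ (1 : Matrix (Fin N) (Fin N) A))
      * ((1 : Matrix (Fin N) (Fin N) A) ⊗ₖ Y (s - 1))

/-- The coefficient of `u^r v^s` in `Y₂(v) X₁(u) R(u,v)`. -/
def rttRight {N : ℕ} {A : Type*} [Ring A] [Algebra ℂ A] (q : ℂ)
    (X Y : ℤ → Matrix (Fin N) (Fin N) A) (r s : ℤ) :
    Matrix (Fin N × Fin N) (Fin N × Fin N) A :=
  ((1 : Matrix (Fin N) (Fin N) A) ⊗ₖ Y s) * (X (r - 1) ⊗ₖ (1 : Matrix (Fin N) (Fin N) A))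
      * trigRIn N A q 1 0
  + ((1 : Matrix (Fin N) (Fin N) A) ⊗ₖ Y (s - 1)) * (X r ⊗ₖ (1 : Matrix (Fin N) (Fin N) A))
      * trigRIn N A q 0 1

/-- The defining relations: all matrix entries of all coefficients of the three RTT relations,
for the pairs `(T,T)`, `(T̄,T̄)` and `(T,T̄)`. -/
inductive Rel (N : ℕ) (q : ℂ) : FreeAlgebra ℂ (Gen N) → FreeAlgebra ℂ (Gen N) → Prop
  | TT (r s : ℤ) (x y : Fin N × Fin N) :
      Rel N q (rttLeft q (modeT N) (modeT N) r s x y) (rttRight q (modeT N) (modeT N) r s x y)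
  | TbarTbar (r s : ℤ) (x y : Fin N × Fin N) :
      Rel N q (rttLeft q (modeTbar N) (modeTbar N) r s x y)
        (rttRight q (modeTbar N) (modeTbar N) r s x y)
  | TTbar (r s : ℤ) (x y : Fin N × Fin N) :
      Rel N q (rttLeft q (modeT N) (modeTbar N) r s x y)
        (rttRight q (modeT N) (modeTbar N) r s x y)

/-- The quantum affine algebra `U_q(ĝl_N)`: the unital associative `ℂ`-algebra generated by the
`T_{ij}[r]`, `T̄_{ij}[r]` subject to the RTT relations. -/
abbrev Uq (N : ℕ) (q : ℂ) : Type := RingQuot (Rel N q)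

/-- The generator `T_{ij}[r]` of `U_q(ĝl_N)`. -/
def genT (N : ℕ) (q : ℂ) (i j : Fin N) (r : ℕ) : Uq N q :=
  RingQuot.mkAlgHom ℂ (Rel N q) (FreeAlgebra.ι ℂ (Gen.T i j r))

/-! ### The trigonometric weight functions -/

/-- The set `I^p` of coordinates of colour at most `p`, with its inherited order. -/
abbrev Below {P : Type*} {m : ℕ} (I : P → Fin (m + 1)) (p : Fin (m + 1)) : Type _ :=
  {i : P // I i ≤ p}

/-- The trigonometric weight function `W(u^1,…,u^{N-1} | v | I)`, with `N = m + 1` and colours and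
layers numbered from `0`. `P` is the linearly ordered set `{1,…,L}` of coordinates,
`I` the colouring, `v_i` (`i : P`) the last set of variables. As `k_p = |I^p|`, the variables
`u^p_1,…,u^p_{k_p}` are numbered by the elements of `I^p` in increasing order, and `S_{k_p}` is
the group of permutations of `I^p`. If `a` is the `a`-th element of `I^p`, then the relabelled
coordinates `i < Ĩ^p_a` (resp. `i > Ĩ^p_a`) are the elements of `I^{p+1}` below
(resp. above) `a` in `P`. The last set of variables is not symmetrized. -/
def weight {K : Type*} [Field K] (q : K) {P : Type*} [Fintype P] [LinearOrder P] {m : ℕ}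
    (I : P → Fin (m + 1)) (u : (p : Fin m) → Below I p.castSucc → K) (v : P → K) : K :=
  let z : (p : Fin (m + 1)) → Below I p → K :=
    Fin.snoc (α := fun p => Below I p → K) u (fun i => v i.1)
  ∑ σ : (p : Fin (m + 1)) → Equiv.Perm (Below I p) with σ (Fin.last m) = 1,
    ∏ p : Fin m,
      ((∏ a : Below I p.castSucc,
          ((∏ b : Below I p.succ with b.1 < a.1,
              (z p.castSucc (σ p.castSucc a) - z p.succ (σ p.succ b)))
            * ((q - q⁻¹) * z p.castSucc (σ p.castSucc a))
            * ∏ b : Below I p.succ with a.1 < b.1,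
              (q * z p.castSucc (σ p.castSucc a) - q⁻¹ * z p.succ (σ p.succ b))))
        * ∏ a : Below I p.castSucc, ∏ b : Below I p.castSucc with a < b,
            (q⁻¹ * z p.castSucc (σ p.castSucc a) - q * z p.castSucc (σ p.castSucc b))
              / (z p.castSucc (σ p.castSucc a) - z p.castSucc (σ p.castSucc b)))

/-! ### Blocks of variables, partitions, coefficients -/

/-- The index set of all variables: `(j,a)` stands for the `a`-th variable of the `j`-th set.
It is ordered lexicographically, i.e. as the concatenation of the `N = m + 1` blocks. -/
abbrev Idx {m : ℕ} (n : Fin (m + 1) → ℕ) : Type := Lex (Σ j : Fin (m + 1), Fin (n j))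

/-- The index of the `a`-th variable of the `j`-th set. -/
def mkIdx {m : ℕ} (n : Fin (m + 1) → ℕ) (j : Fin (m + 1)) (a : Fin (n j)) : Idx n :=
  toLex ⟨j, a⟩

/-- The block of an index. As a colouring of the coordinates this is `(1^{n_1},…,N^{n_N})`. -/
def block {m : ℕ} (n : Fin (m + 1) → ℕ) (i : Idx n) : Fin (m + 1) := (ofLex i).1

/-- Partitions `{u^1,…,u^N} ↦ {v^1,…,v^N}` with `|v^j| = |u^j|`: the function records to
which of the sets `v^j` each variable belongs. -/
abbrev BlockPartition {m : ℕ} (n : Fin (m + 1) → ℕ) : Type :=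
  {c : Idx n → Fin (m + 1) // ∀ j, (Finset.univ.filter fun i => c i = j).card = n j}

/-- `x^j - y^k`, the product of all differences. -/
def diffProd {K : Type*} [Field K] {m : ℕ} (n : Fin (m + 1) → ℕ) (x y : Idx n → K)
    (j k : Fin (m + 1)) : K :=
  ∏ a : Fin (n j), ∏ b : Fin (n k), (x (mkIdx n j a) - y (mkIdx n k b))

/-- `q x^j - q⁻¹ y^k`, the product over all pairs. -/
def qProd {K : Type*} [Field K] (q : K) {m : ℕ} (n : Fin (m + 1) → ℕ) (x y : Idx n → K)
    (j k : Fin (m + 1)) : K :=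
  ∏ a : Fin (n j), ∏ b : Fin (n k), (q * x (mkIdx n j a) - q⁻¹ * y (mkIdx n k b))

/-- The specialization `W(u^1, u^1 ∪ u^2, …, u^1 ∪ ⋯ ∪ u^{N-1} | v^1,…,v^N | 1^{n_1},…,N^{n_N})`. -/
def specialWeight {K : Type*} [Field K] (q : K) {m : ℕ} (n : Fin (m + 1) → ℕ)
    (u v : Idx n → K) : K :=
  weight q (block n) (fun _ i => u i.1) v

/-- The coefficient of the multiple commutation relation; `N = m + 1` and sets of variables are
numbered from `0`. -/
def coefficient {K : Type*} [Field K] (q : K) {m : ℕ} (n : Fin (m + 1) → ℕ)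
    (u v : Idx n → K) : K :=
  1 / (∏ k : Fin m, ∏ j : Fin (m + 1) with j < k.succ,
        (diffProd n v v k.succ j * qProd q n v v j k.castSucc))
  * ((∏ j : Fin m, qProd q n u v (Fin.last m) j.castSucc)
      / ((∏ j : Fin m, qProd q n u v j.castSucc (Fin.last m))
        * ∏ l : Fin m with l.val + 1 < m, ∏ j : Fin (m + 1) with j ≤ l.castSucc,
            ∏ k : Fin (m + 1) with k ≤ l.succ, qProd q n u u j k))
  * specialWeight q n u v

/-- `t_1(x^1) t_2(x^2) ⋯ t_N(x^N)`, where `t j i` stands for `t_j` at the `i`-th variable. -/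
def orderedProd {B : Type*} [Monoid B] {m : ℕ} (n : Fin (m + 1) → ℕ)
    (t : Fin (m + 1) → Idx n → B) : B :=
  (List.ofFn fun j : Fin (m + 1) => (List.ofFn fun a : Fin (n j) => t j (mkIdx n j a)).prod).prod

/-- `t_N(x^N) ⋯ t_2(x^2) t_1(x^1)`. -/
def reversedProd {B : Type*} [Monoid B] {m : ℕ} (n : Fin (m + 1) → ℕ)
    (t : Fin (m + 1) → Idx n → B) : B :=
  (List.ofFn fun j : Fin (m + 1) =>
    (List.ofFn fun a : Fin (n j.rev) => t j.rev (mkIdx n j.rev a)).prod).prod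

/-! ### The identity of formal series

`T_{ij}(u_a) = ∑_r T_{ij}[r] u_a^{-r}` is a formal power series in the variables `X_a = u_a⁻¹`.
The coefficients are rational functions of the `u_a`, i.e. elements of `ℂ(X_a)`. -/

/-- The series `∑_r t[r] u_a^{-r} = ∑_r t[r] X_a^r`. -/
def seriesAt {ι A : Type*} [DecidableEq ι] [Zero A] (t : ℕ → A) (a : ι) : MvPowerSeries ι A :=
  fun e => if e = Finsupp.single a (e a) then t (e a) else 0

/-- A scalar polynomial in the `X_a`, regarded as a (central) element of `A⟦X⟧`. -/
def scalarSeries {ι : Type*} (A : Type*) [Ring A] [Algebra ℂ A] (D : MvPolynomial ι ℂ) :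
    MvPowerSeries ι A :=
  MvPowerSeries.map (algebraMap ℂ A) (D : MvPowerSeries ι ℂ)

/-- The spectral variable `u_a = X_a⁻¹` in the field of rational functions. -/
def uVar {ι : Type*} (a : ι) : FractionRing (MvPolynomial ι ℂ) :=
  (algebraMap (MvPolynomial ι ℂ) (FractionRing (MvPolynomial ι ℂ)) (MvPolynomial.X a))⁻¹

/-- The coefficient of the summand of the partition `c`, as a rational function of the
variables; `τ c` is the chosen ordering of the partition, `v_i = u_{τ c i}`. -/
def ratCoefficient (q : ℂ) {m : ℕ} (n : Fin (m + 1) → ℕ)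
    (τ : BlockPartition n → Equiv.Perm (Idx n)) (c : BlockPartition n) :
    FractionRing (MvPolynomial (Idx n) ℂ) :=
  coefficient (algebraMap ℂ (FractionRing (MvPolynomial (Idx n) ℂ)) q) n
    uVar (fun i => uVar (τ c i))

/-- The multiple commutation relation as an identity of formal series with coefficients in `A`,
for `T_{Nj}(u) = ∑_r t j r u^{-r}`: it holds after multiplication by any common denominator `D`
of the rational coefficients (multiplication by a nonzero polynomial is injective on series). -/
def FormalRelation (q : ℂ) {m : ℕ} (n : Fin (m + 1) → ℕ)
    (τ : BlockPartition n → Equiv.Perm (Idx n))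
    {A : Type*} [Ring A] [Algebra ℂ A] (t : Fin (m + 1) → ℕ → A) : Prop :=
  ∀ (D : MvPolynomial (Idx n) ℂ) (G : BlockPartition n → MvPolynomial (Idx n) ℂ),
    (∀ c, algebraMap _ (FractionRing (MvPolynomial (Idx n) ℂ)) (G c)
      = algebraMap _ (FractionRing (MvPolynomial (Idx n) ℂ)) D * ratCoefficient q n τ c) →
    scalarSeries A D * orderedProd n (fun j i => seriesAt (t j) i)
      = ∑ c : BlockPartition n,
          scalarSeries A (G c) * reversedProd n (fun j i => seriesAt (t j) (τ c i))

/-- A nonzero common denominator exists. -/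
theorem exists_common_denominator (q : ℂ) {m : ℕ} (n : Fin (m + 1) → ℕ)
    (τ : BlockPartition n → Equiv.Perm (Idx n)) :
    ∃ (D : MvPolynomial (Idx n) ℂ) (G : BlockPartition n → MvPolynomial (Idx n) ℂ), D ≠ 0 ∧
      ∀ c, algebraMap _ (FractionRing (MvPolynomial (Idx n) ℂ)) (G c)
        = algebraMap _ (FractionRing (MvPolynomial (Idx n) ℂ)) D * ratCoefficient q n τ c := by
  obtain ⟨D, hD⟩ := IsLocalization.exist_integer_multiples_of_finite
    (nonZeroDivisors (MvPolynomial (Idx n) ℂ)) (fun c => ratCoefficient q n τ c)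
  choose G hG using hD
  exact ⟨D, G, nonZeroDivisors.coe_ne_zero D, fun c => by
    rw [hG c, Algebra.smul_def]⟩

end QAffine

end

/-! Write t_j for the entry T_{Nj}. The last row of the RTT relation closes on itself: t_j(u) and
t_j(v) commute, and for j < k the relation `Exchange` moves t_j past t_k, up to a term in which the
two arguments are interchanged. `orderedProd_eq_sum` uses nothing else, which is why the
coefficients do not depend on the representation.

The word is reordered one block at a time. Suppose the product of the first blocks is already a
combination of words decreasing in colour. The next block moves left through each such word:
`mul_commProd` treats one letter, `seqProd_mul_commProd` a whole word. By `passWeight_eq` the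
coefficient is a domain wall weight in the old arguments x and the new arguments z, times kernels (q
b - q⁻¹ a)/(a - b), up to sign, over the pairs inside z and between z and the arguments left to the
block. A layer of W has the same shape, but its kernel inside the sequence is taken in x instead of
z.

The kernel over pairs of different colours does not see reorderings inside a colour, and the kernel
inside the colours is a symmetrizer. What remains is that symmetrizing the domain wall weight inside
the colours in x or in z gives the same result (`sum_colourPerms_qWallWeight`). The symmetrizer is a
sum of words in Hecke operators of Demazure-Lusztig type (`symSum_heckeOp_apply`). By
`two_site_relation` an adjacent operator in x acts on the weight exactly as its counterpart in z.
Operators in x commute with operators in z, so a word in x acts as the reversed word in z, and the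
symmetrizer equals its own reversal (`symSum_succ_eq`, `symSum_apply_eq`).

Hence every block preserves the form "cross-colour kernel times iterated sum" (`ColourStep.step`).
The iterated sum is W up to normalization (`weight_eq_nestedSum`), and `coefficient_eq` recognizes
G. The expansion runs over all orderings of the variables; each partition occurs once for every
ordering inside its blocks, and the factorials are divided out.

For formal series the same abstract identity is applied over the field of rational functions, after
extending scalars; the extension is injective because nonzero scalar polynomials act injectively on
series. -/

namespace QAffine

open Finset

/-! ### Symmetrizers in an algebra with far-commuting generators -/

section Words

variable {R : Type*} [Ring R]

/-- The word `X_{k-i} ⋯ X_{k-2} X_{k-1}` of length `i`. -/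
def tailWord (X : ℕ → R) (k : ℕ) : ℕ → R
  | 0 => 1
  | i + 1 => X (k - 1 - i) * tailWord X k i

/-- The sum of the words `X_j X_{j+1} ⋯ X_{k-1}`, `j ≤ k`. -/
def ascSum (X : ℕ → R) (k : ℕ) : R := ∑ i ∈ range (k + 1), tailWord X k i

/-- The sum of the words `X_{k-1} ⋯ X_{j+1} X_j`, `j ≤ k`. -/
def descSum (X : ℕ → R) : ℕ → R
  | 0 => 1
  | k + 1 => 1 + X k * descSum X k

/-- The symmetrizer generated by `X_0, …, X_{k-1}`. -/
def symSum (X : ℕ → R) : ℕ → R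
  | 0 => 1
  | k + 1 => ascSum X (k + 1) * symSum X k

theorem tailWord_succ (X : ℕ → R) (k i : ℕ) (hi : i ≤ k) :
    tailWord X (k + 1) (i + 1) = tailWord X k i * X k := by
  induction i with
  | zero => simp [tailWord]
  | succ i ih =>
    rw [tailWord, ih (by omega), tailWord, mul_assoc]
    congr 2
    omega

theorem ascSum_succ (X : ℕ → R) (k : ℕ) : ascSum X (k + 1) = 1 + ascSum X k * X k := by
  rw [ascSum, sum_range_succ', ascSum, sum_mul, add_comm]
  congr 1
  exact sum_congr rfl fun i hi => tailWord_succ X k i (by simp at hi; omega)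

theorem ascSum_zero (X : ℕ → R) : ascSum X 0 = 1 := by simp [ascSum, tailWord]

theorem commute_ascSum {X : ℕ → R} {a : R} {k : ℕ} (h : ∀ i < k, Commute a (X i)) :
    Commute a (ascSum X k) := by
  induction k with
  | zero => rw [ascSum_zero]; exact Commute.one_right a
  | succ k ih =>
    rw [ascSum_succ]
    exact (Commute.one_right a).add_right
      ((ih fun i hi => h i (by omega)).mul_right (h k (by omega)))

theorem commute_symSum {X : ℕ → R} {a : R} {k : ℕ} (h : ∀ i < k, Commute a (X i)) :
    Commute a (symSum X k) := by
  induction k with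
  | zero => exact Commute.one_right a
  | succ k ih =>
    exact (commute_ascSum h).mul_right (ih fun i hi => h i (by omega))

/-- The left side peels an ascending sum off the left, the right side a descending sum off the
right, so iterating this shows that the symmetrizer equals its own reversal. Far commutation
suffices, no braid relation enters: the only move is to carry `X (k + 1)` through `symSum X k`. -/
theorem symSum_succ_eq {X : ℕ → R} (hX : ∀ i j, i + 2 ≤ j → Commute (X i) (X j)) (k : ℕ) :
    symSum X (k + 1) = symSum X k * descSum X (k + 1) := by
  induction k with
  | zero => simp [symSum, ascSum_succ, ascSum_zero, descSum]
  | succ k ih =>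
    have hc : Commute (X (k + 1)) (symSum X k) :=
      commute_symSum fun i hi => (hX i (k + 1) (by omega)).symm
    calc symSum X (k + 2) = symSum X (k + 1) + ascSum X (k + 1) * X (k + 1) * symSum X (k + 1) := by
          rw [symSum, ascSum_succ, add_mul, one_mul]
      _ = symSum X (k + 1)
            + ascSum X (k + 1) * (X (k + 1) * symSum X k) * descSum X (k + 1) := by
          rw [ih]; noncomm_ring
      _ = symSum X (k + 1) + ascSum X (k + 1) * symSum X k * X (k + 1) * descSum X (k + 1) := by
          rw [hc.eq]; noncomm_ring
      _ = symSum X (k + 1) * descSum X (k + 2) := by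
          rw [show descSum X (k + 2) = 1 + X (k + 1) * descSum X (k + 1) from rfl,
            ← show symSum X (k + 1) = ascSum X (k + 1) * symSum X k from rfl]
          noncomm_ring

end Words

/-! ### Two commuting families that agree on one vector -/

section TwoActions

variable {K M : Type*} [Field K] [AddCommGroup M] [Module K M]

/-- On `φ` the innermost `X` may be replaced by `Y` and then moved outside all remaining `X`s, so a
word in `X` acts as the reversed word in `Y`. This turns ascending sums into descending sums, and
`symSum_succ_eq` for `Y` reassembles them. -/
theorem symSum_apply_eq {X Y : ℕ → Module.End K M} {φ : M}
    (hY : ∀ i j, i + 2 ≤ j → Commute (Y i) (Y j))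
    (hXY : ∀ i j, Commute (X i) (Y j)) (hφ : ∀ i, X i φ = Y i φ) (k : ℕ) :
    symSum X k φ = symSum Y k φ := by
  have step : ∀ A A' B B' : Module.End K M, Commute A B' → A φ = B φ → A' φ = B' φ →
      (A * A') φ = (B' * B) φ := by
    intro A A' B B' hc h h'
    rw [Module.End.mul_apply, h', ← Module.End.mul_apply, hc.eq, Module.End.mul_apply, h,
      ← Module.End.mul_apply]
  have hasc : ∀ k, ascSum X k φ = descSum Y k φ ∧ ∀ j, Commute (ascSum X k) (Y j) := by
    intro k
    refine ⟨?_, fun j => (commute_ascSum fun i _ => (hXY i j).symm).symm⟩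
    induction k with
    | zero => rw [ascSum_zero]; rfl
    | succ k ih =>
      rw [ascSum_succ, descSum, LinearMap.add_apply, LinearMap.add_apply,
        step _ _ _ _ (commute_ascSum fun i _ => (hXY i k).symm).symm ih (hφ k)]
  induction k with
  | zero => rfl
  | succ k ih =>
    rw [symSum_succ_eq hY, symSum]
    exact step _ _ _ _ (commute_symSum fun i _ => ((hasc (k + 1)).2 i)) (hasc (k + 1)).1 ih

end TwoActions

/-! ### Hecke operators on functions of a permuted sequence -/

/-- A set of configurations on which `Perm (Fin n)` acts from the right, together with an
equivariant sequence of pairwise distinct coordinates. -/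
structure PermSystem (n : ℕ) (K Ω : Type*) where
  act : Ω → Equiv.Perm (Fin n) → Ω
  act_one : ∀ ω, act ω 1 = ω
  act_act : ∀ ω σ τ, act (act ω σ) τ = act ω (σ * τ)
  coord : Ω → Fin n → K
  coord_act : ∀ ω σ i, coord (act ω σ) i = coord ω (σ i)
  coord_injective : ∀ ω, Function.Injective (coord ω)

section

variable {K : Type*} [Field K]

/-- The factor `(t a - b) / (a - b)` of the symmetrizing kernel. -/
def kernelFactor (t a b : K) : K := (t * a - b) / (a - b)

/-- The three-point identity behind `tailWord_heckeOp_apply`: it merges the two contributions of an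
adjacent operator, with and without the transposition, into a single factor. -/
theorem kernelFactor_relation (t : K) {a b k : K} (hab : a ≠ b) (hak : a ≠ k) (hbk : b ≠ k) :
    (kernelFactor t b a - 1) * (kernelFactor t k b - 1)
      + kernelFactor t a b * (kernelFactor t k a - 1)
    = (kernelFactor t k a - 1) * kernelFactor t k b := by
  have h1 : a - b ≠ 0 := sub_ne_zero.2 hab
  have h2 : b - a ≠ 0 := sub_ne_zero.2 hab.symm
  have h3 : k - a ≠ 0 := sub_ne_zero.2 hak.symm
  have h4 : k - b ≠ 0 := sub_ne_zero.2 hbk.symm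
  unfold kernelFactor
  rw [← neg_sub a b]
  field_simp
  ring

variable {n : ℕ} {Ω C : Type*} [LinearOrder C] (A : PermSystem n K Ω) (c : Fin n → C) (t : K)

/-- The Hecke operator exchanging two adjacent coordinates. -/
def adjacentOp (i j : Fin n) : Module.End K (Ω → K) where
  toFun f ω := (kernelFactor t (A.coord ω j) (A.coord ω i) - 1) * f ω
    + kernelFactor t (A.coord ω i) (A.coord ω j) * f (A.act ω (Equiv.swap i j))
  map_add' f g := by ext ω; simp; ring
  map_smul' r f := by ext ω; simp; ring

/-- The Hecke operators of adjacent coordinates of the same colour. -/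
def heckeOp (i : ℕ) : Module.End K (Ω → K) :=
  if h : i + 1 < n then
    if c ⟨i, by omega⟩ = c ⟨i + 1, h⟩ then adjacentOp A t ⟨i, by omega⟩ ⟨i + 1, h⟩ else 0
  else 0

theorem adjacentOp_apply (i j : Fin n) (f : Ω → K) (ω : Ω) :
    adjacentOp A t i j f ω = (kernelFactor t (A.coord ω j) (A.coord ω i) - 1) * f ω
    + kernelFactor t (A.coord ω i) (A.coord ω j) * f (A.act ω (Equiv.swap i j)) := rfl

theorem heckeOp_eq (i j : Fin n) (h : (i : ℕ) + 1 = j) :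
    heckeOp A c t i = if c i = c j then adjacentOp A t i j else 0 := by
  have : (i : ℕ) + 1 < n := h ▸ j.2
  have hj : (⟨i + 1, this⟩ : Fin n) = j := Fin.ext h
  simp [heckeOp, this, hj]

theorem heckeOp_commute (i j : ℕ) (hij : i + 2 ≤ j) :
    Commute (heckeOp A c t i) (heckeOp A c t j) := by
  unfold heckeOp
  split_ifs with h1 h2 h3 h4 <;> try simp
  have e1 : (⟨i, by omega⟩ : Fin n) ≠ ⟨j, by omega⟩ := by simp; omega
  have e2 : (⟨i, by omega⟩ : Fin n) ≠ ⟨j + 1, by omega⟩ := by simp; omega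
  have e3 : (⟨i + 1, by omega⟩ : Fin n) ≠ ⟨j, by omega⟩ := by simp; omega
  have e4 : (⟨i + 1, by omega⟩ : Fin n) ≠ ⟨j + 1, by omega⟩ := by simp; omega
  generalize (⟨i, _⟩ : Fin n) = a at *
  generalize (⟨i + 1, _⟩ : Fin n) = a' at *
  generalize (⟨j, _⟩ : Fin n) = b at *
  generalize (⟨j + 1, _⟩ : Fin n) = b' at *
  have hs : Equiv.swap a a' * Equiv.swap b b' = Equiv.swap b b' * Equiv.swap a a' := by
    apply Equiv.Perm.Disjoint.commute
    intro x
    by_cases hx : x = b ∨ x = b'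
    · left; rcases hx with rfl | rfl <;> simp [Equiv.swap_apply_of_ne_of_ne, *, Ne.symm]
    · right; push Not at hx; exact Equiv.swap_apply_of_ne_of_ne hx.1 hx.2
  ext f ω
  simp only [Module.End.mul_apply, adjacentOp_apply, A.act_act, A.coord_act, hs,
    Equiv.swap_apply_of_ne_of_ne e1.symm e3.symm, Equiv.swap_apply_of_ne_of_ne e2.symm e4.symm,
    Equiv.swap_apply_of_ne_of_ne e1 e2, Equiv.swap_apply_of_ne_of_ne e3 e4]
  ring

/-- Invariance under the colour-preserving permutations of the first `k` positions. -/
def InvariantBelow (k : Fin n) (h : Ω → K) : Prop :=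
  ∀ σ : Equiv.Perm (Fin n), (∀ b, c (σ b) = c b) → (∀ b, k ≤ b → σ b = b) →
    ∀ ω, h (A.act ω σ) = h ω

variable {A c}

/-- Expanding the word directly gives a term for each choice of "stay" or "swap" in every letter.
Invariance of `h` below `k` leaves only the information which position `l` is sent to `k`, and
`kernelFactor_relation` sums the terms with the same `l`. By monotonicity of `c`, equal colours at
`J` and `k` force a single colour in between; otherwise some letter of the word is zero. -/
theorem tailWord_heckeOp_apply (hc : Monotone c) {k : Fin n} {h : Ω → K}
    (hh : InvariantBelow A c k h) (i : ℕ) :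
    ∀ J : Fin n, (J : ℕ) + i = k → ∀ ω, tailWord (heckeOp A c t) k i h ω =
      if c J = c k then
        (∏ b ∈ Ioc J k, kernelFactor t (A.coord ω J) (A.coord ω b))
            * h (A.act ω (Equiv.swap J k))
          + ∑ l ∈ Ioc J k, (kernelFactor t (A.coord ω l) (A.coord ω J) - 1)
            * (∏ b ∈ (Ioc J k).erase l, kernelFactor t (A.coord ω l) (A.coord ω b))
            * h (A.act ω (Equiv.swap l k))
      else 0 := by
  induction i with
  | zero =>
    intro J hJ ω
    obtain rfl : J = k := Fin.ext (by omega)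
    have : A.act ω (Equiv.refl _) = ω := A.act_one ω
    simp [tailWord, this]
  | succ i ih =>
    intro J hJ ω
    obtain ⟨J', hJ'⟩ : ∃ J' : Fin n, (J : ℕ) + 1 = J' := ⟨⟨J + 1, by omega⟩, rfl⟩
    have hJJ' : J < J' := by rw [Fin.lt_def]; omega
    have hJ'k : J' ≤ k := by rw [Fin.le_def]; omega
    have hJk : J < k := hJJ'.trans_le hJ'k
    rw [tailWord, show (k : ℕ) - 1 - i = J by omega, heckeOp_eq A c t J J' hJ',
      Module.End.mul_apply]
    by_cases hcJ : c J = c J'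
    swap
    · have : c J ≠ c k := fun h => hcJ (le_antisymm (hc hJJ'.le) (h ▸ hc hJ'k))
      simp [hcJ, this]
    rw [if_pos hcJ, adjacentOp_apply, ih J' (by omega), ih J' (by omega), hcJ]
    by_cases hck : c J' = c k
    swap
    · simp [hck]
    simp only [if_pos hck]
    have hI : Ioc J k = insert J' (Ioc J' k) := by
      ext b; simp only [mem_Ioc, mem_insert, Fin.lt_def, Fin.le_def, Fin.ext_iff] at *; omega
    have hmem : J' ∉ Ioc J' k := by simp
    have hfix : ∀ b ∈ Ioc J' k, Equiv.swap J J' b = b := fun b hb => by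
      have := (mem_Ioc.1 hb).1
      exact Equiv.swap_apply_of_ne_of_ne (hJJ'.trans this).ne' this.ne'
    have hcol : ∀ b, c (Equiv.swap J J' b) = c b := fun b => by
      rcases eq_or_ne b J with rfl | h1
      · simp [hcJ]
      rcases eq_or_ne b J' with rfl | h2
      · simp [hcJ]
      rw [Equiv.swap_apply_of_ne_of_ne h1 h2]
    -- Conjugation moves the adjacent transposition to the right of the long one. There it only
    -- touches positions below `k`, so `h` does not see it. The same device gives `hlater`.
    have hfirst : h (A.act ω (Equiv.swap J J' * Equiv.swap J' k))
        = h (A.act ω (Equiv.swap J k)) := by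
      rcases hJ'k.eq_or_lt with rfl | hlt
      · rw [Equiv.swap_self, show (Equiv.refl (Fin n)) = 1 from rfl, mul_one]
      · have : Equiv.swap J J' * Equiv.swap J' k = Equiv.swap J k * Equiv.swap J J' := by
          rw [Equiv.mul_swap_eq_swap_mul, Equiv.swap_apply_right,
            Equiv.swap_apply_of_ne_of_ne hJk.ne' hlt.ne']
        rw [this, ← A.act_act]
        exact hh _ hcol (fun b hb => Equiv.swap_apply_of_ne_of_ne (hJk.trans_le hb).ne'
          (hlt.trans_le hb).ne') _
    have hlater : ∀ l ∈ Ioc J' k, h (A.act ω (Equiv.swap J J' * Equiv.swap l k))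
        = h (A.act ω (Equiv.swap l k)) := by
      intro l hl
      have hl' := mem_Ioc.1 hl
      have hlt : J' < k := hl'.1.trans_le hl'.2
      have : Equiv.swap J J' * Equiv.swap l k = Equiv.swap l k * Equiv.swap J J' := by
        rw [Equiv.mul_swap_eq_swap_mul, hfix l hl,
          Equiv.swap_apply_of_ne_of_ne hJk.ne' hlt.ne']
      rw [this, ← A.act_act]
      exact hh _ hcol (fun b hb => Equiv.swap_apply_of_ne_of_ne (hJk.trans_le hb).ne'
        (hlt.trans_le hb).ne') _
    have hinj := A.coord_injective ω
    simp only [A.act_act, A.coord_act, Equiv.swap_apply_right]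
    rw [hI, sum_insert hmem, erase_insert hmem, prod_insert hmem, hfirst]
    have hsum : ∑ l ∈ Ioc J' k, (kernelFactor t (A.coord ω l) (A.coord ω J) - 1)
          * (∏ b ∈ (insert J' (Ioc J' k)).erase l,
              kernelFactor t (A.coord ω l) (A.coord ω b)) * h (A.act ω (Equiv.swap l k))
        = (kernelFactor t (A.coord ω J') (A.coord ω J) - 1) *
            ∑ l ∈ Ioc J' k, (kernelFactor t (A.coord ω l) (A.coord ω J') - 1)
            * (∏ b ∈ (Ioc J' k).erase l, kernelFactor t (A.coord ω l) (A.coord ω b))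
            * h (A.act ω (Equiv.swap l k))
          + kernelFactor t (A.coord ω J) (A.coord ω J') *
            ∑ l ∈ Ioc J' k,
              (kernelFactor t (A.coord ω (Equiv.swap J J' l)) (A.coord ω J) - 1)
            * (∏ b ∈ (Ioc J' k).erase l, kernelFactor t (A.coord ω (Equiv.swap J J' l))
                (A.coord ω (Equiv.swap J J' b)))
            * h (A.act ω (Equiv.swap J J' * Equiv.swap l k)) := by
      rw [mul_sum, mul_sum, ← sum_add_distrib]
      refine sum_congr rfl fun l hl => ?_
      have hl' := mem_Ioc.1 hl
      rw [hlater l hl, hfix l hl, erase_insert_of_ne hl'.1.ne,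
        prod_insert (fun h => hmem (mem_of_mem_erase h)),
        prod_congr (f := fun b => kernelFactor t (A.coord ω l) (A.coord ω (Equiv.swap J J' b)))
          (g := fun b => kernelFactor t (A.coord ω l) (A.coord ω b)) rfl
          fun b hb => by rw [hfix b (mem_of_mem_erase hb)]]
      linear_combination (-(∏ b ∈ (Ioc J' k).erase l, kernelFactor t (A.coord ω l) (A.coord ω b))
        * h (A.act ω (Equiv.swap l k))) * kernelFactor_relation t (hinj.ne hJJ'.ne)
          (hinj.ne (hJJ'.trans hl'.1).ne) (hinj.ne hl'.1.ne)
    have hprod : ∏ b ∈ Ioc J' k, kernelFactor t (A.coord ω J) (A.coord ω (Equiv.swap J J' b))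
        = ∏ b ∈ Ioc J' k, kernelFactor t (A.coord ω J) (A.coord ω b) :=
      prod_congr rfl fun b hb => by rw [hfix b hb]
    rw [hsum, hprod]
    ring

/-- The sum telescopes: lengthening the range to `J` adds to the coefficient of `l` the factor
`kernelFactor - 1` at the pair `l, J`, and the coefficient already present cancels the `-1`. -/
theorem sum_tailWord_heckeOp_apply (hc : Monotone c) {k : Fin n} {h : Ω → K}
    (hh : InvariantBelow A c k h) (m : ℕ) :
    ∀ J : Fin n, (J : ℕ) + m = k → ∀ ω,
      (∑ i ∈ range (m + 1), tailWord (heckeOp A c t) k i) h ω =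
        ∑ l ∈ Icc J k with c l = c k,
          (∏ b ∈ (Icc J k).erase l with c b = c k, kernelFactor t (A.coord ω l) (A.coord ω b))
            * h (A.act ω (Equiv.swap l k)) := by
  induction m with
  | zero =>
    intro J hJ ω
    obtain rfl : J = k := Fin.ext (by omega)
    have : A.act ω (Equiv.refl _) = ω := A.act_one ω
    simp [tailWord, this, filter_singleton]
  | succ m ih =>
    intro J hJ ω
    obtain ⟨J', hJ'⟩ : ∃ J' : Fin n, (J : ℕ) + 1 = J' := ⟨⟨J + 1, by omega⟩, rfl⟩
    rw [sum_range_succ, LinearMap.add_apply, Pi.add_apply, ih J' (by omega),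
      tailWord_heckeOp_apply t hc hh _ J (by omega)]
    have hI : Icc J k = insert J (Ioc J k) := by
      ext b; simp only [mem_Ioc, mem_Icc, mem_insert, Fin.lt_def, Fin.le_def, Fin.ext_iff] at *
      omega
    have hI' : Icc J' k = Ioc J k := by
      ext b; simp only [mem_Ioc, mem_Icc, Fin.lt_def, Fin.le_def] at *
      omega
    have hmem : J ∉ Ioc J k := by simp
    rw [hI, hI', filter_insert]
    by_cases hcJ : c J = c k
    · have hall : ∀ b ∈ Ioc J k, c b = c k := fun b hb =>
        le_antisymm (hc (mem_Ioc.1 hb).2) (hcJ ▸ hc (mem_Ioc.1 hb).1.le)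
      rw [if_pos hcJ, if_pos hcJ, filter_true_of_mem hall, sum_insert hmem, erase_insert hmem,
        filter_true_of_mem hall, add_left_comm, ← sum_add_distrib]
      congr 1
      refine sum_congr rfl fun l hl => ?_
      rw [filter_true_of_mem fun b hb => hall b (mem_of_mem_erase hb),
        erase_insert_of_ne (mem_Ioc.1 hl).1.ne, filter_insert, if_pos hcJ,
        filter_true_of_mem fun b hb => hall b (mem_of_mem_erase hb),
        prod_insert (fun h => hmem (mem_of_mem_erase h))]
      ring
    · rw [if_neg hcJ, if_neg hcJ, add_zero]
      refine sum_congr rfl fun l hl => ?_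
      congr 1
      refine prod_congr ?_ fun _ _ => rfl
      ext b
      simp only [mem_filter, mem_erase, mem_insert]
      refine ⟨fun h => ⟨⟨h.1.1, Or.inr h.1.2⟩, h.2⟩, fun h => ⟨⟨h.1.1, ?_⟩, h.2⟩⟩
      rcases h.1.2 with rfl | h'
      · exact absurd h.2 hcJ
      · exact h'

theorem ascSum_heckeOp_apply (hc : Monotone c) {k : Fin n} {h : Ω → K}
    (hh : InvariantBelow A c k h) (ω : Ω) :
    ascSum (heckeOp A c t) k h ω =
        ∑ l ∈ Iic k with c l = c k,
          (∏ b ∈ (Iic k).erase l with c b = c k, kernelFactor t (A.coord ω l) (A.coord ω b))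
            * h (A.act ω (Equiv.swap l k)) := by
  have h0 : 0 < n := (Nat.zero_le _).trans_lt k.2
  have : Finset.Iic k = Finset.Icc (⟨0, h0⟩ : Fin n) k := by
    ext b
    rw [Finset.mem_Iic, Finset.mem_Icc]
    exact ⟨fun h => ⟨Nat.zero_le _, h⟩, fun h => h.2⟩
  rw [this]
  exact sum_tailWord_heckeOp_apply t hc hh k ⟨0, h0⟩ (by simp) ω

end

/-! ### The symmetrizer of Hecke operators as a sum over colour-preserving permutations -/

section

variable {K : Type*} [Field K] {n : ℕ} {Ω C : Type*} [LinearOrder C]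
  {A : PermSystem n K Ω} {c : Fin n → C} (t : K)

/-- The colour-preserving permutations fixing all positions above `k`. -/
def colourPermsUpTo (c : Fin n → C) (k : Fin n) : Finset (Equiv.Perm (Fin n)) :=
  univ.filter fun σ => (∀ b, c (σ b) = c b) ∧ ∀ b, k < b → σ b = b

theorem mem_colourPermsUpTo {k : Fin n} {σ : Equiv.Perm (Fin n)} :
    σ ∈ colourPermsUpTo c k ↔ (∀ b, c (σ b) = c b) ∧ ∀ b, k < b → σ b = b := by
  simp [colourPermsUpTo]

/-- The symmetrizing kernel within the colours, for the positions up to `k`. -/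
def colourKernelUpTo (A : PermSystem n K Ω) (c : Fin n → C) (t : K) (k : Fin n) (ω : Ω) : K :=
  ∏ a ∈ Iic k, ∏ b ∈ Iio a with c b = c a, kernelFactor t (A.coord ω a) (A.coord ω b)

theorem perm_le_iff {k : Fin n} {σ : Equiv.Perm (Fin n)} (h : ∀ b, k < b → σ b = b) (b : Fin n) :
    σ b ≤ k ↔ b ≤ k := by
  refine ⟨fun hb => ?_, fun hb => ?_⟩
  · by_contra hk
    rw [h b (not_le.1 hk)] at hb
    exact hk hb
  · by_contra hk
    have := σ.injective (h _ (not_le.1 hk))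
    rw [this] at hk
    exact hk hb

/-- Induction along the chain of Young subgroups. The symmetrizer up to the previous position is
invariant under that subgroup, so `ascSum_heckeOp_apply` applies to it, and the transpositions with
the new position are coset representatives. -/
theorem symSum_heckeOp_apply (hc : Monotone c) (f : Ω → K) (i : ℕ) :
    ∀ k : Fin n, (k : ℕ) = i → ∀ ω, symSum (heckeOp A c t) i f ω =
      ∑ σ ∈ colourPermsUpTo c k, colourKernelUpTo A c t k (A.act ω σ) * f (A.act ω σ) := by
  induction i with
  | zero =>
    intro k hk ω
    have h1 : colourPermsUpTo c k = {1} := by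
      ext σ
      rw [mem_colourPermsUpTo, mem_singleton]
      refine ⟨fun h => ?_, by rintro rfl; simp⟩
      have h0 : ∀ b, k < b → σ b = b := h.2
      ext b
      rcases eq_or_ne b k with rfl | hb
      · have := (perm_le_iff h0 b).2 le_rfl
        rw [Fin.le_def] at this
        simp; omega
      · rw [h0 b (lt_of_le_of_ne (by rw [Fin.le_def]; omega) hb.symm)]; rfl
    have h2 : ∀ ω, colourKernelUpTo A c t k ω = 1 := fun ω => by
      refine prod_eq_one fun a ha => prod_eq_one fun b hb => ?_
      simp only [mem_Iic, mem_filter, mem_Iio, Fin.le_def, Fin.lt_def] at ha hb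
      omega
    simp [h1, h2, symSum, A.act_one]
  | succ i ih =>
    intro k' hk' ω
    obtain ⟨k, hk⟩ : ∃ k : Fin n, (k : ℕ) = i := ⟨⟨i, by omega⟩, rfl⟩
    have hkk' : ∀ b : Fin n, k < b ↔ k' ≤ b := fun b => by
      rw [Fin.lt_def, Fin.le_def]; omega
    have hinv : InvariantBelow A c k' (symSum (heckeOp A c t) i f) := by
      intro ρ hρc hρ ω
      rw [ih k hk, ih k hk]
      simp only [A.act_act]
      refine sum_bij' (fun σ _ => ρ * σ) (fun σ _ => ρ⁻¹ * σ) ?_ ?_ ?_ ?_ ?_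
      · intro σ hσ
        rw [mem_colourPermsUpTo] at hσ ⊢
        refine ⟨fun b => by rw [Equiv.Perm.mul_apply, hρc, hσ.1], fun b hb => ?_⟩
        rw [Equiv.Perm.mul_apply, hσ.2 b hb, hρ b ((hkk' b).1 hb)]
      · intro σ hσ
        rw [mem_colourPermsUpTo] at hσ ⊢
        refine ⟨fun b => ?_, fun b hb => ?_⟩
        · rw [Equiv.Perm.mul_apply, ← hρc, (by simp : ρ (ρ⁻¹ (σ b)) = σ b), hσ.1]
        · rw [Equiv.Perm.mul_apply, hσ.2 b hb, Equiv.Perm.inv_eq_iff_eq,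
            hρ b ((hkk' b).1 hb)]
      · intro σ _; simp
      · intro σ _; simp
      · intro σ _; rfl
    rw [symSum, Module.End.mul_apply, ← hk', ascSum_heckeOp_apply t hc hinv]
    simp only [ih k hk, mul_sum]
    rw [← sum_product']
    -- Coset decomposition: `l = π k'` determines the transposition, and what is left fixes `k'`.
    refine sum_bij' (fun p _ => Equiv.swap p.1 k' * p.2)
      (fun π _ => (π k', Equiv.swap (π k') k' * π)) ?_ ?_ ?_ ?_ ?_
    · rintro ⟨l, σ⟩ hp
      simp only [mem_product, mem_filter, mem_Iic, mem_colourPermsUpTo] at hp ⊢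
      obtain ⟨⟨hl, hcl⟩, hσc, hσ⟩ := hp
      refine ⟨fun b => ?_, fun b hb => ?_⟩
      · rw [Equiv.Perm.mul_apply, ← hσc b, Equiv.swap_apply_def]
        split_ifs with h1 h2
        · rw [h1, hcl]
        · rw [h2, hcl]
        · rfl
      · rw [Equiv.Perm.mul_apply, hσ b ((hkk' b).2 hb.le)]
        exact Equiv.swap_apply_of_ne_of_ne (hl.trans_lt hb).ne' hb.ne'
    · intro π hπ
      rw [mem_colourPermsUpTo] at hπ
      simp only [mem_product, mem_filter, mem_Iic, mem_colourPermsUpTo]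
      have hl := (perm_le_iff hπ.2 k').2 le_rfl
      refine ⟨⟨hl, hπ.1 k'⟩, fun b => ?_, fun b hb => ?_⟩
      · rw [Equiv.Perm.mul_apply, ← hπ.1 b, Equiv.swap_apply_def]
        split_ifs with h1 h2
        · rw [h1, hπ.1]
        · rw [h2, hπ.1]
        · rfl
      · rw [Equiv.Perm.mul_apply]
        rcases ((hkk' b).1 hb).eq_or_lt with rfl | hlt
        · simp
        · rw [hπ.2 b hlt]
          exact Equiv.swap_apply_of_ne_of_ne (hl.trans_lt hlt).ne' hlt.ne'
    · rintro ⟨l, σ⟩ hp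
      simp only [mem_product, mem_filter, mem_Iic, mem_colourPermsUpTo] at hp
      have : σ k' = k' := hp.2.2 k' ((hkk' k').2 le_rfl)
      simp [this]
    · intro π _; simp
    · rintro ⟨l, σ⟩ hp
      simp only [mem_product, mem_filter, mem_Iic, mem_colourPermsUpTo] at hp
      obtain ⟨⟨hl, hcl⟩, hσc, hσ⟩ := hp
      have hσk : σ k' = k' := hσ k' ((hkk' k').2 le_rfl)
      simp only [A.act_act]
      rw [← mul_assoc]
      congr 1
      set π := Equiv.swap l k' * σ with hπ
      have hπk : π k' = l := by simp [hπ, hσk]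
      have hπc : ∀ b, c (π b) = c b := fun b => by
        rw [hπ, Equiv.Perm.mul_apply, ← hσc b, Equiv.swap_apply_def]
        split_ifs with h1 h2
        · rw [h1, hcl]
        · rw [h2, hcl]
        · rfl
      have hπf : ∀ b, k' < b → π b = b := fun b hb => by
        rw [hπ, Equiv.Perm.mul_apply, hσ b ((hkk' b).2 hb.le)]
        exact Equiv.swap_apply_of_ne_of_ne (hl.trans_lt hb).ne' hb.ne'
      have hI : Iic k' = insert k' (Iic k) := by
        ext b; simp only [mem_Iic, mem_insert, Fin.le_def, Fin.ext_iff]; omega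
      have hmem : k' ∉ Iic k := by simp only [mem_Iic, Fin.le_def]; omega
      rw [colourKernelUpTo, colourKernelUpTo]
      conv_rhs => rw [hI, prod_insert hmem]
      congr 1
      simp only [A.coord_act, hπk]
      refine (prod_equiv π (fun b => ?_) fun b _ => rfl).symm
      simp only [mem_filter, mem_Iio, mem_erase, mem_Iic, hπc, perm_le_iff hπf]
      rw [← hπk, π.injective.ne_iff, lt_iff_le_and_ne, and_comm (a := b ≤ k')]

end

/-! ### The domain wall weight and its two symmetrizations -/

section

variable {K : Type*} [Field K]

/-- The elementary factor of the domain wall weight. -/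
def wallFactor {P : Type*} [LinearOrder P] (t : K) (a j : P) (x z : K) : K :=
  if j < a then x - z else if a < j then t * x - z else 1

/-- The domain wall weight of the identity matching. -/
def wallWeight {P : Type*} [Fintype P] [LinearOrder P] (t : K) (x z : P → K) : K :=
  ∏ p : P × P, wallFactor t p.1 p.2 (x p.1) (z p.2)

variable {n : ℕ} {C : Type*} [LinearOrder C]

/-- Permutations of the first of two sequences of distinct elements. -/
def leftSystem (n : ℕ) (K : Type*) : PermSystem n K ((Fin n ↪ K) × (Fin n ↪ K)) where
  act ω σ := (σ.toEmbedding.trans ω.1, ω.2)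
  act_one _ := rfl
  act_act _ _ _ := rfl
  coord ω := ω.1
  coord_act _ _ _ := rfl
  coord_injective ω := ω.1.injective

/-- Permutations of the second of two sequences of distinct elements. -/
def rightSystem (n : ℕ) (K : Type*) : PermSystem n K ((Fin n ↪ K) × (Fin n ↪ K)) where
  act ω σ := (ω.1, σ.toEmbedding.trans ω.2)
  act_one _ := rfl
  act_act _ _ _ := rfl
  coord ω := ω.2
  coord_act _ _ _ := rfl
  coord_injective ω := ω.2.injective

/-- Since `i` and `j` are adjacent, every other position lies on the same side of both. -/
theorem wallFactor_swap_left (t : K) {i j : Fin n} (h : (i : ℕ) + 1 = j) (a b : Fin n)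
    (hab : ¬((a = i ∨ a = j) ∧ (b = i ∨ b = j))) (x z : K) :
    wallFactor t (Equiv.swap i j a) b x z = wallFactor t a b x z := by
  have e : (Equiv.swap i j a < b ↔ a < b) ∧ (b < Equiv.swap i j a ↔ b < a) := by
    rw [Equiv.swap_apply_def]
    simp only [Fin.ext_iff, Fin.lt_def] at *
    split_ifs <;> omega
  simp only [wallFactor, e.1, e.2]

theorem wallFactor_swap_right (t : K) {i j : Fin n} (h : (i : ℕ) + 1 = j) (a b : Fin n)
    (hab : ¬((a = i ∨ a = j) ∧ (b = i ∨ b = j))) (x z : K) :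
    wallFactor t a (Equiv.swap i j b) x z = wallFactor t a b x z := by
  have e : (Equiv.swap i j b < a ↔ b < a) ∧ (a < Equiv.swap i j b ↔ a < b) := by
    rw [Equiv.swap_apply_def]
    simp only [Fin.ext_iff, Fin.lt_def] at *
    split_ifs <;> omega
  simp only [wallFactor, e.1, e.2]

theorem swap_eq_or_iff {P : Type*} [DecidableEq P] (i j a : P) :
    (Equiv.swap i j a = i ∨ Equiv.swap i j a = j) ↔ (a = i ∨ a = j) := by
  rw [Equiv.swap_apply_def]
  split_ifs <;> simp_all

/-- The part of the domain wall weight away from two positions. -/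
def wallRest (t : K) (i j : Fin n) (x z : Fin n → K) : K :=
  ∏ p : Fin n × Fin n with ¬((p.1 = i ∨ p.1 = j) ∧ (p.2 = i ∨ p.2 = j)),
    wallFactor t p.1 p.2 (x p.1) (z p.2)

theorem wallWeight_eq_rest (t : K) {i j : Fin n} (h : (i : ℕ) + 1 = j) (x z : Fin n → K) :
    wallWeight t x z = wallRest t i j x z * ((x j - z i) * (t * x i - z j)) := by
  have hij : i < j := by rw [Fin.lt_def]; omega
  rw [wallWeight, ← prod_filter_mul_prod_filter_not univ
    (fun p : Fin n × Fin n => (p.1 = i ∨ p.1 = j) ∧ (p.2 = i ∨ p.2 = j)), mul_comm]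
  congr 1
  have : (univ.filter fun p : Fin n × Fin n => (p.1 = i ∨ p.1 = j) ∧ (p.2 = i ∨ p.2 = j))
      = ({i, j} : Finset (Fin n)) ×ˢ {i, j} := by
    ext p; simp
  rw [this, prod_product, prod_pair hij.ne, prod_pair hij.ne, prod_pair hij.ne]
  simp only [wallFactor, lt_irrefl, if_false, if_pos hij, if_neg hij.not_gt]
  ring

theorem wallRest_swap_left (t : K) {i j : Fin n} (h : (i : ℕ) + 1 = j) (x z : Fin n → K) :
    wallRest t i j (fun a => x (Equiv.swap i j a)) z = wallRest t i j x z := by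
  refine prod_equiv ((Equiv.swap i j).prodCongr (Equiv.refl _)) (fun p => ?_) fun p hp => ?_
  · simp only [mem_filter, mem_univ, true_and, Equiv.prodCongr_apply, Prod.map, swap_eq_or_iff,
      Equiv.refl_apply]
  · simp only [mem_filter, mem_univ, true_and] at hp
    simp only [Equiv.prodCongr_apply, Prod.map, Equiv.refl_apply]
    rw [wallFactor_swap_left t h _ _ hp]

theorem wallRest_swap_right (t : K) {i j : Fin n} (h : (i : ℕ) + 1 = j) (x z : Fin n → K) :
    wallRest t i j x (fun a => z (Equiv.swap i j a)) = wallRest t i j x z := by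
  refine prod_equiv ((Equiv.refl _).prodCongr (Equiv.swap i j)) (fun p => ?_) fun p hp => ?_
  · simp only [mem_filter, mem_univ, true_and, Equiv.prodCongr_apply, Prod.map, swap_eq_or_iff,
      Equiv.refl_apply]
  · simp only [mem_filter, mem_univ, true_and] at hp
    simp only [Equiv.prodCongr_apply, Prod.map, Equiv.refl_apply]
    rw [wallFactor_swap_right t h _ _ hp]

/-- The only explicit computation with the weight: on two adjacent sites the Hecke operator in x and
the one in z give the same result. -/
theorem two_site_relation (t : K) {x₁ x₂ z₁ z₂ : K} (hx : x₁ ≠ x₂) (hz : z₁ ≠ z₂) :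
    (kernelFactor t x₂ x₁ - 1) * ((x₂ - z₁) * (t * x₁ - z₂))
      + kernelFactor t x₁ x₂ * ((x₁ - z₁) * (t * x₂ - z₂))
    = (kernelFactor t z₂ z₁ - 1) * ((x₂ - z₁) * (t * x₁ - z₂))
      + kernelFactor t z₁ z₂ * ((x₂ - z₂) * (t * x₁ - z₁)) := by
  have h1 : x₁ - x₂ ≠ 0 := sub_ne_zero.2 hx
  have h2 : x₂ - x₁ ≠ 0 := sub_ne_zero.2 hx.symm
  have h3 : z₁ - z₂ ≠ 0 := sub_ne_zero.2 hz
  have h4 : z₂ - z₁ ≠ 0 := sub_ne_zero.2 hz.symm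
  unfold kernelFactor
  rw [← neg_sub x₁ x₂, ← neg_sub z₁ z₂]
  field_simp
  ring

/-- All factors except those pairing the two adjacent sites with each other are unchanged by either
transposition, which reduces the claim to `two_site_relation`. -/
theorem heckeOp_wallWeight (t : K) (c : Fin n → C) (i : ℕ) :
    heckeOp (leftSystem n K) c t i (fun ω => wallWeight t ω.1 ω.2)
      = heckeOp (rightSystem n K) c t i (fun ω => wallWeight t ω.1 ω.2) := by
  unfold heckeOp
  split_ifs with h1 h2
  · generalize hi : (⟨i, _⟩ : Fin n) = a
    generalize hj : (⟨i + 1, _⟩ : Fin n) = b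
    have h : (a : ℕ) + 1 = b := by rw [← hi, ← hj]
    have hab : a ≠ b := fun e => by rw [e] at h; omega
    ext ω
    have e1 : wallWeight t ((leftSystem n K).act ω (Equiv.swap a b)).1
        ((leftSystem n K).act ω (Equiv.swap a b)).2
        = wallRest t a b ω.1 ω.2 * ((ω.1 a - ω.2 a) * (t * ω.1 b - ω.2 b)) := by
      rw [wallWeight_eq_rest t h, ← wallRest_swap_left t h ω.1 ω.2]
      simp only [leftSystem, Function.Embedding.trans_apply, Equiv.coe_toEmbedding,
        Equiv.swap_apply_left, Equiv.swap_apply_right]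
      rfl
    have e2 : wallWeight t ((rightSystem n K).act ω (Equiv.swap a b)).1
        ((rightSystem n K).act ω (Equiv.swap a b)).2
        = wallRest t a b ω.1 ω.2 * ((ω.1 b - ω.2 b) * (t * ω.1 a - ω.2 a)) := by
      rw [wallWeight_eq_rest t h, ← wallRest_swap_right t h ω.1 ω.2]
      simp only [rightSystem, Function.Embedding.trans_apply, Equiv.coe_toEmbedding,
        Equiv.swap_apply_left, Equiv.swap_apply_right]
      rfl
    rw [adjacentOp_apply, adjacentOp_apply, e1, e2, wallWeight_eq_rest t h]
    simp only [show (leftSystem n K).coord ω = ω.1 from rfl,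
      show (rightSystem n K).coord ω = ω.2 from rfl]
    linear_combination wallRest t a b ω.1 ω.2 *
      two_site_relation t (ω.1.injective.ne hab) (ω.2.injective.ne hab)
  · rfl
  · rfl

/-- The symmetrizing kernel within the colours. -/
def colourKernel {P : Type*} [Fintype P] [LinearOrder P] (t : K) (c : P → C) (x : P → K) : K :=
  ∏ a : P, ∏ b : P with b < a ∧ c b = c a, kernelFactor t (x a) (x b)

theorem sum_colourPerms_fin (t : K) {c : Fin n → C} (hc : Monotone c) {x z : Fin n → K}
    (hx : Function.Injective x) (hz : Function.Injective z) :
    ∑ σ : Equiv.Perm (Fin n) with ∀ b, c (σ b) = c b,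
        colourKernel t c (x ∘ σ) * wallWeight t (x ∘ σ) z
      = ∑ σ : Equiv.Perm (Fin n) with ∀ b, c (σ b) = c b,
        colourKernel t c (z ∘ σ) * wallWeight t x (z ∘ σ) := by
  -- The formula for the symmetrizer is indexed by a last position, which does not exist for `n =
  -- 0`.
  rcases n with _ | n
  · refine sum_congr rfl fun σ _ => ?_
    rw [Subsingleton.elim (x ∘ σ) (z ∘ σ), Subsingleton.elim (z ∘ σ) z, Subsingleton.elim z x]
  have key := congrFun (symSum_apply_eq (X := heckeOp (leftSystem (n + 1) K) c t)
    (Y := heckeOp (rightSystem (n + 1) K) c t) (φ := fun ω => wallWeight t ω.1 ω.2)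
    (heckeOp_commute _ c t) ?_ (heckeOp_wallWeight t c) n) (⟨x, hx⟩, ⟨z, hz⟩)
  · rw [symSum_heckeOp_apply t hc _ n (Fin.last n) rfl,
      symSum_heckeOp_apply t hc _ n (Fin.last n) rfl] at key
    have hG : colourPermsUpTo c (Fin.last n)
        = univ.filter fun σ : Equiv.Perm (Fin (n + 1)) => ∀ b, c (σ b) = c b := by
      ext σ
      rw [mem_colourPermsUpTo]
      simp [(Fin.le_last _).not_gt]
    have hk : ∀ (B : PermSystem (n + 1) K ((Fin (n + 1) ↪ K) × (Fin (n + 1) ↪ K))) ω,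
        colourKernelUpTo B c t (Fin.last n) ω = colourKernel t c (B.coord ω) := by
      intro B ω
      refine prod_congr (by ext; simp [Fin.le_last]) fun a _ => prod_congr ?_ fun _ _ => rfl
      ext; simp
    rw [hG] at key
    simp only [hk] at key
    exact key
  · intro i j
    unfold heckeOp
    split_ifs <;> try simp
    ext f ω
    simp only [Module.End.mul_apply, adjacentOp_apply, leftSystem, rightSystem]
    ring

/-- The kernel `(q a - q⁻¹ b) / (a - b)`. -/
def qKernel (q a b : K) : K := (q * a - q⁻¹ * b) / (a - b)

theorem qKernel_eq {q : K} (hq : q ≠ 0) (a b : K) :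
    qKernel q a b = q⁻¹ * kernelFactor (q ^ 2) a b := by
  rw [qKernel, kernelFactor, mul_div_assoc']
  congr 1
  field_simp

/-- The symmetrizing kernel within the colours, in the symmetric normalization. -/
def qColourKernel {P : Type*} [Fintype P] [LinearOrder P] (q : K) (c : P → C) (x : P → K) : K :=
  ∏ a : P, ∏ b : P with b < a ∧ c b = c a, qKernel q (x a) (x b)

/-- The domain wall weight of the identity matching, in the symmetric normalization. -/
def qWallWeight {P : Type*} [Fintype P] [LinearOrder P] (q : K) (x z : P → K) : K :=
  ∏ a : P, (∏ b : P with b < a, (x a - z b)) * ∏ b : P with a < b, (q * x a - q⁻¹ * z b)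

theorem qWallWeight_eq {P : Type*} [Fintype P] [LinearOrder P] {q : K} (hq : q ≠ 0)
    (x z : P → K) :
    qWallWeight q x z
      = (∏ a : P, ∏ b : P with a < b, q⁻¹) * wallWeight (q ^ 2) x z := by
  rw [qWallWeight, wallWeight, Fintype.prod_prod_type, ← prod_mul_distrib]
  refine prod_congr rfl fun a _ => ?_
  have h1 : ∏ b : P with a < b, (q * x a - q⁻¹ * z b)
      = (∏ b : P with a < b, q⁻¹) * ∏ b : P with a < b, (q ^ 2 * x a - z b) := by
    rw [← prod_mul_distrib]
    refine prod_congr rfl fun b _ => ?_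
    field_simp
  rw [h1, mul_left_comm]
  congr 1
  rw [prod_filter, prod_filter, ← prod_mul_distrib]
  refine prod_congr rfl fun b _ => ?_
  unfold wallFactor
  rcases lt_trichotomy a b with h | h | h <;> simp [h, h.not_gt]

theorem qColourKernel_eq {P : Type*} [Fintype P] [LinearOrder P] {q : K} (hq : q ≠ 0)
    (c : P → C) (x : P → K) :
    qColourKernel q c x
      = (∏ a : P, ∏ b : P with b < a ∧ c b = c a, q⁻¹) * colourKernel (q ^ 2) c x := by
  simp only [qColourKernel, colourKernel, ← prod_mul_distrib, qKernel_eq hq]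

theorem qColourKernel_comp {P P' : Type*} [Fintype P] [LinearOrder P] [Fintype P']
    [LinearOrder P'] (e : P' ≃o P) (q : K) (c : P → C) (x : P → K) :
    qColourKernel q (c ∘ e) (x ∘ e) = qColourKernel q c x := by
  refine Fintype.prod_equiv e.toEquiv _ _ fun a => ?_
  refine prod_equiv e.toEquiv (fun b => ?_) fun _ _ => rfl
  simp

theorem qWallWeight_comp {P P' : Type*} [Fintype P] [LinearOrder P] [Fintype P']
    [LinearOrder P'] (e : P' ≃o P) (q : K) (x z : P → K) :
    qWallWeight q (x ∘ e) (z ∘ e) = qWallWeight q x z := by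
  refine Fintype.prod_equiv e.toEquiv _ _ fun a => ?_
  congr 1
  · exact prod_equiv e.toEquiv (fun b => by simp) fun _ _ => rfl
  · exact prod_equiv e.toEquiv (fun b => by simp) fun _ _ => rfl

/-- Symmetrizing the domain wall weight within the colours in the first set of variables is the
same as symmetrizing it in the second set. -/
theorem sum_colourPerms_qWallWeight {P : Type*} [Fintype P] [LinearOrder P] {q : K} (hq : q ≠ 0)
    {c : P → C} (hc : Monotone c) {x z : P → K}
    (hx : Function.Injective x) (hz : Function.Injective z) :
    ∑ σ : Equiv.Perm P with ∀ b, c (σ b) = c b,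
        qColourKernel q c (x ∘ σ) * qWallWeight q (x ∘ σ) z
      = ∑ σ : Equiv.Perm P with ∀ b, c (σ b) = c b,
        qColourKernel q c (z ∘ σ) * qWallWeight q x (z ∘ σ) := by
  -- Both sides depend only on the order of `P`, so it may be replaced by an initial segment.
  -- Passing from `t = q ^ 2` to the symmetric normalization costs a power of `q⁻¹` that is the same
  -- for all permutations and on both sides.
  let e := Fintype.orderIsoFinOfCardEq P rfl
  have hfin : ∑ σ : Equiv.Perm (Fin (Fintype.card P)) with ∀ b, (c ∘ e) (σ b) = (c ∘ e) b,
        qColourKernel q (c ∘ e) ((x ∘ e) ∘ σ) * qWallWeight q ((x ∘ e) ∘ σ) (z ∘ e)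
      = ∑ σ : Equiv.Perm (Fin (Fintype.card P)) with ∀ b, (c ∘ e) (σ b) = (c ∘ e) b,
        qColourKernel q (c ∘ e) ((z ∘ e) ∘ σ) * qWallWeight q (x ∘ e) ((z ∘ e) ∘ σ) := by
    have := sum_colourPerms_fin (q ^ 2) (hc.comp e.monotone)
      (hx.comp e.injective) (hz.comp e.injective)
    have factor : ∀ (s : Finset (Equiv.Perm (Fin (Fintype.card P)))) (a b : K)
        (F G : Equiv.Perm (Fin (Fintype.card P)) → K),
        ∑ σ ∈ s, a * F σ * (b * G σ) = a * b * ∑ σ ∈ s, F σ * G σ := fun s a b F G => by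
      rw [mul_sum]
      exact sum_congr rfl fun _ _ => by ring
    simp only [qColourKernel_eq hq, qWallWeight_eq hq]
    rw [factor, factor, this]
  have transfer : ∀ F : Equiv.Perm P → K,
      ∑ σ : Equiv.Perm (Fin (Fintype.card P)) with ∀ b, (c ∘ e) (σ b) = (c ∘ e) b,
        F (e.toEquiv.permCongr σ) = ∑ σ : Equiv.Perm P with ∀ b, c (σ b) = c b, F σ := by
    intro F
    refine sum_equiv e.toEquiv.permCongr (fun σ => ?_) fun _ _ => rfl
    simp only [mem_filter, mem_univ, true_and, Function.comp_apply]
    refine ⟨fun h b => ?_, fun h b => ?_⟩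
    · simpa [Equiv.permCongr_apply] using h (e.symm b)
    · simpa [Equiv.permCongr_apply] using h (e b)
  rw [← transfer, ← transfer]
  convert hfin using 2 with σ _ σ _
  · rw [← qColourKernel_comp e, ← qWallWeight_comp e]
    congr 2 <;> ext a <;> simp [Equiv.permCongr_apply]
  · rw [← qColourKernel_comp e, ← qWallWeight_comp e]
    congr 2 <;> ext a <;> simp [Equiv.permCongr_apply]

end

/-! ### Moving a product of commuting operators through a sequence of operators -/

section

variable {K B ι : Type*} [Field K] [Ring B] [Algebra K B] [DecidableEq ι]

/-- The exchange relation of `X` with a family `T` of operators of a higher colour. -/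
def Exchange (q : K) (u : ι → K) (T X : ι → B) : Prop :=
  ∀ a b, a ≠ b → (u b - u a) • (X a * T b)
    = (q * u b - q⁻¹ * u a) • (T b * X a) - ((q - q⁻¹) * u a) • (T a * X b)

/-- The product of a commuting family over a finite set. -/
def commProd (T : ι → B) (hT : ∀ a b, Commute (T a) (T b)) (s : Finset ι) : B :=
  s.noncommProd T fun a _ b _ _ => hT a b

theorem commProd_insert (T : ι → B) (hT : ∀ a b, Commute (T a) (T b)) {s : Finset ι} {a : ι}
    (ha : a ∉ s) : commProd T hT (insert a s) = T a * commProd T hT s :=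
  noncommProd_insert_of_notMem _ _ _ _ ha

/-- The coefficient of `T(x, s without z) X(z)` in `X(x) T(s)`. -/
def passCoeff (q : K) (u : ι → K) (x z : ι) (s : Finset ι) : K :=
  u x / u z * ((∏ w ∈ s, (q * u w - q⁻¹ * u z)) / ∏ w ∈ (insert x s).erase z, (u w - u z))

/-- The standard argument of the algebraic Bethe ansatz, as an induction on `s`: a single exchange
produces two operators still to be moved, `X x` and `X y`, and their expansions recombine. -/
theorem mul_commProd {q : K} {u : ι → K} (hu : Function.Injective u)
    (hu0 : ∀ a, u a ≠ 0) {T X : ι → B} (hT : ∀ a b, Commute (T a) (T b))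
    (hX : Exchange q u T X) (s : Finset ι) : ∀ x ∉ s,
    X x * commProd T hT s = ∑ z ∈ insert x s,
      passCoeff q u x z s • (commProd T hT ((insert x s).erase z) * X z) := by
  induction s using Finset.induction_on with
  | empty =>
    intro x _
    have h0 : commProd T hT ∅ = 1 := noncommProd_empty _ _
    simp [passCoeff, h0, hu0]
  | insert y s hy ih =>
    intro x hx
    have hxy : x ≠ y := fun h => hx (h ▸ mem_insert_self _ _)
    have hxs : x ∉ s := fun h => hx (mem_insert_of_mem h)
    have hsub : ∀ {a b}, a ≠ b → u a - u b ≠ 0 := fun h => sub_ne_zero.2 (hu.ne h)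
    set α := (q * u y - q⁻¹ * u x) / (u y - u x) with hα
    set β := -((q - q⁻¹) * u x) / (u y - u x) with hβ
    have hswap : X x * T y = α • (T y * X x) + β • (T x * X y) := by
      have h := hX x y hxy
      have h2 : X x * T y = (u y - u x)⁻¹ • ((u y - u x) • (X x * T y)) := by
        rw [smul_smul, inv_mul_cancel₀ (hsub hxy.symm), one_smul]
      rw [h2, h, smul_sub, smul_smul, smul_smul, hα, hβ, div_eq_inv_mul, div_eq_inv_mul, mul_neg,
        neg_smul, sub_eq_add_neg]
    have hz : ∀ z ∈ s, z ≠ x ∧ z ≠ y := fun z hz =>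
      ⟨fun h => hxs (h ▸ hz), fun h => hy (h ▸ hz)⟩
    have ex : (insert x s).erase x = s := erase_insert hxs
    have ey : (insert y s).erase y = s := erase_insert hy
    have exy : (insert x (insert y s)).erase x = insert y s := erase_insert hx
    have eyx : (insert x (insert y s)).erase y = insert x s := by
      rw [erase_insert_of_ne hxy, ey]
    have hxe : ∀ z, x ∉ s.erase z := fun z h => hxs (mem_of_mem_erase h)
    have hye : ∀ z, y ∉ s.erase z := fun z h => hy (mem_of_mem_erase h)
    have e1 : ∀ z ∈ s, (insert x s).erase z = insert x (s.erase z) := fun z h =>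
      erase_insert_of_ne (hz z h).1.symm
    have e2 : ∀ z ∈ s, (insert y s).erase z = insert y (s.erase z) := fun z h =>
      erase_insert_of_ne (hz z h).2.symm
    have e3 : ∀ z ∈ s, (insert x (insert y s)).erase z = insert x (insert y (s.erase z)) :=
      fun z h => by rw [erase_insert_of_ne (hz z h).1.symm, e2 z h]
    have c1 : passCoeff q u x x (insert y s) = α * passCoeff q u x x s := by
      rw [passCoeff, passCoeff, exy, ex, prod_insert hy, prod_insert hy, hα, div_self (hu0 x),
        one_mul, one_mul, mul_div_mul_comm]
    have c2 : passCoeff q u x y (insert y s) = β * passCoeff q u y y s := by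
      rw [passCoeff, passCoeff, eyx, ey, prod_insert hy, prod_insert hxs, hβ, div_self (hu0 y),
        one_mul, ← neg_sub (u x) (u y), neg_div_neg_eq, mul_div_mul_comm, ← mul_assoc]
      congr 1
      have := hu0 y
      have := hsub hxy
      field_simp
    -- An argument `z` in `s` is reached both from `X x` and from `X y`; the two contributions add
    -- up by a partial fraction identity in x, y, z.
    have c3 : ∀ z ∈ s, passCoeff q u x z (insert y s)
        = α * passCoeff q u x z s + β * passCoeff q u y z s := by
      intro z h
      rw [passCoeff, passCoeff, passCoeff, e3 z h, e1 z h, e2 z h, prod_insert hy,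
        prod_insert (hxe z), prod_insert (hye z),
        prod_insert (by simp [hxy, hxs] : x ∉ insert y (s.erase z)), prod_insert (hye z), hα, hβ]
      have h1 := hu0 z
      have h2 := hsub (hz z h).1.symm
      have h3 := hsub (hz z h).2.symm
      have h4 := hsub hxy.symm
      have h5 : ∏ w ∈ s.erase z, (u w - u z) ≠ 0 :=
        prod_ne_zero_iff.2 fun w hw => hsub (ne_of_mem_erase hw)
      field_simp
      ring
    rw [commProd_insert T hT hy, ← mul_assoc, hswap, add_mul, smul_mul_assoc, smul_mul_assoc,
      mul_assoc, mul_assoc, ih x hxs, ih y hy, sum_insert hxs, sum_insert hy, sum_insert hx,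
      sum_insert hy, ex, ey, exy, eyx, c1, c2, commProd_insert T hT hy, commProd_insert T hT hxs]
    have hs : ∑ z ∈ s, passCoeff q u x z (insert y s)
          • (commProd T hT ((insert x (insert y s)).erase z) * X z)
        = α • (T y * ∑ z ∈ s, passCoeff q u x z s
            • (commProd T hT ((insert x s).erase z) * X z))
          + β • (T x * ∑ z ∈ s, passCoeff q u y z s
            • (commProd T hT ((insert y s).erase z) * X z)) := by
      rw [mul_sum, mul_sum, smul_sum, smul_sum, ← sum_add_distrib]
      refine sum_congr rfl fun z h => ?_
      rw [c3 z h, e3 z h, e1 z h, e2 z h,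
        commProd_insert T hT (by simp [hxy, hxs] : x ∉ insert y (s.erase z)),
        commProd_insert T hT (hye z), commProd_insert T hT (hxe z), add_smul,
        mul_smul_comm, mul_smul_comm, smul_smul, smul_smul]
      congr 2
      · rw [← mul_assoc, ← mul_assoc, ← mul_assoc, (hT x y).eq]
      · rw [← mul_assoc, ← mul_assoc, ← mul_assoc]
    rw [hs]
    simp only [mul_add, smul_add, mul_smul_comm, smul_smul, mul_assoc]
    abel

/-- The coefficient of `T(U without z) X₁(z₁) ⋯ X_M(z_M)` in
`X₁(x₁) ⋯ X_M(x_M) T(U without x)`. -/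
def seqCoeff (q : K) (u : ι → K) (U : Finset ι) {M : ℕ} (x z : Fin M → ι) : K :=
  ∏ k, ((q - q⁻¹) * u (x k) / (q * u (x k) - q⁻¹ * u (z k))
    * (∏ j with j < k, (u (x j) - u (z k)) / (q * u (x j) - q⁻¹ * u (z k))
        * qKernel q (u (z j)) (u (z k)))
    * ∏ w ∈ U \ univ.image z, qKernel q (u w) (u (z k)))

/-- The first operator meets the block last, when the block carries `insert (x 0) s` without its new
argument. Since `insert (x 0) s = insert (z 0) V`, products over `s` become products over `V`, and
the correction is exactly the `j = 0` factor of the later indices. -/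
theorem seqCoeff_cons {q : K} {u : ι → K} (hu : Function.Injective u) (hu0 : ∀ a, u a ≠ 0)
    (hq : ∀ a b, q * u a - q⁻¹ * u b ≠ 0) {U : Finset ι} {M : ℕ} {x z : Fin (M + 1) → ι}
    (hx0 : x 0 ∈ U) (hz0 : z 0 ∈ U) (hz : Function.Injective z)
    (hxz : ∀ k : Fin M, x 0 ≠ z k.succ) :
    seqCoeff q u U x z
      = seqCoeff q u (U.erase (x 0)) (Fin.tail x) (Fin.tail z)
        * passCoeff q u (x 0) (z 0) (U.erase (x 0) \ univ.image (Fin.tail z)) := by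
  set V := U \ univ.image z with hV
  set s := U.erase (x 0) \ univ.image (Fin.tail z) with hs
  have hxs : x 0 ∉ s := by simp [hs]
  have hzV : z 0 ∉ V := by simp [hV]
  have hins : insert (x 0) s = insert (z 0) V := by
    ext a
    simp only [hs, hV, mem_insert, mem_sdiff, mem_erase, mem_image, mem_univ, true_and,
      Fin.exists_fin_succ, Fin.tail]
    by_cases h1 : a = x 0
    · subst h1
      have : ∀ k : Fin M, z k.succ ≠ x 0 := fun k => (hxz k).symm
      by_cases h2 : x 0 = z 0
      · simp [h2]
      · simp [hx0, h2, this, Ne.symm h2]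
    · by_cases h2 : a = z 0
      · subst h2
        have : ∀ k : Fin M, z k.succ ≠ z 0 := fun k h => absurd (hz h) (Fin.succ_ne_zero k)
        simp [h1, hz0, this]
      · simp [h1, h2, Ne.symm h2]
  have hprod : ∀ f : ι → K, f (x 0) * ∏ w ∈ s, f w = f (z 0) * ∏ w ∈ V, f w := fun f => by
    rw [← prod_insert hxs, hins, prod_insert hzV]
  have hK : ∀ k : Fin M, ∏ w ∈ s, qKernel q (u w) (u (z k.succ))
      = (u (x 0) - u (z k.succ)) / (q * u (x 0) - q⁻¹ * u (z k.succ))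
        * qKernel q (u (z 0)) (u (z k.succ)) * ∏ w ∈ V, qKernel q (u w) (u (z k.succ)) := by
    intro k
    rw [mul_assoc, ← hprod (fun w => qKernel q (u w) (u (z k.succ))), ← mul_assoc]
    have h1 := hq (x 0) (z k.succ)
    have h2 := sub_ne_zero.2 (hu.ne (hxz k))
    rw [qKernel, div_mul_div_cancel₀ h1, div_self h2, one_mul]
  rw [seqCoeff, Fin.prod_univ_succ, mul_comm, ← hV]
  congr 1
  · refine prod_congr rfl fun k _ => ?_
    rw [← hs, show (Fin.tail z k) = z k.succ from rfl, hK k, prod_filter, Fin.prod_univ_succ,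
      if_pos (Fin.succ_pos k)]
    simp only [Fin.succ_lt_succ_iff, ← prod_filter]
    simp only [Fin.tail]
    ring
  · have h0 : (univ.filter fun j : Fin (M + 1) => j < 0) = ∅ := by ext j; simp
    rw [h0, prod_empty, passCoeff, hins, erase_insert hzV]
    have h1 := hprod (fun w => q * u w - q⁻¹ * u (z 0))
    have h2 := hq (x 0) (z 0)
    have h3 := hu0 (z 0)
    have h4 : ∏ w ∈ V, (u w - u (z 0)) ≠ 0 :=
      prod_ne_zero_iff.2 fun w hw => sub_ne_zero.2 (hu.ne fun h => hzV (h ▸ hw))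
    simp only [qKernel, prod_div_distrib]
    rw [mul_one, div_mul_div_comm, div_mul_div_comm, div_eq_div_iff (mul_ne_zero h2 h4)
      (mul_ne_zero h3 h4)]
    linear_combination (-(u (x 0) * ∏ w ∈ V, (u w - u (z 0)))) * h1

theorem seqProd_mul_commProd {q : K} {u : ι → K} (hu : Function.Injective u)
    (hu0 : ∀ a, u a ≠ 0) (hq : ∀ a b, q * u a - q⁻¹ * u b ≠ 0) {T : ι → B}
    (hT : ∀ a b, Commute (T a) (T b)) [Fintype ι] {M : ℕ} :
    ∀ (X : Fin M → ι → B), (∀ k, Exchange q u T (X k)) → ∀ (U : Finset ι) (x : Fin M → ι),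
      Function.Injective x → (∀ k, x k ∈ U) →
      (List.ofFn fun k => X k (x k)).prod * commProd T hT (U \ univ.image x)
        = ∑ z : Fin M → ι with Function.Injective z ∧ ∀ k, z k ∈ U, seqCoeff q u U x z
            • (commProd T hT (U \ univ.image z) * (List.ofFn fun k => X k (z k)).prod) := by
  induction M with
  | zero =>
    intro X _ U x _ _
    have : (univ.filter fun z : Fin 0 → ι => Function.Injective z ∧ ∀ k, z k ∈ U) = {x} := by
      ext z
      rw [mem_filter, mem_singleton]
      exact ⟨fun _ => Subsingleton.elim z x, fun _ => ⟨mem_univ _,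
        Function.injective_of_subsingleton _, fun k => k.elim0⟩⟩
    rw [this, sum_singleton]
    simp [seqCoeff]
  | succ M ih =>
    intro X hX U x hx hxU
    have hU : U \ univ.image x = U.erase (x 0) \ univ.image (Fin.tail x) := by
      ext a
      simp only [mem_sdiff, mem_erase, mem_image, mem_univ, true_and, Fin.exists_fin_succ,
        Fin.tail, not_or, ne_comm (a := a) (b := x 0)]
      tauto
    rw [List.ofFn_succ, List.prod_cons, mul_assoc, hU]
    have h := ih (fun k => X k.succ) (fun k => hX k.succ) (U.erase (x 0)) (Fin.tail x)
      (hx.comp (Fin.succ_injective M)) fun k => mem_erase.2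
        ⟨hx.ne (Fin.succ_ne_zero k), hxU k.succ⟩
    simp only [Fin.tail] at h ⊢
    rw [h, mul_sum]
    have inner : ∀ z' : Fin M → ι, X 0 (x 0) * (seqCoeff q u (U.erase (x 0)) (Fin.tail x) z'
          • (commProd T hT (U.erase (x 0) \ univ.image z')
            * (List.ofFn fun k => X k.succ (z' k)).prod))
        = ∑ z ∈ insert (x 0) (U.erase (x 0) \ univ.image z'),
          (seqCoeff q u (U.erase (x 0)) (Fin.tail x) z'
            * passCoeff q u (x 0) z (U.erase (x 0) \ univ.image z'))
          • (commProd T hT ((insert (x 0) (U.erase (x 0) \ univ.image z')).erase z)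
            * (X 0 z * (List.ofFn fun k => X k.succ (z' k)).prod)) := by
      intro z'
      rw [mul_smul_comm, ← mul_assoc, mul_commProd hu hu0 hT (hX 0) _ _ (by simp), sum_mul,
        smul_sum]
      refine sum_congr rfl fun z _ => ?_
      rw [smul_mul_assoc, smul_smul, mul_assoc]
    rw [sum_congr rfl fun z' _ => inner z', sum_sigma']
    -- The recursion never lets a later operator end at `x 0`. Such sequences can nevertheless be
    -- included in the sum, because their coefficient contains the vanishing factor `u (x 0) - u (z
    -- k.succ)`.
    rw [← sum_subset (s₁ := univ.filter fun z : Fin (M + 1) → ι =>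
      (Function.Injective z ∧ ∀ k, z k ∈ U) ∧ ∀ k : Fin M, x 0 ≠ z k.succ)]
    · refine sum_bij' (fun p _ => (Fin.cons p.2 p.1 : Fin (M + 1) → ι))
        (fun z _ => ⟨Fin.tail z, z 0⟩) ?_ ?_ ?_ ?_ ?_
      · rintro ⟨z', z0⟩ hp
        simp only [mem_sigma, mem_filter, mem_univ, true_and, mem_insert, mem_sdiff, mem_erase,
          mem_image, not_exists] at hp ⊢
        obtain ⟨⟨hinj, hz'⟩, hz0⟩ := hp
        have hx0 : ∀ k, x 0 ≠ z' k := fun k => (hz' k).1.symm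
        refine ⟨⟨?_, ?_⟩, hx0⟩
        · rw [Fin.cons_injective_iff]
          refine ⟨?_, hinj⟩
          rintro ⟨k, hk⟩
          rcases hz0 with h | h
          · exact hx0 k (h ▸ hk.symm)
          · exact h.2 k hk
        · refine Fin.cases ?_ fun k => (hz' k).2
          rcases hz0 with h | h
          · rw [h]; exact hxU 0
          · exact h.1.2
      · intro z hz
        simp only [mem_sigma, mem_filter, mem_univ, true_and, mem_insert, mem_sdiff, mem_erase,
          mem_image, not_exists] at hz ⊢
        obtain ⟨⟨hinj, hzU⟩, hx0⟩ := hz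
        refine ⟨⟨hinj.comp (Fin.succ_injective M), fun k => ⟨(hx0 k).symm, hzU _⟩⟩, ?_⟩
        by_cases h : z 0 = x 0
        · exact Or.inl h
        · exact Or.inr ⟨⟨h, hzU 0⟩, fun k hk => Fin.succ_ne_zero k (hinj hk)⟩
      · rintro ⟨z', z0⟩ _; simp
      · intro z _; simp
      · rintro ⟨z', z0⟩ hp
        simp only [mem_sigma, mem_filter, mem_univ, true_and, mem_insert, mem_sdiff, mem_erase,
          mem_image, not_exists] at hp
        obtain ⟨⟨hinj, hz'⟩, hz0⟩ := hp
        have hx0 : ∀ k, x 0 ≠ z' k := fun k => (hz' k).1.symm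
        have hz0U : z0 ∈ U := by
          rcases hz0 with h | h
          · rw [h]; exact hxU 0
          · exact h.1.2
        have hcons : Function.Injective (Fin.cons z0 z' : Fin (M + 1) → ι) := by
          rw [Fin.cons_injective_iff]
          refine ⟨?_, hinj⟩
          rintro ⟨k, hk⟩
          rcases hz0 with h | h
          · exact hx0 k (h ▸ hk.symm)
          · exact h.2 k hk
        rw [seqCoeff_cons hu hu0 hq (z := Fin.cons z0 z') (hxU 0) hz0U hcons hx0]
        simp only [Fin.cons_zero, Fin.cons_succ, Fin.tail_cons, List.ofFn_succ, List.prod_cons]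
        congr 3
        ext a
        simp only [mem_insert, mem_sdiff, mem_erase, mem_image, mem_univ, true_and,
          Fin.exists_fin_succ, Fin.cons_zero, Fin.cons_succ, not_or, not_exists]
        by_cases h1 : a = x 0
        · subst h1
          have : ∀ k, z' k ≠ x 0 := fun k => (hx0 k).symm
          simp [hxU 0, this, eq_comm]
        · simp only [h1, false_or, ne_eq, not_false_eq_true, true_and, eq_comm (a := z0)]
          tauto
    · intro z hz
      simp only [mem_filter, mem_univ, true_and] at hz ⊢
      exact hz.1
    · intro z hz hz'
      simp only [mem_filter, mem_univ, true_and] at hz hz'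
      obtain ⟨k, hk⟩ : ∃ k : Fin M, x 0 = z k.succ := by
        by_contra hne
        push Not at hne
        exact hz' ⟨hz, hne⟩
      have : seqCoeff q u U x z = 0 := by
        refine prod_eq_zero (mem_univ k.succ) ?_
        rw [prod_eq_zero (i := 0) (by simp) (by simp [hk]), mul_zero, zero_mul]
      rw [this, zero_smul]

end

/-! ### Decreasing products over a linear order and the factorized coefficient -/

section

variable {K B C : Type*} [Field K] [Ring B] [Algebra K B] [LinearOrder C]

/-- The product of a family over a finite linear order, taken in decreasing order. -/
def descProd {Q : Type*} [Fintype Q] [LinearOrder Q] (f : Q → B) : B :=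
  (((univ : Finset Q).sort (· ≥ ·)).map f).prod

theorem sort_ge_eq {Q : Type*} [LinearOrder Q] {s : Finset Q} {l : List Q}
    (hl : l.Pairwise (· > ·)) (hs : l.toFinset = s) : s.sort (· ≥ ·) = l := by
  have hn : l.Nodup := hl.imp fun h => ne_of_gt h
  refine List.Perm.eq_of_pairwise (le := (· ≥ ·)) (fun a b _ _ h h' => le_antisymm h' h)
    (pairwise_sort s _) (hl.imp fun h => h.le) ?_
  refine List.perm_of_nodup_nodup_toFinset_eq (sort_nodup s _) hn ?_
  rw [sort_toFinset, hs]

theorem sort_ge_pairwise {Q : Type*} [LinearOrder Q] (s : Finset Q) :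
    (s.sort (· ≥ ·)).Pairwise (· > ·) :=
  ((pairwise_sort s (· ≥ ·)).and (sort_nodup s (· ≥ ·))).imp
    fun h => lt_of_le_of_ne h.1 h.2.symm

theorem descProd_eq_ofFn {Q : Type*} [Fintype Q] [LinearOrder Q] (e : Fin (Fintype.card Q) ≃o Qᵒᵈ)
    (f : Q → B) : descProd f = (List.ofFn fun k => f (OrderDual.ofDual (e k))).prod := by
  have : (univ : Finset Q).sort (· ≥ ·) = List.ofFn fun k => OrderDual.ofDual (e k) := by
    refine sort_ge_eq ?_ ?_
    · rw [List.pairwise_ofFn]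
      exact fun i j hij => e.strictMono hij
    · ext a
      simp only [List.mem_toFinset, List.mem_ofFn, mem_univ, iff_true]
      exact ⟨e.symm (OrderDual.toDual a), by simp⟩
  rw [descProd, this, List.map_ofFn]
  rfl

/-- The image of `i` is an initial segment, so in decreasing order its complement is read first. -/
theorem descProd_split {Q₀ Q₁ : Type*} [Fintype Q₀] [LinearOrder Q₀] [Fintype Q₁] [LinearOrder Q₁]
    {i : Q₀ → Q₁} (hi : StrictMono i) (hlow : ∀ a, ∀ b ∉ Set.range i, i a < b) (f : Q₁ → B) :
    descProd f = (((univ \ univ.image i).sort (· ≥ ·)).map f).prod * descProd (f ∘ i) := by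
  have : (univ : Finset Q₁).sort (· ≥ ·) = (univ \ univ.image i).sort (· ≥ ·)
      ++ ((univ : Finset Q₀).sort (· ≥ ·)).map i := by
    refine sort_ge_eq ?_ ?_
    · rw [List.pairwise_append]
      refine ⟨sort_ge_pairwise _, (sort_ge_pairwise _).map _ fun a b h => hi h, ?_⟩
      intro b hb a ha
      simp only [mem_sort, mem_sdiff, mem_univ, true_and, mem_image, not_exists] at hb
      simp only [List.mem_map, mem_sort, mem_univ, true_and] at ha
      obtain ⟨a, rfl⟩ := ha
      exact hlow a b fun ⟨a', h⟩ => hb a' h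
    · ext b
      simp only [List.toFinset_append, sort_toFinset, mem_union, mem_sdiff, mem_univ, true_and,
        mem_image, List.mem_toFinset, List.mem_map, mem_sort, iff_true]
      exact (em _).symm
  rw [descProd, this, List.map_append, List.prod_append, List.map_map, descProd]

theorem prod_map_sort_eq_commProd {Q ι : Type*} [LinearOrder Q] [DecidableEq ι] {T : ι → B}
    (hT : ∀ a b, Commute (T a) (T b)) (s : Finset Q) {g : Q → ι} (hg : Function.Injective g) :
    ((s.sort (· ≥ ·)).map fun b => T (g b)).prod = commProd T hT (s.image g) := by
  have hn : ((s.sort (· ≥ ·)).map g).Nodup := (sort_nodup s _).map hg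
  have hs : ((s.sort (· ≥ ·)).map g).toFinset = s.image g := by
    ext a; simp
  have := noncommProd_toFinset ((s.sort (· ≥ ·)).map g) T (fun a _ b _ _ => hT a b) hn
  rw [List.map_map] at this
  rw [show (fun b => T (g b)) = T ∘ g from rfl, ← this, commProd]
  congr 1

variable {ι : Type*} [DecidableEq ι] [Fintype ι]

/-- The coefficient of `T(rest) ∏ X_a(z_a)` in `∏ X_a(x_a) T(rest)`, both products being taken in
decreasing order. -/
def passWeight {Q : Type*} [Fintype Q] [LinearOrder Q] (q : K) (u : ι → K) (x z : Q → ι) : K :=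
  ∏ a, ((q - q⁻¹) * u (x a) / (q * u (x a) - q⁻¹ * u (z a))
    * (∏ j with a < j, (u (x j) - u (z a)) / (q * u (x j) - q⁻¹ * u (z a))
        * qKernel q (u (z j)) (u (z a)))
    * ∏ w ∈ univ \ univ.image z, qKernel q (u w) (u (z a)))

theorem descProd_mul_commProd {Q : Type*} [Fintype Q] [LinearOrder Q] {q : K} {u : ι → K}
    (hu : Function.Injective u) (hu0 : ∀ a, u a ≠ 0) (hq : ∀ a b, q * u a - q⁻¹ * u b ≠ 0)
    {T : ι → B} (hT : ∀ a b, Commute (T a) (T b)) (X : Q → ι → B)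
    (hX : ∀ a, Exchange q u T (X a)) {x : Q → ι} (hx : Function.Injective x) :
    descProd (fun a => X a (x a)) * commProd T hT (univ \ univ.image x)
      = ∑ z : Q → ι with Function.Injective z, passWeight q u x z
        • (commProd T hT (univ \ univ.image z) * descProd (fun a => X a (z a))) := by
  let e : Fin (Fintype.card Q) ≃o Qᵒᵈ := Fintype.orderIsoFinOfCardEq Qᵒᵈ rfl
  let e' : Fin (Fintype.card Q) ≃ Q := e.toEquiv.trans OrderDual.ofDual
  have he : ∀ i j, e' i < e' j ↔ j < i := fun i j => e.lt_iff_lt (x := j) (y := i)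
  have himg : ∀ z : Q → ι, univ.image (fun k => z (e' k)) = univ.image z := fun z => by
    ext a
    simp only [mem_image, mem_univ, true_and]
    exact ⟨fun ⟨k, h⟩ => ⟨e' k, h⟩, fun ⟨k, h⟩ => ⟨e'.symm k, by simpa using h⟩⟩
  have h := seqProd_mul_commProd hu hu0 hq hT (fun k => X (e' k)) (fun k => hX _) univ
    (fun k => x (e' k)) (hx.comp e'.injective) (by simp)
  rw [himg] at h
  rw [descProd_eq_ofFn e]
  refine h.trans ?_
  symm
  refine sum_equiv (e'.symm.arrowCongr (Equiv.refl ι)) (fun z => ?_) fun z hz => ?_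
  · simp only [mem_filter, mem_univ, true_and, implies_true, and_true]
    exact (Function.Injective.of_comp_iff' z e'.bijective).symm
  · rw [descProd_eq_ofFn e]
    have hz' : (e'.symm.arrowCongr (Equiv.refl ι)) z = fun k => z (e' k) := rfl
    rw [hz', himg]
    congr 1
    rw [passWeight, seqCoeff, himg]
    refine (Fintype.prod_equiv e' _ _ fun k => ?_).symm
    congr 2
    refine prod_equiv e' (fun j => ?_) fun _ _ => rfl
    simp [he]

/-- The symmetrizing kernel over all pairs. -/
def fullKernel {Q : Type*} [Fintype Q] [LinearOrder Q] (q : K) (x : Q → K) : K :=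
  ∏ a, ∏ b with a < b, qKernel q (x b) (x a)

/-- The kernel over the pairs of different colours. -/
def crossKernel {Q : Type*} [Fintype Q] (q : K) (c : Q → C) (x : Q → K) : K :=
  ∏ a, ∏ b with c a < c b, qKernel q (x b) (x a)

/-- The normalized domain wall weight. -/
def normWall {Q : Type*} [Fintype Q] [LinearOrder Q] (q : K) (x z : Q → K) : K :=
  qWallWeight q x z * (∏ a, (q - q⁻¹) * x a) / ∏ a, ∏ b, (q * x a - q⁻¹ * z b)

/-- For a monotone colouring, a pair with different colours is ordered in the same way by position
and by colour. -/
theorem fullKernel_eq {Q : Type*} [Fintype Q] [LinearOrder Q] (q : K) {c : Q → C}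
    (hc : Monotone c) (x : Q → K) :
    fullKernel q x = qColourKernel q c x * crossKernel q c x := by
  have h : qColourKernel q c x = ∏ a, ∏ b with a < b ∧ c b = c a, qKernel q (x b) (x a) := by
    rw [qColourKernel]
    simp only [prod_filter]
    rw [prod_comm]
    refine prod_congr rfl fun a _ => prod_congr rfl fun b _ => ?_
    simp only [eq_comm]
  rw [h, crossKernel, fullKernel, ← prod_mul_distrib]
  refine prod_congr rfl fun a _ => ?_
  simp only [prod_filter]
  rw [← prod_mul_distrib]
  refine prod_congr rfl fun b _ => ?_
  by_cases hab : a < b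
  · rcases (hc hab.le).eq_or_lt with h | h
    · simp [hab, h]
    · simp [hab, h, h.ne']
  · have : ¬ c a < c b := fun h => hab (lt_of_not_ge fun h' => (hc h').not_gt h)
    simp [hab, this]

/-- Isolates the part depending on both x and z, to which the symmetrization identity applies, from
kernels in z alone. The numerators `q x - q⁻¹ z` of the domain wall weight cancel one third of the
full double product in `normWall`; the diagonal and the opposite triangle remain as denominators. -/
theorem passWeight_eq {Q : Type*} [Fintype Q] [LinearOrder Q] {q : K} {u : ι → K}
    (hq : ∀ a b, q * u a - q⁻¹ * u b ≠ 0) (x z : Q → ι) :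
    passWeight q u x z = normWall q (u ∘ x) (u ∘ z) * fullKernel q (u ∘ z)
      * ∏ a, ∏ w ∈ univ \ univ.image z, qKernel q (u w) (u (z a)) := by
  have h1 : ∏ a, ∏ b, (q * u (x a) - q⁻¹ * u (z b))
      = (∏ a, (q * u (x a) - q⁻¹ * u (z a)))
        * (∏ a, ∏ j with a < j, (q * u (x j) - q⁻¹ * u (z a)))
        * ∏ a, ∏ b with a < b, (q * u (x a) - q⁻¹ * u (z b)) := by
    have : ∏ a, ∏ j with a < j, (q * u (x j) - q⁻¹ * u (z a))
        = ∏ a, ∏ j with j < a, (q * u (x a) - q⁻¹ * u (z j)) := by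
      simp only [prod_filter]
      rw [prod_comm]
    rw [this, ← prod_mul_distrib, ← prod_mul_distrib]
    refine prod_congr rfl fun a _ => ?_
    rw [prod_filter, prod_filter, ← Fintype.prod_ite_eq' a
      (fun b => q * u (x a) - q⁻¹ * u (z b)), ← prod_mul_distrib, ← prod_mul_distrib]
    refine prod_congr rfl fun b _ => ?_
    rcases lt_trichotomy a b with h | h | h
    · simp [h, h.not_gt, h.ne']
    · simp [h]
    · simp [h, h.not_gt, h.ne]
  have h2 : ∏ a, ∏ j with a < j, (u (x j) - u (z a))
      = ∏ a, ∏ j with j < a, (u (x a) - u (z j)) := by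
    simp only [prod_filter]
    rw [prod_comm]
  rw [passWeight, prod_mul_distrib, prod_mul_distrib, normWall, fullKernel, qWallWeight]
  congr 1
  simp only [prod_mul_distrib, prod_div_distrib, Function.comp_apply]
  rw [h1, h2]
  have n1 : ∏ a, (q * u (x a) - q⁻¹ * u (z a)) ≠ 0 := prod_ne_zero_iff.2 fun a _ => hq _ _
  have n2 : ∏ a, ∏ j with a < j, (q * u (x j) - q⁻¹ * u (z a)) ≠ 0 :=
    prod_ne_zero_iff.2 fun a _ => prod_ne_zero_iff.2 fun b _ => hq _ _
  have n3 : ∏ a, ∏ b with a < b, (q * u (x a) - q⁻¹ * u (z b)) ≠ 0 :=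
    prod_ne_zero_iff.2 fun a _ => prod_ne_zero_iff.2 fun b _ => hq _ _
  generalize ∏ a, (q * u (x a) - q⁻¹ * u (z a)) = p₁ at n1 ⊢
  generalize ∏ a, ∏ j with a < j, (q * u (x j) - q⁻¹ * u (z a)) = p₂ at n2 ⊢
  generalize ∏ a, ∏ b with a < b, (q * u (x a) - q⁻¹ * u (z b)) = p₃ at n3 ⊢
  generalize ∏ a : Q, (q - q⁻¹) = p₄
  field_simp

end

/-! ### Sums over permutations, injections and Young subgroups -/

section

/-- Such a permutation is a bijection between the complements of the two ranges. -/
theorem card_perm_extending {Q₀ Q₁ : Type*} [Fintype Q₀] [Fintype Q₁] [DecidableEq Q₁]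
    {i z : Q₀ → Q₁} (hi : Function.Injective i) (hz : Function.Injective z) :
    #{τ : Equiv.Perm Q₁ | ⇑τ ∘ i = z} = (#(univ \ univ.image i)).factorial := by
  classical
  let e₀ : Set.range i ≃ Set.range z := (Equiv.ofInjective i hi).symm.trans (Equiv.ofInjective z hz)
  have he₀ : ∀ a, e₀ ⟨i a, a, rfl⟩ = ⟨z a, a, rfl⟩ := fun a => by
    have : (Equiv.ofInjective i hi).symm ⟨i a, a, rfl⟩ = a :=
      Equiv.ofInjective_symm_apply hi a
    simp only [e₀, Equiv.trans_apply, this]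
    rfl
  have hcard : ∀ w : Q₀ → Q₁, Function.Injective w →
      Fintype.card ((Set.range w)ᶜ : Set Q₁) = #(univ \ univ.image w) := fun w _ => by
    rw [← Set.toFinset_card]
    congr 1
    ext b
    simp
  have hcard' : ∀ w : Q₀ → Q₁, Function.Injective w →
      #(univ \ univ.image w) = Fintype.card Q₁ - Fintype.card Q₀ := fun w hw => by
    rw [card_sdiff_of_subset (subset_univ _), card_image_of_injective _ hw, card_univ, card_univ]
  have e : ((Set.range i)ᶜ : Set Q₁) ≃ ((Set.range z)ᶜ : Set Q₁) :=
    Fintype.equivOfCardEq (by rw [hcard i hi, hcard z hz, hcard' i hi, hcard' z hz])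
  rw [← hcard i hi, ← Fintype.card_equiv e, ← Fintype.card_congr (Equiv.Set.compl e₀),
    Fintype.card_subtype]
  congr 1
  ext τ
  simp only [mem_filter, mem_univ, true_and]
  constructor
  · rintro h ⟨_, a, rfl⟩
    rw [he₀]
    exact congrFun h a
  · intro h
    ext a
    rw [Function.comp_apply, h ⟨i a, a, rfl⟩, he₀]

/-- Replaces sums over injective sequences by sums over orderings of the larger set. The factorial
counts orderings of the newly added block, whose operators commute. -/
theorem sum_perm_comp {Q₀ Q₁ M : Type*} [Fintype Q₀] [DecidableEq Q₀] [Fintype Q₁] [DecidableEq Q₁]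
    [AddCommMonoid M]
    {i : Q₀ → Q₁} (hi : Function.Injective i) (F : (Q₀ → Q₁) → M) :
    ∑ τ : Equiv.Perm Q₁, F (τ ∘ i)
      = (#(univ \ univ.image i)).factorial • ∑ z : Q₀ → Q₁ with Function.Injective z, F z := by
  rw [← sum_fiberwise_of_maps_to (s := univ) (g := fun τ : Equiv.Perm Q₁ => ⇑τ ∘ i)
    (t := univ.filter fun z : Q₀ → Q₁ => Function.Injective z)
    (fun τ _ => by simpa using τ.injective.comp hi), smul_sum]
  refine sum_congr rfl fun z hz => ?_
  rw [← card_perm_extending hi (mem_filter.1 hz).2, ← sum_const]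
  refine sum_congr rfl fun τ hτ => ?_
  rw [(mem_filter.1 hτ).2]

/-- The permutations preserving a colouring. -/
def colourPerms {Q C : Type*} [Fintype Q] [DecidableEq Q] [DecidableEq C] (c : Q → C) :
    Finset (Equiv.Perm Q) :=
  univ.filter fun σ => ∀ b, c (σ b) = c b

theorem mem_colourPerms {Q C : Type*} [Fintype Q] [DecidableEq Q] [DecidableEq C] {c : Q → C}
    {σ : Equiv.Perm Q} : σ ∈ colourPerms c ↔ ∀ b, c (σ b) = c b := by
  simp [colourPerms]

theorem sum_colourPerms_mul {Q C M : Type*} [Fintype Q] [DecidableEq Q] [DecidableEq C]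
    [AddCommMonoid M] {c : Q → C} {γ : Equiv.Perm Q} (hγ : γ ∈ colourPerms c)
    (F : Equiv.Perm Q → M) : ∑ β ∈ colourPerms c, F (γ * β) = ∑ β ∈ colourPerms c, F β := by
  rw [mem_colourPerms] at hγ
  refine sum_equiv (Equiv.mulLeft γ) (fun β => ?_) fun _ _ => rfl
  simp [mem_colourPerms, hγ]

variable {K C : Type*} [Field K] [LinearOrder C]

theorem crossKernel_comp {Q : Type*} [Fintype Q] (q : K) {c : Q → C} (x : Q → K)
    {β : Equiv.Perm Q} (hβ : ∀ b, c (β b) = c b) :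
    crossKernel q c (x ∘ β) = crossKernel q c x := by
  refine Fintype.prod_equiv β _ _ fun a => ?_
  refine prod_equiv β (fun b => ?_) fun b _ => rfl
  simp [hβ]

/-- The factors that distinguish `normWall` from `qWallWeight` are symmetric in x and in z
separately, so they come out of both sums. -/
theorem sum_colourPerms_normWall {Q : Type*} [Fintype Q] [LinearOrder Q] {q : K} (hq : q ≠ 0)
    {c : Q → C} (hc : Monotone c) {x z : Q → K}
    (hx : Function.Injective x) (hz : Function.Injective z) :
    ∑ σ ∈ colourPerms c, qColourKernel q c (x ∘ σ) * normWall q (x ∘ σ) z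
      = ∑ σ ∈ colourPerms c, qColourKernel q c (z ∘ σ) * normWall q x (z ∘ σ) := by
  have h := sum_colourPerms_qWallWeight hq hc hx hz
  have h1 : ∀ σ : Equiv.Perm Q, ∏ a, (q - q⁻¹) * (x ∘ σ) a = ∏ a, (q - q⁻¹) * x a := fun σ =>
    Equiv.prod_comp σ fun a => (q - q⁻¹) * x a
  have h2 : ∀ σ : Equiv.Perm Q, ∏ a, ∏ b, (q * (x ∘ σ) a - q⁻¹ * z b)
      = ∏ a, ∏ b, (q * x a - q⁻¹ * z b) := fun σ =>
    Equiv.prod_comp σ fun a => ∏ b, (q * x a - q⁻¹ * z b)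
  have h3 : ∀ σ : Equiv.Perm Q, ∏ a, ∏ b, (q * x a - q⁻¹ * (z ∘ σ) b)
      = ∏ a, ∏ b, (q * x a - q⁻¹ * z b) := fun σ =>
    prod_congr rfl fun a _ => Equiv.prod_comp σ fun b => (q * x a - q⁻¹ * z b)
  simp only [normWall, h1, h2, h3, ← mul_div_assoc, ← mul_assoc, ← sum_mul, ← sum_div]
  exact congrArg (fun s => s * _ / _) h

/-! ### One step of the nested recursion -/

/-- A finite linear order `Q₀` included in `Q₁` as the set of elements of non-maximal colour. -/
structure ColourStep {Q₀ Q₁ : Type*} [LinearOrder Q₀] [LinearOrder Q₁] (i : Q₀ → Q₁) (c : Q₁ → C)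
    (N : C) : Prop where
  strictMono : StrictMono i
  monotone : Monotone c
  lt : ∀ a, c (i a) < N
  eq : ∀ b ∉ Set.range i, c b = N

variable {Q₀ Q₁ : Type*} [Fintype Q₀] [LinearOrder Q₀] [Fintype Q₁] [LinearOrder Q₁]
  {i : Q₀ → Q₁} {c : Q₁ → C} {N : C}

/-- The transition weight between an ordering of `Q₀` and an ordering of `Q₁`. -/
def transWeight (q : K) (u : Q₁ → K) (i : Q₀ → Q₁) (σ : Equiv.Perm Q₀) (τ : Equiv.Perm Q₁) : K :=
  normWall q (u ∘ i ∘ σ) (u ∘ τ ∘ i) * fullKernel q (u ∘ i ∘ σ)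

/-- The next partial sum of the nested recursion. -/
def nextSum (q : K) (u : Q₁ → K) (i : Q₀ → Q₁) (f : Equiv.Perm Q₀ → K) (τ : Equiv.Perm Q₁) : K :=
  ∑ σ, transWeight q u i σ τ * f σ

/-- A colour-preserving permutation cannot mix the range of `i`, where colours are below `N`, with
the complement, where the colour is `N`. -/
theorem ColourStep.exists_restrict (h : ColourStep i c N) {γ : Equiv.Perm Q₁}
    (hγ : γ ∈ colourPerms c) : ∃ γ₀ ∈ colourPerms (c ∘ i), ∀ a, γ (i a) = i (γ₀ a) := by
  rw [mem_colourPerms] at hγ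
  have hr : ∀ a, ∃ a', i a' = γ (i a) := fun a => by
    by_contra hne
    have := h.eq (γ (i a)) hne
    rw [hγ] at this
    exact (h.lt a).ne this
  choose g hg using hr
  have hinj : Function.Injective g := fun a a' haa' => by
    apply h.strictMono.injective
    apply γ.injective
    rw [← hg, ← hg, haa']
  refine ⟨Equiv.ofBijective g (Finite.injective_iff_bijective.1 hinj), ?_, fun a => (hg a).symm⟩
  rw [mem_colourPerms]
  intro a
  simp [hg, hγ]

omit [Fintype Q₁] in
/-- The symmetrized form of the next partial sum. -/
theorem ColourStep.card_mul_nextSum (h : ColourStep i c N) {q : K} (hq : q ≠ 0) {u : Q₁ → K}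
    (hu : Function.Injective u) {f : Equiv.Perm Q₀ → K}
    (hf : ∀ σ, ∀ β ∈ colourPerms (c ∘ i), f (σ * β) = f σ) (τ : Equiv.Perm Q₁) :
    (#(colourPerms (c ∘ i)) : K) * nextSum q u i f τ
      = ∑ σ : Equiv.Perm Q₀, crossKernel q (c ∘ i) (u ∘ i ∘ σ) * f σ
        * ∑ β ∈ colourPerms (c ∘ i), qColourKernel q (c ∘ i) (u ∘ τ ∘ i ∘ β)
            * normWall q (u ∘ i ∘ σ) (u ∘ τ ∘ i ∘ β) := by
  have hmono : Monotone (c ∘ i) := h.monotone.comp h.strictMono.monotone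
  have hi := h.strictMono.injective
  -- The symmetrization identity, used to turn averaging over the old ordering into averaging over
  -- the new one.
  have h1 : ∀ σ : Equiv.Perm Q₀,
      ∑ β ∈ colourPerms (c ∘ i), qColourKernel q (c ∘ i) (u ∘ τ ∘ i ∘ β)
            * normWall q (u ∘ i ∘ σ) (u ∘ τ ∘ i ∘ β)
      = ∑ β ∈ colourPerms (c ∘ i), qColourKernel q (c ∘ i) (u ∘ i ∘ (σ * β : Equiv.Perm Q₀))
            * normWall q (u ∘ i ∘ (σ * β : Equiv.Perm Q₀)) (u ∘ τ ∘ i) := fun σ =>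
    (sum_colourPerms_normWall hq hmono (x := u ∘ i ∘ σ) (z := u ∘ τ ∘ i)
      (hu.comp (hi.comp σ.injective)) (hu.comp (τ.injective.comp hi))).symm
  simp only [h1, mul_sum]
  rw [sum_comm, ← nsmul_eq_mul, ← sum_const]
  refine sum_congr rfl fun β hβ => ?_
  rw [nextSum, ← Equiv.sum_comp (Equiv.mulRight β)]
  refine sum_congr rfl fun σ _ => ?_
  rw [Equiv.coe_mulRight, hf σ β hβ, transWeight, fullKernel_eq q hmono]
  have : crossKernel q (c ∘ i) (u ∘ i ∘ (σ * β : Equiv.Perm Q₀))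
      = crossKernel q (c ∘ i) (u ∘ i ∘ σ) :=
    crossKernel_comp q (u ∘ i ∘ σ) (mem_colourPerms.1 hβ)
  rw [this]
  ring

theorem card_colourPerms_ne_zero [CharZero K] {Q C : Type*} [Fintype Q] [DecidableEq Q]
    [DecidableEq C] (c : Q → C) : (#(colourPerms c) : K) ≠ 0 := by
  have : (1 : Equiv.Perm Q) ∈ colourPerms c := by simp [mem_colourPerms]
  exact_mod_cast (card_pos.2 ⟨1, this⟩).ne'

/-- In the form of `card_mul_nextSum` the new ordering enters only through an average over its
reorderings inside the colours; `γ` restricts to such a reordering and is absorbed. -/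
theorem ColourStep.nextSum_invariant [CharZero K] (h : ColourStep i c N) {q : K} (hq : q ≠ 0)
    {u : Q₁ → K} (hu : Function.Injective u) {f : Equiv.Perm Q₀ → K}
    (hf : ∀ σ, ∀ β ∈ colourPerms (c ∘ i), f (σ * β) = f σ) (τ : Equiv.Perm Q₁)
    (γ : Equiv.Perm Q₁) (hγ : γ ∈ colourPerms c) :
    nextSum q u i f (τ * γ) = nextSum q u i f τ := by
  obtain ⟨γ₀, hγ₀, hres⟩ := h.exists_restrict hγ
  apply mul_left_cancel₀ (card_colourPerms_ne_zero (K := K) (c ∘ i))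
  rw [h.card_mul_nextSum hq hu hf, h.card_mul_nextSum hq hu hf]
  refine sum_congr rfl fun σ _ => ?_
  congr 1
  have : ∀ β : Equiv.Perm Q₀, u ∘ (τ * γ : Equiv.Perm Q₁) ∘ i ∘ β
      = u ∘ τ ∘ i ∘ (γ₀ * β : Equiv.Perm Q₀) := fun β => by
    ext a
    simp [hres]
  simp only [this]
  exact sum_colourPerms_mul hγ₀ fun β => qColourKernel q (c ∘ i) (u ∘ τ ∘ i ∘ β)
    * normWall q (u ∘ i ∘ σ) (u ∘ τ ∘ i ∘ β)

variable {B : Type*} [Ring B] [Algebra K B]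

theorem ColourStep.crossKernel_eq (h : ColourStep i c N) (q : K) (x : Q₁ → K) :
    crossKernel q c x = crossKernel q (c ∘ i) (x ∘ i)
      * ∏ a, ∏ b ∈ univ \ univ.image i, qKernel q (x b) (x (i a)) := by
  have hi := h.strictMono.injective
  have hle : ∀ b, c b ≤ N := fun b => by
    by_cases hb : b ∈ Set.range i
    · obtain ⟨a, rfl⟩ := hb
      exact (h.lt a).le
    · exact (h.eq b hb).le
  rw [crossKernel, ← prod_sdiff (subset_univ (univ.image i))]
  have h1 : ∏ a ∈ univ \ univ.image i, ∏ b with c a < c b, qKernel q (x b) (x a) = 1 := by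
    refine prod_eq_one fun a ha => prod_eq_one fun b hb => ?_
    simp only [mem_sdiff, mem_univ, true_and, mem_image, not_exists, mem_filter] at ha hb
    rw [h.eq a (by simpa using ha)] at hb
    exact absurd hb (hle b).not_gt
  rw [h1, one_mul, prod_image fun a _ b _ hab => hi hab, crossKernel, ← prod_mul_distrib]
  refine prod_congr rfl fun a _ => ?_
  rw [prod_filter, ← prod_sdiff (subset_univ (univ.image i)),
    prod_image fun a _ b _ hab => hi hab, mul_comm, prod_filter]
  congr 1
  refine prod_congr rfl fun b hb => ?_
  simp only [mem_sdiff, mem_univ, true_and, mem_image, not_exists] at hb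
  rw [if_pos]
  rw [h.eq b (by simpa using hb)]
  exact h.lt a

/-- The product of the operators at a sequence of variables, in decreasing order. -/
def orderedOps {Q ι : Type*} [Fintype Q] [LinearOrder Q] (t : C → ι → B) (c : Q → C)
    (x : Q → ι) : B :=
  descProd fun b => t (c b) (x b)

/-- The ordered product does not depend on the order of the variables of the same colour. -/
def OrderFree {Q : Type*} [Fintype Q] [LinearOrder Q] {ι : Type*} (t : C → ι → B) (c : Q → C) :
    Prop :=
  ∀ x : Q → ι, Function.Injective x → ∀ β ∈ colourPerms c,
    orderedOps t c (x ∘ β) = orderedOps t c x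

theorem ColourStep.orderedOps_split (h : ColourStep i c N) {ι : Type*} [DecidableEq ι]
    {t : C → ι → B} (ht : ∀ a b, Commute (t N a) (t N b)) {x : Q₁ → ι}
    (hx : Function.Injective x) :
    orderedOps t c x = commProd (t N) ht ((univ \ univ.image i).image x)
      * orderedOps t (c ∘ i) (x ∘ i) := by
  have hlow : ∀ a, ∀ b ∉ Set.range i, i a < b := fun a b hb => by
    by_contra hlt
    have := h.monotone (not_lt.1 hlt)
    rw [h.eq b hb] at this
    exact this.not_gt (h.lt a)
  rw [orderedOps, descProd_split h.strictMono hlow, ← prod_map_sort_eq_commProd ht _ hx]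
  congr 2
  refine List.map_congr_left fun b hb => ?_
  simp only [mem_sort, mem_sdiff, mem_univ, true_and, mem_image, not_exists] at hb
  rw [h.eq b (by simpa using hb)]

theorem image_compl_range {Q₀ Q₁ ι : Type*} [Fintype Q₀] [Fintype Q₁] [DecidableEq Q₁]
    [DecidableEq ι] {i : Q₀ → Q₁} {x : Q₁ → ι} (hx : Function.Injective x) :
    (univ \ univ.image i).image x = univ.image x \ univ.image (x ∘ i) := by
  rw [image_sdiff _ _ hx, image_image]

/-- Permuting inside the colours changes neither the set of arguments of the top block, whose
operators commute, nor the lower word, by hypothesis. -/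
theorem ColourStep.orderFree (h : ColourStep i c N) {ι : Type*} [DecidableEq ι]
    {t : C → ι → B} (ht : ∀ a b, Commute (t N a) (t N b)) (h₀ : OrderFree t (c ∘ i)) :
    OrderFree t c := by
  intro x hx γ hγ
  obtain ⟨γ₀, hγ₀, hres⟩ := h.exists_restrict hγ
  have e1 : (x ∘ γ) ∘ i = (x ∘ i) ∘ γ₀ := by
    ext a; simp [hres]
  have e2 : univ.image (x ∘ γ) = univ.image x := by
    rw [← image_image, image_univ_equiv]
  have e3 : univ.image ((x ∘ i) ∘ γ₀) = univ.image (x ∘ i) := by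
    rw [← image_image, image_univ_equiv]
  rw [h.orderedOps_split ht (hx.comp γ.injective), h.orderedOps_split ht hx,
    image_compl_range (hx.comp γ.injective), image_compl_range hx, e1, e2, e3,
    h₀ _ (hx.comp h.strictMono.injective) γ₀ hγ₀]

/-- Passing the top block through the words yields coefficients with the internal kernel in the new
variables, whereas `nextSum` has it in the old ones. Since the words do not depend on the order
inside a colour, the coefficients may be averaged over such reorderings, and the averages agree by
`card_mul_nextSum`. Characteristic zero permits dividing by the order of the Young subgroup. -/
theorem ColourStep.step [CharZero K] (h : ColourStep i c N) {q : K} (hq : q ≠ 0)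
    {u : Q₁ → K} (hu : Function.Injective u) (hu0 : ∀ a, u a ≠ 0)
    (hqu : ∀ a b, q * u a - q⁻¹ * u b ≠ 0) {t : C → Q₁ → B}
    (ht : ∀ a b, Commute (t N a) (t N b)) (hex : ∀ j < N, Exchange q u (t N) (t j))
    (h₀ : OrderFree t (c ∘ i)) {f : Equiv.Perm Q₀ → K}
    (hf : ∀ σ, ∀ β ∈ colourPerms (c ∘ i), f (σ * β) = f σ) {κ : ℕ} {O : B}
    (hO : κ • O = ∑ σ : Equiv.Perm Q₀,
      (crossKernel q (c ∘ i) (u ∘ i ∘ σ) * f σ) • orderedOps t (c ∘ i) (i ∘ σ)) :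
    ((#(univ \ univ.image i)).factorial * κ) • (O * commProd (t N) ht (univ \ univ.image i))
      = ∑ τ : Equiv.Perm Q₁,
        (crossKernel q c (u ∘ τ) * nextSum q u i f τ) • orderedOps t c τ := by
  have hi := h.strictMono.injective
  have hmono : Monotone (c ∘ i) := h.monotone.comp h.strictMono.monotone
  have hsplit : ∀ τ : Equiv.Perm Q₁, orderedOps t c τ
      = commProd (t N) ht (univ \ univ.image (τ ∘ i)) * orderedOps t (c ∘ i) (τ ∘ i) := fun τ => by
    rw [h.orderedOps_split ht τ.injective, image_compl_range τ.injective, image_univ_equiv]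
  let cross (τ : Equiv.Perm Q₁) : K :=
    ∏ a, ∏ w ∈ univ \ univ.image (τ ∘ i), qKernel q (u w) (u (τ (i a)))
  have hcross : ∀ τ : Equiv.Perm Q₁, crossKernel q c (u ∘ τ)
      = crossKernel q (c ∘ i) (u ∘ τ ∘ i) * cross τ := fun τ => by
    rw [h.crossKernel_eq]
    congr 1
    refine prod_congr rfl fun a _ => ?_
    have himg : univ \ univ.image (τ ∘ i) = (univ \ univ.image i).image τ := by
      rw [image_compl_range τ.injective, image_univ_equiv]
    rw [himg, prod_image fun a _ b _ hab => τ.injective hab]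
    rfl
  let A (τ : Equiv.Perm Q₁) : K := ∑ σ : Equiv.Perm Q₀,
    crossKernel q (c ∘ i) (u ∘ i ∘ σ) * f σ
      * (normWall q (u ∘ i ∘ σ) (u ∘ τ ∘ i) * fullKernel q (u ∘ τ ∘ i) * cross τ)
  -- The raw expansion. The factorial pays for replacing injective sequences by orderings of all of
  -- `Q₁`.
  have hexp : ((#(univ \ univ.image i)).factorial * κ)
      • (O * commProd (t N) ht (univ \ univ.image i)) = ∑ τ, A τ • orderedOps t c τ := by
    have hterm : ∀ σ : Equiv.Perm Q₀, orderedOps t (c ∘ i) (i ∘ σ)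
          * commProd (t N) ht (univ \ univ.image i)
        = ∑ z : Q₀ → Q₁ with Function.Injective z, passWeight q u (i ∘ σ) z
          • (commProd (t N) ht (univ \ univ.image z) * orderedOps t (c ∘ i) z) := fun σ => by
      have := descProd_mul_commProd hu hu0 hqu ht (fun a => t (c (i a)))
        (fun a => hex _ (h.lt a)) (x := i ∘ σ) (hi.comp σ.injective)
      rw [← image_image, image_univ_equiv] at this
      exact this
    rw [mul_smul, ← smul_mul_assoc, hO, sum_mul]
    simp only [smul_mul_assoc, hterm, smul_sum (s := univ.filter _)]
    rw [sum_comm, ← sum_perm_comp hi (fun z => ∑ σ : Equiv.Perm Q₀,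
      (crossKernel q (c ∘ i) (u ∘ i ∘ σ) * f σ) • passWeight q u (i ∘ σ) z
          • (commProd (t N) ht (univ \ univ.image z) * orderedOps t (c ∘ i) z))]
    refine sum_congr rfl fun τ _ => ?_
    rw [hsplit, sum_smul]
    refine sum_congr rfl fun σ _ => ?_
    rw [smul_smul, passWeight_eq hqu]
    rfl
  -- Reorderings of the old colours are extended by the identity on the new block. Both cross-colour
  -- kernels are constant along them, leaving precisely the average of the colour kernel times
  -- `normWall`.
  have hA : ∀ τ : Equiv.Perm Q₁, ∑ β ∈ colourPerms (c ∘ i), A (τ * β.viaEmbedding ⟨i, hi⟩)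
      = (#(colourPerms (c ∘ i)) : K) * (crossKernel q c (u ∘ τ) * nextSum q u i f τ) := by
    intro τ
    rw [mul_left_comm, h.card_mul_nextSum hq hu hf, hcross, mul_sum, sum_comm]
    refine sum_congr rfl fun σ _ => ?_
    rw [mul_sum, mul_sum]
    refine sum_congr rfl fun β hβ => ?_
    have hv : ∀ a, β.viaEmbedding ⟨i, hi⟩ (i a) = i (β a) :=
      fun a => Equiv.Perm.viaEmbedding_apply β ⟨i, hi⟩ a
    have e1 : (τ * β.viaEmbedding ⟨i, hi⟩ : Equiv.Perm Q₁) ∘ i = τ ∘ i ∘ β := by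
      ext a; simp [hv]
    have e2 : cross (τ * β.viaEmbedding ⟨i, hi⟩) = cross τ := by
      simp only [cross, e1]
      have : univ.image (τ ∘ i ∘ β) = univ.image (τ ∘ i) := by
        rw [← Function.comp_assoc, ← image_image (f := β), image_univ_equiv]
      rw [this]
      simp only [Equiv.Perm.mul_apply, hv]
      exact Equiv.prod_comp β fun a =>
        ∏ w ∈ univ \ univ.image (τ ∘ i), qKernel q (u w) (u (τ (i a)))
    have e3 : crossKernel q (c ∘ i) (u ∘ τ ∘ i ∘ β) = crossKernel q (c ∘ i) (u ∘ τ ∘ i) :=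
      crossKernel_comp q (u ∘ τ ∘ i) (mem_colourPerms.1 hβ)
    rw [e1, e2, fullKernel_eq q hmono, e3]
    ring
  rw [hexp]
  have hD : ∀ (τ : Equiv.Perm Q₁), ∀ β ∈ colourPerms (c ∘ i),
      orderedOps t c (τ * β.viaEmbedding ⟨i, hi⟩ : Equiv.Perm Q₁) = orderedOps t c τ := by
    intro τ β hβ
    have hv : ∀ a, β.viaEmbedding ⟨i, hi⟩ (i a) = i (β a) :=
      fun a => Equiv.Perm.viaEmbedding_apply β ⟨i, hi⟩ a
    have e1 : (τ * β.viaEmbedding ⟨i, hi⟩ : Equiv.Perm Q₁) ∘ i = (τ ∘ i) ∘ β := by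
      ext a; simp [hv]
    rw [hsplit, hsplit, e1, ← image_image (f := β), image_univ_equiv,
      h₀ _ (τ.injective.comp hi) β hβ]
  have hb := card_colourPerms_ne_zero (K := K) (c ∘ i)
  have hkey : (#(colourPerms (c ∘ i)) : K) • ∑ τ, A τ • orderedOps t c τ
      = (#(colourPerms (c ∘ i)) : K) • ∑ τ : Equiv.Perm Q₁,
        (crossKernel q c (u ∘ τ) * nextSum q u i f τ) • orderedOps t c τ := by
    rw [Nat.cast_smul_eq_nsmul, ← sum_const]
    rw [sum_congr rfl fun β _ => (Equiv.sum_comp (Equiv.mulRight (β.viaEmbedding ⟨i, hi⟩))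
      fun τ => A τ • orderedOps t c τ).symm, sum_comm, smul_sum]
    refine sum_congr rfl fun τ _ => ?_
    rw [smul_smul, ← hA τ, sum_smul]
    refine sum_congr rfl fun β hβ => ?_
    rw [Equiv.coe_mulRight, hD τ β hβ]
  have := congrArg (fun y => (#(colourPerms (c ∘ i)) : K)⁻¹ • y) hkey
  simpa only [smul_smul, inv_mul_cancel₀ hb, one_smul] using this

end

/-! ### The weight function as an iterated sum -/

section

theorem induction_castSucc {K : Type*} {m : ℕ} {X : Fin (m + 2) → Type*} (z : X 0 → K)
    (s : ∀ p : Fin (m + 1), (X p.castSucc → K) → X p.succ → K) (p : Fin (m + 1)) :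
    Fin.induction (motive := fun p => X p → K) z s p.castSucc
      = Fin.induction (motive := fun p : Fin (m + 1) => X p.castSucc → K) z
          (fun p => s p.castSucc) p := by
  induction p using Fin.induction with
  | zero => rfl
  | succ p ih =>
    have h1 := Fin.induction_succ (motive := fun p => X p → K) z s p.castSucc
    have h2 := Fin.induction_succ (motive := fun p : Fin (m + 1) => X p.castSucc → K) z
      (fun p => s p.castSucc) p
    exact h1.trans ((congrArg (s p.castSucc) ih).trans h2.symm)

variable {K : Type*} [Field K]

/-- A sum over paths of a product of transition weights is an iterated application of transfer
matrices; this turns the multiple sum W into a recursion over the layers. -/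
theorem sum_path {m : ℕ} : ∀ {X : Fin (m + 1) → Type*} [∀ p, Fintype (X p)]
    [∀ p, DecidableEq (X p)] (A : ∀ p : Fin m, X p.castSucc → X p.succ → K) (e : X (Fin.last m)),
    ∑ σ : ∀ p, X p with σ (Fin.last m) = e, ∏ p : Fin m, A p (σ p.castSucc) (σ p.succ)
      = Fin.induction (motive := fun p => X p → K) (fun _ => 1)
          (fun p s e => ∑ e', A p e' e * s e') (Fin.last m) e := by
  induction m with
  | zero =>
    intro X _ _ A e
    let _ : Unique (Fin (0 + 1)) := ⟨⟨Fin.last 0⟩, fun a => Fin.ext (by have := a.2; omega)⟩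
    rw [sum_filter]
    refine (Fintype.sum_equiv (Equiv.piUnique X) _ (fun y => if y = e then 1 else 0)
      fun σ => ?_).trans ?_
    · simp only [univ_eq_empty, prod_empty]
      rfl
    · exact Fintype.sum_ite_eq' e fun _ => 1
  | succ m ih =>
    intro X _ _ A e
    have h1 : ∑ σ : ∀ p, X p with σ (Fin.last m).succ = e,
          ∏ p : Fin (m + 1), A p (σ p.castSucc) (σ p.succ)
        = ∑ ρ : ∀ p : Fin (m + 1), X p.castSucc, A (Fin.last m) (ρ (Fin.last m)) e
            * ∏ p : Fin m, A p.castSucc (ρ p.castSucc) (ρ p.succ) := by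
      refine sum_bij' (fun σ _ p => σ p.castSucc) (fun ρ _ => Fin.snoc (α := X) ρ e) ?_ ?_ ?_ ?_ ?_
      · intro σ _; exact mem_univ _
      · intro ρ _
        rw [mem_filter]
        exact ⟨mem_univ _, Fin.snoc_last (α := X) e ρ⟩
      · intro σ hσ
        have : σ (Fin.last (m + 1)) = e := (mem_filter.1 hσ).2
        rw [← this]
        exact Fin.snoc_init_self σ
      · intro ρ _
        funext p
        exact Fin.snoc_castSucc (α := X) e ρ p
      · intro σ hσ
        have : σ (Fin.last m).succ = e := (mem_filter.1 hσ).2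
        rw [Fin.prod_univ_castSucc, mul_comm, ← this]
        rfl
    refine h1.trans (Eq.trans ?_ (congrFun (Fin.induction_succ (motive := fun p => X p → K)
      (fun _ => 1) (fun p s e => ∑ e', A p e' e * s e') (Fin.last m)) e).symm)
    rw [← sum_fiberwise univ (fun ρ : ∀ p : Fin (m + 1), X p.castSucc => ρ (Fin.last m))]
    refine sum_congr rfl fun e' _ => ?_
    refine Eq.trans ?_ (congrArg (A (Fin.last m) e' e * ·) (congrFun (induction_castSucc
      (fun _ => 1) (fun p s e => ∑ e', A p e' e * s e') (Fin.last m)) e').symm)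
    have h2 := ih (X := fun p => X p.castSucc) (fun p => A p.castSucc) e'
    refine Eq.trans ?_ (congrArg (A (Fin.last m) e' e * ·) h2)
    simp only [mul_sum]
    refine sum_congr rfl fun ρ hρ => ?_
    rw [(mem_filter.1 hρ).2]

/-- One layer of the weight function. -/
def layerWeight {Q₀ Q₁ : Type*} [Fintype Q₀] [LinearOrder Q₀] [Fintype Q₁] [LinearOrder Q₁]
    (q : K) (i : Q₀ → Q₁) (x : Q₀ → K) (y : Q₁ → K) : K :=
  (∏ a, ((∏ b with b < i a, (x a - y b)) * ((q - q⁻¹) * x a)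
      * ∏ b with i a < b, (q * x a - q⁻¹ * y b)))
    * ∏ a, ∏ b with a < b, (q⁻¹ * x a - q * x b) / (x a - x b)

variable {C Q₀ Q₁ : Type*} [LinearOrder C] [Fintype Q₀] [LinearOrder Q₀] [Fintype Q₁]
  [LinearOrder Q₁] {i : Q₀ → Q₁} {c : Q₁ → C} {N : C}

omit [Fintype Q₀] [Fintype Q₁] in
theorem ColourStep.lt_of_notMem (h : ColourStep i c N) (a : Q₀) {b : Q₁} (hb : b ∉ Set.range i) :
    i a < b := by
  by_contra hlt
  have := h.monotone (not_lt.1 hlt)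
  rw [h.eq b hb] at this
  exact this.not_gt (h.lt a)

/-- Coordinates outside the range of `i` lie above all others, so they contribute only factors `q x
- q⁻¹ y`. Together with the denominator of `normWall` these form the full double product over both
layers, which no longer depends on the orderings. -/
theorem ColourStep.layerWeight_eq (h : ColourStep i c N) {q : K} {u : Q₁ → K}
    (hqu : ∀ a b, q * u a - q⁻¹ * u b ≠ 0) (σ : Equiv.Perm Q₀) (τ : Equiv.Perm Q₁) :
    layerWeight q i (u ∘ i ∘ σ) (u ∘ τ)
      = (∏ a, ∏ b, (q * u (i a) - q⁻¹ * u b)) * transWeight q u i σ τ := by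
  have hi := h.strictMono.injective
  have hK : ∏ a, ∏ b with a < b, (q⁻¹ * (u ∘ i ∘ σ) a - q * (u ∘ i ∘ σ) b)
        / ((u ∘ i ∘ σ) a - (u ∘ i ∘ σ) b) = fullKernel q (u ∘ i ∘ σ) := by
    refine prod_congr rfl fun a _ => prod_congr rfl fun b _ => ?_
    rw [qKernel, ← neg_div_neg_eq]
    congr 1 <;> ring
  have hD : ∏ a, ∏ b, (q * u (i a) - q⁻¹ * u b)
      = (∏ a, ∏ b, (q * (u ∘ i ∘ σ) a - q⁻¹ * (u ∘ τ ∘ i) b))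
        * ∏ a, ∏ b ∈ univ \ univ.image i, (q * u (i (σ a)) - q⁻¹ * u (τ b)) := by
    rw [← Equiv.prod_comp σ, ← prod_mul_distrib]
    refine prod_congr rfl fun a _ => ?_
    rw [← Equiv.prod_comp τ, ← prod_sdiff (subset_univ (univ.image i)),
      prod_image fun a _ b _ hab => hi hab, mul_comm]
    rfl
  have hlow : ∀ a, univ.filter (fun b => b < i a) = (univ.filter fun b => b < a).image i := by
    intro a
    ext b
    simp only [mem_filter, mem_univ, true_and, mem_image]
    constructor
    · intro hb
      by_cases hr : b ∈ Set.range i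
      · obtain ⟨b, rfl⟩ := hr
        exact ⟨b, h.strictMono.lt_iff_lt.1 hb, rfl⟩
      · exact absurd hb (h.lt_of_notMem a hr).not_gt
    · rintro ⟨b, hb, rfl⟩
      exact h.strictMono hb
  have hhigh : ∀ a, univ.filter (fun b => i a < b)
      = (univ \ univ.image i) ∪ (univ.filter fun b => a < b).image i := by
    intro a
    ext b
    simp only [mem_filter, mem_univ, true_and, mem_image, mem_union, mem_sdiff, not_exists]
    constructor
    · intro hb
      by_cases hr : ∃ b', i b' = b
      · obtain ⟨b, rfl⟩ := hr
        exact Or.inr ⟨b, h.strictMono.lt_iff_lt.1 hb, rfl⟩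
      · exact Or.inl fun x hx => hr ⟨x, hx⟩
    · rintro (hb | ⟨b, hb, rfl⟩)
      · exact h.lt_of_notMem a fun ⟨x, hx⟩ => hb x hx
      · exact h.strictMono hb
  have hdis : ∀ a, Disjoint (univ \ univ.image i) ((univ.filter fun b => a < b).image i) := by
    intro a
    rw [disjoint_left]
    intro b hb hb'
    exact (mem_sdiff.1 hb).2 (image_subset_image (filter_subset _ _) hb')
  have hne : ∏ a, ∏ b, (q * (u ∘ i ∘ σ) a - q⁻¹ * (u ∘ τ ∘ i) b) ≠ 0 :=
    prod_ne_zero_iff.2 fun a _ => prod_ne_zero_iff.2 fun b _ => hqu _ _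
  rw [layerWeight, hK, transWeight, normWall, hD, ← mul_assoc]
  congr 1
  rw [mul_right_comm, mul_div_assoc', mul_div_cancel_left₀ _ hne, qWallWeight, ← prod_mul_distrib,
    ← prod_mul_distrib]
  refine prod_congr rfl fun a _ => ?_
  rw [hlow, hhigh, prod_union (hdis a), prod_image fun a _ b _ hab => hi hab,
    prod_image fun a _ b _ hab => hi hab]
  simp only [Function.comp_apply]
  ring

end

/-! ### The nested recursion over the colours -/

section

variable {K P : Type*} [Field K] [Fintype P] [LinearOrder P] {m : ℕ} (I : P → Fin (m + 1))

/-- The inclusion of the coordinates of colour at most `p` into those of colour at most `p + 1`. -/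
def belowIncl (p : Fin m) (a : Below I p.castSucc) : Below I p.succ :=
  ⟨a.1, a.2.trans (Fin.castSucc_lt_succ (i := p)).le⟩

/-- The colouring of the coordinates of colour at most `p`. -/
def belowColour (p : Fin (m + 1)) (a : Below I p) : Fin (m + 1) := I a.1

omit [Fintype P] in
theorem colourStep_belowIncl {I : P → Fin (m + 1)} (hI : Monotone I) (p : Fin m) :
    ColourStep (belowIncl I p) (belowColour I p.succ) p.succ where
  strictMono _ _ h := h
  monotone _ _ h := hI h
  lt a := a.2.trans_lt Fin.castSucc_lt_succ
  eq b hb := by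
    refine le_antisymm b.2 ?_
    by_contra hlt
    exact hb ⟨⟨b.1, Fin.le_castSucc_iff.2 (not_le.1 hlt)⟩, rfl⟩

omit [Fintype P] in
theorem colourStep_zero {I : P → Fin (m + 1)} (hI : Monotone I) :
    ColourStep (Fin.elim0 : Fin 0 → Below I 0) (belowColour I 0) 0 where
  strictMono a := a.elim0
  monotone _ _ h := hI h
  lt a := a.elim0
  eq b _ := le_antisymm b.2 (Fin.zero_le _)

/-- The normalized iterated sums of the weight function. -/
def nestedSum (q : K) (u : P → K) (p : Fin (m + 1)) : Equiv.Perm (Below I p) → K :=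
  Fin.induction (motive := fun p => Equiv.Perm (Below I p) → K) (fun _ => 1)
    (fun p f => nextSum q (fun a : Below I p.succ => u a.1) (belowIncl I p) f) p

theorem nestedSum_zero (q : K) (u : P → K) : nestedSum I q u 0 = fun _ => 1 := rfl

theorem nestedSum_succ (q : K) (u : P → K) (p : Fin m) :
    nestedSum I q u p.succ = nextSum q (fun a : Below I p.succ => u a.1) (belowIncl I p)
      (nestedSum I q u p.castSucc) :=
  Fin.induction_succ (motive := fun p => Equiv.Perm (Below I p) → K) _ _ p

/-- The coordinates of colour `p`. -/
def blockSet (p : Fin (m + 1)) : Finset P := univ.filter fun i => I i = p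

variable {B : Type*} [Ring B] [Algebra K B]

/-- The product over the blocks `0, …, p` in increasing order. -/
def partialProd (t : Fin (m + 1) → P → B) (ht : ∀ j a b, Commute (t j a) (t j b))
    (p : Fin (m + 1)) : B :=
  Fin.induction (motive := fun _ => B) (commProd (t 0) (ht 0) (blockSet I 0))
    (fun p o => o * commProd (t p.succ) (ht p.succ) (blockSet I p.succ)) p

omit [LinearOrder P] in
theorem partialProd_succ (t : Fin (m + 1) → P → B) (ht : ∀ j a b, Commute (t j a) (t j b))
    (p : Fin m) : partialProd I t ht p.succ
      = partialProd I t ht p.castSucc * commProd (t p.succ) (ht p.succ) (blockSet I p.succ) :=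
  Fin.induction_succ (motive := fun _ => B) _ _ p

/-- The number of orderings of the blocks `0, …, p`. -/
def blockOrderings (p : Fin (m + 1)) : ℕ := ∏ j with j ≤ p, (#(blockSet I j)).factorial

omit [LinearOrder P] in
theorem blockOrderings_zero : blockOrderings I 0 = (#(blockSet I 0)).factorial := by
  have : univ.filter (fun j : Fin (m + 1) => j ≤ 0) = {0} := by
    ext j; simp
  rw [blockOrderings, this, prod_singleton]

omit [LinearOrder P] in
theorem blockOrderings_succ (p : Fin m) : blockOrderings I p.succ
    = (#(blockSet I p.succ)).factorial * blockOrderings I p.castSucc := by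
  have : univ.filter (fun j : Fin (m + 1) => j ≤ p.succ)
      = insert p.succ (univ.filter fun j => j ≤ p.castSucc) := by
    ext j
    simp only [mem_filter, mem_univ, true_and, mem_insert, Fin.le_castSucc_iff]
    exact le_iff_eq_or_lt
  rw [blockOrderings, this, prod_insert (by simp), blockOrderings]

theorem commProd_comp {ι Q : Type*} [DecidableEq ι] [DecidableEq Q] {T : ι → B}
    (hT : ∀ a b, Commute (T a) (T b)) {g : Q → ι} (hg : Function.Injective g) (s : Finset Q) :
    commProd (fun a => T (g a)) (fun a b => hT (g a) (g b)) s = commProd T hT (s.image g) := by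
  induction s using Finset.induction_on with
  | empty =>
    rw [image_empty]
    exact (noncommProd_empty _ _).trans (noncommProd_empty _ _).symm
  | insert a s ha ih =>
    rw [commProd_insert _ _ ha, image_insert, commProd_insert _ _ (by simpa [hg.eq_iff] using ha),
      ih]

variable {I}

theorem image_val_sdiff_belowIncl (p : Fin m) [DecidableEq (Below I p.succ)] :
    (univ \ univ.image (belowIncl I p)).image Subtype.val = blockSet I p.succ := by
  ext a
  simp only [mem_image, mem_sdiff, mem_univ, true_and, not_exists, blockSet, mem_filter]
  constructor
  · rintro ⟨b, hb, rfl⟩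
    refine le_antisymm b.2 ?_
    by_contra hlt
    exact hb ⟨b.1, Fin.le_castSucc_iff.2 (not_le.1 hlt)⟩ rfl
  · intro ha
    refine ⟨⟨a, ha.le⟩, fun b hb => ?_, rfl⟩
    have hb' : b.1 = a := congrArg Subtype.val hb
    have := b.2
    rw [hb', ha] at this
    exact this.not_gt Fin.castSucc_lt_succ

theorem card_sdiff_belowIncl (p : Fin m) [DecidableEq (Below I p.succ)] :
    #(univ \ univ.image (belowIncl I p)) = #(blockSet I p.succ) := by
  rw [← image_val_sdiff_belowIncl, card_image_of_injective _ Subtype.val_injective]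

theorem image_val_sdiff_zero [DecidableEq (Below I 0)] :
    (univ \ univ.image (Fin.elim0 : Fin 0 → Below I 0)).image Subtype.val = blockSet I 0 := by
  ext a
  simp [blockSet]

theorem card_sdiff_zero [DecidableEq (Below I 0)] :
    #(univ \ univ.image (Fin.elim0 : Fin 0 → Below I 0)) = #(blockSet I 0) := by
  rw [← image_val_sdiff_zero, card_image_of_injective _ Subtype.val_injective]

/-- The expansion of the ordered product of the blocks `0, …, p` over the orderings. -/
theorem blockOrderings_smul_partialProd [CharZero K] (hI : Monotone I) {q : K} (hq : q ≠ 0)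
    {u : P → K} (hu : Function.Injective u) (hu0 : ∀ a, u a ≠ 0)
    (hqu : ∀ a b, q * u a - q⁻¹ * u b ≠ 0) {t : Fin (m + 1) → P → B}
    (ht : ∀ j a b, Commute (t j a) (t j b)) (hex : ∀ j k, j < k → Exchange q u (t k) (t j))
    (p : Fin (m + 1)) :
    (∀ σ, ∀ β ∈ colourPerms (belowColour I p), nestedSum I q u p (σ * β) = nestedSum I q u p σ) ∧
    OrderFree t (belowColour I p) ∧
    blockOrderings I p • partialProd I t ht p = ∑ σ : Equiv.Perm (Below I p),
      (crossKernel q (belowColour I p) (fun a => u (σ a).1) * nestedSum I q u p σ)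
        • orderedOps t (belowColour I p) fun a => (σ a).1 := by
  have restrict : ∀ p, Function.Injective (fun a : Below I p => u a.1) :=
    fun p => hu.comp Subtype.val_injective
  have hexr : ∀ p j k, j < k → Exchange q (fun a : Below I p => u a.1) (fun a => t k a.1)
      (fun a => t j a.1) := fun p j k hjk a b hab =>
    hex j k hjk a.1 b.1 fun h => hab (Subtype.ext h)
  induction p using Fin.induction with
  | zero =>
    -- The first block is itself a step, from the empty order with `O = 1` and `κ = 1`.
    have hstep := colourStep_zero hI
    have hfree : ∀ (ι : Type _) (s : Fin (m + 1) → ι → B),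
        OrderFree s (belowColour I 0 ∘ (Fin.elim0 : Fin 0 → Below I 0)) := fun ι s x _ β _ => by
      rw [Subsingleton.elim (x ∘ β) x]
    have hone : ∀ τ : Equiv.Perm (Below I 0), nextSum q (fun a : Below I 0 => u a.1)
        (Fin.elim0 : Fin 0 → Below I 0) (fun _ => 1) τ = 1 := fun τ => by
      simp [nextSum, transWeight, normWall, fullKernel, qWallWeight]
    refine ⟨fun _ _ _ => rfl, hstep.orderFree (ht 0) (hfree _ _), ?_⟩
    have h := hstep.step hq (restrict 0) (fun a => hu0 a.1) (fun a b => hqu a.1 b.1)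
      (t := fun j a => t j a.1) (fun a b => ht 0 a.1 b.1) (fun j hj => absurd hj (Fin.not_lt_zero j))
      (hfree _ _) (f := fun _ => 1) (fun _ _ _ => rfl) (κ := 1) (O := (1 : B)) (by
        simp [crossKernel, orderedOps, descProd])
    simp only [hone] at h
    rw [one_mul, mul_one, commProd_comp (ht 0) Subtype.val_injective, image_val_sdiff_zero,
      card_sdiff_zero,
      ← blockOrderings_zero] at h
    exact h
  | succ p ih =>
    obtain ⟨hinv, hfree, hid⟩ := ih
    have hstep := colourStep_belowIncl hI p
    have hfree' : OrderFree (fun j (a : Below I p.succ) => t j a.1)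
        (belowColour I p.succ ∘ belowIncl I p) := fun x hx β hβ =>
      hfree (fun a => (x a).1) (Subtype.val_injective.comp hx) β hβ
    refine ⟨?_, hstep.orderFree (ht p.succ) hfree, ?_⟩
    · rw [nestedSum_succ]
      exact hstep.nextSum_invariant hq (restrict _) hinv
    · have h := hstep.step hq (restrict _) (fun a => hu0 a.1) (fun a b => hqu a.1 b.1)
        (t := fun j a => t j a.1) (fun a b => ht p.succ a.1 b.1) (fun j hj => hexr _ _ _ hj)
        hfree' hinv hid
      rw [commProd_comp (ht p.succ) Subtype.val_injective, image_val_sdiff_belowIncl,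
        card_sdiff_belowIncl,
        ← blockOrderings_succ, ← partialProd_succ, ← nestedSum_succ] at h
      exact h

/-- The normalization of the weight function. -/
def weightNorm (I : P → Fin (m + 1)) (q : K) (u : P → K) (p : Fin m) : K :=
  ∏ a : Below I p.castSucc, ∏ b : Below I p.succ, (q * u a.1 - q⁻¹ * u b.1)

/-- An ordering of all coordinates, as an ordering of those of colour at most the largest. -/
def lastPerm (I : P → Fin (m + 1)) (τ : Equiv.Perm P) : Equiv.Perm (Below I (Fin.last m)) :=
  (Equiv.subtypeUnivEquiv fun i => Fin.le_last (I i)).symm.permCongr τ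

theorem weight_eq_nestedSum (hI : Monotone I) {q : K}
    {u : P → K} (hqu : ∀ a b, q * u a - q⁻¹ * u b ≠ 0) (τ : Equiv.Perm P) :
    weight q I (fun _ a => u a.1) (fun i => u (τ i))
      = (∏ p, weightNorm I q u p) * nestedSum I q u (Fin.last m) (lastPerm I τ) := by
  have h1 : weight q I (fun _ a => u a.1) (fun i => u (τ i))
      = ∑ σ : (p : Fin (m + 1)) → Equiv.Perm (Below I p) with σ (Fin.last m) = lastPerm I τ,
        ∏ p : Fin m, layerWeight q (belowIncl I p) (fun a => u (σ p.castSucc a).1)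
          (fun b => u (σ p.succ b).1) := by
    -- The weight has permuted variables in its last set and an identity permutation there.
    -- Equivalently, the last set is unpermuted and the last permutation is `τ`, which puts all
    -- layers on the same footing.
    have key : ∀ (σ : (p : Fin (m + 1)) → Equiv.Perm (Below I p)), σ (Fin.last m) = 1 →
        ∀ (p : Fin (m + 1)) (b : Below I p),
        (Fin.snoc (α := fun p => Below I p → K) (fun _ a => u a.1) (fun i => u (τ i.1)) :
          (p : Fin (m + 1)) → Below I p → K) p (σ p b)
        = u (Function.update σ (Fin.last m) (lastPerm I τ) p b).1 := by
      intro σ hσ p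
      refine Fin.lastCases ?_ (fun p => ?_) p
      · intro b
        rw [Fin.snoc_last, hσ, Function.update_self]
        rfl
      · intro b
        rw [Fin.snoc_castSucc, Function.update_of_ne (Fin.castSucc_lt_last p).ne]
    unfold weight
    refine sum_bij' (fun σ _ => Function.update σ (Fin.last m) (lastPerm I τ))
      (fun σ _ => Function.update σ (Fin.last m) 1) ?_ ?_ ?_ ?_ ?_
    · intro σ _; simp
    · intro σ _; simp
    · intro σ hσ
      have : σ (Fin.last m) = 1 := (mem_filter.1 hσ).2
      rw [Function.update_idem, ← this, Function.update_eq_self]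
    · intro σ hσ
      have : σ (Fin.last m) = lastPerm I τ := (mem_filter.1 hσ).2
      rw [Function.update_idem, ← this, Function.update_eq_self]
    · intro σ hσ
      have hσ' : σ (Fin.last m) = 1 := (mem_filter.1 hσ).2
      simp only [key σ hσ']
      rfl
  have h2 := sum_path (X := fun p => Equiv.Perm (Below I p)) (fun (p : Fin m) (σ : Equiv.Perm (Below I p.castSucc))
    (σ' : Equiv.Perm (Below I p.succ)) => layerWeight q (belowIncl I p) (fun a => u (σ a).1)
          (fun b => u (σ' b).1)) (lastPerm I τ)
  rw [h1]
  refine Eq.trans (by congr!) (h2.trans ?_)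
  have h3 : ∀ (p : Fin (m + 1)) (e : Equiv.Perm (Below I p)),
      Fin.induction (motive := fun p => Equiv.Perm (Below I p) → K) (fun _ => 1)
          (fun p s e => ∑ e', layerWeight q (belowIncl I p) (fun a => u (e' a).1)
            (fun b => u (e b).1) * s e') p e
      = (∏ l : Fin m with l.castSucc < p, weightNorm I q u l) * nestedSum I q u p e := by
    intro p
    induction p using Fin.induction with
    | zero => intro e; simp [nestedSum_zero]
    | succ p ih =>
      intro e
      rw [Fin.induction_succ, nestedSum_succ, nextSum, mul_sum]
      refine sum_congr rfl fun e' _ => ?_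
      have hs : univ.filter (fun l : Fin m => l.castSucc < p.succ)
          = insert p (univ.filter fun l : Fin m => l.castSucc < p.castSucc) := by
        ext l
        simp only [mem_filter, mem_univ, true_and, mem_insert, Fin.castSucc_lt_succ_iff,
          Fin.castSucc_lt_castSucc_iff]
        exact le_iff_eq_or_lt
      have := (colourStep_belowIncl hI p).layerWeight_eq
        (u := fun a => u a.1) (q := q) (fun a b => hqu a.1 b.1) e' e
      rw [ih, hs, prod_insert (by simp)]
      refine (congrArg (· * _) this).trans ?_
      rw [weightNorm]
      simp only [belowIncl]
      ring
  rw [h3]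
  congr 2
  rw [filter_true_of_mem fun l _ => Fin.castSucc_lt_last l]

end

/-! ### The coefficients in terms of the nested recursion -/

section

variable {K : Type*} [Field K] {m : ℕ} (n : Fin (m + 1) → ℕ)

theorem prod_idx {M : Type*} [CommMonoid M] (f : Idx n → M) :
    ∏ i, f i = ∏ j, ∏ a, f (mkIdx n j a) := by
  rw [← Fintype.prod_sigma' fun j a => f (mkIdx n j a)]
  exact (Fintype.prod_equiv toLex _ _ fun _ => rfl).symm

theorem monotone_block : Monotone (block n) := by
  intro a b h
  rcases Sigma.Lex.le_def.1 h with h | ⟨h, _⟩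
  · exact h.le
  · exact h.le

theorem prod_idx_filter {M : Type*} [CommMonoid M] (R : Fin (m + 1) → Prop) [DecidablePred R]
    (f : Idx n → M) :
    ∏ i with R (block n i), f i = ∏ j with R j, ∏ a, f (mkIdx n j a) := by
  rw [prod_filter, prod_idx, prod_filter]
  refine prod_congr rfl fun j _ => ?_
  by_cases h : R j
  · rw [if_pos h]
    exact prod_congr rfl fun a _ => if_pos h
  · rw [if_neg h]
    exact prod_eq_one fun a _ => if_neg h

theorem prod_qProd_filter (q : K) (x y : Idx n → K) (j : Fin (m + 1)) (R : Fin (m + 1) → Prop)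
    [DecidablePred R] : ∏ k with R k, qProd q n x y j k
      = ∏ a, ∏ i with R (block n i), (q * x (mkIdx n j a) - q⁻¹ * y i) := by
  simp only [qProd, prod_idx_filter n R]
  rw [prod_comm]

theorem prod_qProd (q : K) (x y : Idx n → K) (j : Fin (m + 1)) :
    ∏ k, qProd q n x y j k = ∏ a, ∏ i, (q * x (mkIdx n j a) - q⁻¹ * y i) := by
  simp only [qProd, prod_idx]
  rw [prod_comm]

theorem prod_qProd_left (q : K) (x y : Idx n → K) (k : Fin (m + 1)) :
    ∏ j, qProd q n x y j k = ∏ b, ∏ i, (q * x i - q⁻¹ * y (mkIdx n k b)) := by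
  simp only [qProd, prod_idx]
  rw [prod_comm (s := (univ : Finset (Fin (n k))))]
  exact prod_congr rfl fun j _ => prod_comm

theorem crossKernel_block (q : K) (x : Idx n → K) : crossKernel q (block n) x
    = (∏ k, ∏ j with j < k, qProd q n x x k j) / ∏ k, ∏ j with j < k, diffProd n x x k j := by
  have h : crossKernel q (block n) x
      = ∏ b, ∏ a with block n a < block n b, qKernel q (x b) (x a) := by
    rw [crossKernel]
    simp only [prod_filter]
    exact prod_comm
  rw [h, ← prod_div_distrib, prod_idx]
  refine prod_congr rfl fun k _ => ?_
  refine (prod_congr rfl fun a _ => prod_idx_filter n (· < k)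
    fun i => qKernel q (x (mkIdx n k a)) (x i)).trans ?_
  rw [prod_comm, ← prod_div_distrib]
  refine prod_congr rfl fun j _ => ?_
  simp only [qProd, diffProd, ← prod_div_distrib]
  rfl

theorem weightNorm_block (q : K) (u : Idx n → K) (p : Fin m) : weightNorm (block n) q u p
    = ∏ j with j ≤ p.castSucc, ∏ k with k ≤ p.succ, qProd q n u u j k := by
  have h : ∀ (p : Fin (m + 1)) (f : Idx n → K),
      ∏ a : Below (block n) p, f a.1 = ∏ j with j ≤ p, ∏ a, f (mkIdx n j a) := fun p f => by
    rw [← prod_idx_filter n (· ≤ p)]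
    exact (prod_subtype _ (by simp) f).symm
  rw [weightNorm, h p.castSucc fun i => ∏ b : Below (block n) p.succ, (q * u i - q⁻¹ * u b.1)]
  refine prod_congr rfl fun j _ => ?_
  rw [prod_qProd_filter n q u u j (· ≤ p.succ)]
  exact prod_congr rfl fun a _ => (prod_subtype _ (by simp)
    fun i => q * u (mkIdx n j a) - q⁻¹ * u i).symm

/-- Only the q-products need matching. As v is a permutation of u, a product over a complete set of
variables is the same for both; the partial products in `coefficient` are completed to such
products. -/
theorem coefficient_eq {q : K} {u : Idx n → K}
    (hqu : ∀ a b, q * u a - q⁻¹ * u b ≠ 0) (τ : Equiv.Perm (Idx n)) :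
    coefficient q n u (fun i => u (τ i)) = crossKernel q (block n) (fun i => u (τ i))
      * nestedSum (block n) q u (Fin.last m) (lastPerm (block n) τ) := by
  have hne : ∀ (x y : Idx n → K), (∀ i, ∃ a, x i = u a) → (∀ i, ∃ a, y i = u a) →
      ∀ j k, qProd q n x y j k ≠ 0 := fun x y hx hy j k =>
    prod_ne_zero_iff.2 fun a _ => prod_ne_zero_iff.2 fun b _ => by
      obtain ⟨i, hi⟩ := hx (mkIdx n j a)
      obtain ⟨i', hi'⟩ := hy (mkIdx n k b)
      rw [hi, hi']
      exact hqu i i'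
  set v : Idx n → K := fun i => u (τ i) with hv
  have nuv := hne u v (fun i => ⟨i, rfl⟩) (fun i => ⟨τ i, rfl⟩)
  have nuu := hne u u (fun i => ⟨i, rfl⟩) (fun i => ⟨i, rfl⟩)
  have nvv := hne v v (fun i => ⟨τ i, rfl⟩) (fun i => ⟨τ i, rfl⟩)
  have hright : ∀ (x : Idx n → K) j, ∏ k, qProd q n x v j k = ∏ k, qProd q n x u j k :=
    fun x j => by
      rw [prod_qProd, prod_qProd]
      exact prod_congr rfl fun a _ => Equiv.prod_comp τ fun i => q * x (mkIdx n j a) - q⁻¹ * u i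
  have hleft : ∀ (y : Idx n → K) k, ∏ j, qProd q n v y j k = ∏ j, qProd q n u y j k :=
    fun y k => by
      rw [prod_qProd_left, prod_qProd_left]
      exact prod_congr rfl fun b _ => Equiv.prod_comp τ fun i => q * u i - q⁻¹ * y (mkIdx n k b)
  have htot : ∏ j, ∏ k, qProd q n v v j k = ∏ j, ∏ k, qProd q n u u j k := by
    simp only [hright v]
    rw [prod_comm]
    simp only [hleft u]
    rw [prod_comm]
  rw [coefficient, specialWeight, weight_eq_nestedSum (monotone_block n) hqu, crossKernel_block,
    ← mul_assoc]
  congr 1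
  -- With a single colour every product is empty; otherwise there is a last layer to split off.
  obtain _ | m := m
  · simp
  have hA : ∏ k : Fin (m + 1), ∏ j with j < k.succ, diffProd n v v k.succ j
      = ∏ k, ∏ j with j < k, diffProd n v v k j := by
    rw [Fin.prod_univ_succ (fun k => ∏ j with j < k, diffProd n v v k j)]
    simp
  have hB : (∏ k : Fin (m + 1), ∏ j with j < k.succ, qProd q n v v j k.castSucc)
        * ∏ j, qProd q n v v j (Fin.last (m + 1))
      = ∏ k, ∏ j with j ≤ k, qProd q n v v j k := by
    rw [Fin.prod_univ_castSucc (fun k => ∏ j with j ≤ k, qProd q n v v j k)]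
    simp only [← Fin.le_castSucc_iff, Fin.le_last, filter_true]
  have hsplit : ∏ j, ∏ k, qProd q n v v j k
      = (∏ k, ∏ j with j ≤ k, qProd q n v v j k) * ∏ k, ∏ j with j < k, qProd q n v v k j := by
    have : ∏ k, ∏ j with j < k, qProd q n v v k j
        = ∏ k, ∏ j with ¬ j ≤ k, qProd q n v v j k := by
      simp only [prod_filter, not_le]
      rw [prod_comm]
    rw [this, ← prod_mul_distrib, prod_comm]
    exact prod_congr rfl fun k _ => (prod_filter_mul_prod_filter_not _ _ _).symm
  have hD : (∏ j : Fin (m + 1), qProd q n u v (Fin.last (m + 1)) j.castSucc)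
        * qProd q n u v (Fin.last (m + 1)) (Fin.last (m + 1))
      = ∏ k, qProd q n u u (Fin.last (m + 1)) k := by
    rw [← hright u, Fin.prod_univ_castSucc (fun k => qProd q n u v (Fin.last (m + 1)) k)]
  have hE : (∏ j : Fin (m + 1), qProd q n u v j.castSucc (Fin.last (m + 1)))
        * qProd q n u v (Fin.last (m + 1)) (Fin.last (m + 1))
      = ∏ j, qProd q n v v j (Fin.last (m + 1)) := by
    rw [hleft v, Fin.prod_univ_castSucc (fun j => qProd q n u v j (Fin.last (m + 1)))]
  -- The denominator of `coefficient` contains the normalizations of all layers but the last, so the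
  -- last one survives.
  have hW : ∏ p, weightNorm (block n) q u p
      = (∏ l : Fin (m + 1) with l.val + 1 < m + 1, ∏ j with j ≤ l.castSucc,
            ∏ k with k ≤ l.succ, qProd q n u u j k)
        * ∏ j : Fin (m + 1), ∏ k, qProd q n u u j.castSucc k := by
    rw [Fin.prod_univ_castSucc, prod_filter, Fin.prod_univ_castSucc]
    simp only [weightNorm_block, Fin.val_castSucc, Fin.val_last, lt_irrefl, if_false, mul_one,
      add_lt_add_iff_right, Fin.is_lt, if_true]
    congr 1
    rw [prod_filter, Fin.prod_univ_castSucc]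
    simp [Fin.le_last, Fin.castSucc_le_castSucc_iff]
  have hZ : (∏ j : Fin (m + 1), ∏ k, qProd q n u u j.castSucc k)
      * ∏ k, qProd q n u u (Fin.last (m + 1)) k = ∏ j, ∏ k, qProd q n v v j k := by
    rw [htot, Fin.prod_univ_castSucc (fun j => ∏ k, qProd q n u u j k)]
  simp only [prod_mul_distrib]
  rw [hA, hW]
  have n1 : (∏ j : Fin (m + 1), qProd q n u v (Fin.last (m + 1)) j.castSucc) ≠ 0 :=
    prod_ne_zero_iff.2 fun _ _ => nuv _ _
  have n2 : (∏ j : Fin (m + 1), qProd q n u v j.castSucc (Fin.last (m + 1))) ≠ 0 :=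
    prod_ne_zero_iff.2 fun _ _ => nuv _ _
  have n3 := nuv (Fin.last (m + 1)) (Fin.last (m + 1))
  have n4 : (∏ k : Fin (m + 1), ∏ j with j < k.succ, qProd q n v v j k.castSucc) ≠ 0 :=
    prod_ne_zero_iff.2 fun _ _ => prod_ne_zero_iff.2 fun _ _ => nvv _ _
  have n5 : (∏ l : Fin (m + 1) with l.val + 1 < m + 1, ∏ j : Fin (m + 1 + 1) with j ≤ l.castSucc,
      ∏ k : Fin (m + 1 + 1) with k ≤ l.succ, qProd q n u u j k) ≠ 0 :=
    prod_ne_zero_iff.2 fun _ _ => prod_ne_zero_iff.2 fun _ _ => prod_ne_zero_iff.2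
      fun _ _ => nuu _ _
  have key : (∏ j : Fin (m + 1), qProd q n u v (Fin.last (m + 1)) j.castSucc)
        * (∏ j : Fin (m + 1), ∏ k, qProd q n u u j.castSucc k)
      = (∏ k : Fin (m + 1), ∏ j with j < k.succ, qProd q n v v j k.castSucc)
        * (∏ j : Fin (m + 1), qProd q n u v j.castSucc (Fin.last (m + 1)))
        * ∏ k, ∏ j with j < k, qProd q n v v k j := by
    -- The factor pairing the last blocks of u and v is missing from both families; restoring it
    -- completes the products.
    apply mul_right_cancel₀ n3
    rw [mul_right_comm, hD, mul_comm, hZ, hsplit, ← hB, ← hE]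
    ring
  rw [div_eq_mul_inv _ (∏ k, ∏ j with j < k, diffProd n v v k j), one_div, mul_inv]
  rw [mul_comm _ (∏ k, ∏ j with j < k, diffProd n v v k j)⁻¹, mul_assoc, mul_assoc]
  congr 1
  field_simp
  exact key

end

/-! ### The multiple commutation relation for an abstract family of operators -/

section

theorem prod_ofFn_of_step {B : Type*} [Monoid B] {m : ℕ} (f g : Fin (m + 1) → B) (h0 : g 0 = f 0)
    (hs : ∀ p : Fin m, g p.succ = g p.castSucc * f p.succ) :
    (List.ofFn f).prod = g (Fin.last m) := by
  induction m with
  | zero => simp [h0]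
  | succ m ih =>
    have h := ih (fun j => f j.castSucc) (fun j => g j.castSucc) h0 fun p => hs p.castSucc
    rw [List.ofFn_succ', List.concat_eq_append, List.prod_append, h, List.prod_singleton,
      ← Fin.succ_last, hs]

theorem prod_ofFn_rev_of_step {B : Type*} [Monoid B] {m : ℕ} (f g : Fin (m + 1) → B)
    (h0 : g 0 = f 0) (hs : ∀ p : Fin m, g p.succ = f p.succ * g p.castSucc) :
    (List.ofFn fun j => f j.rev).prod = g (Fin.last m) := by
  induction m with
  | zero => simp [h0]
  | succ m ih =>
    have h := ih (fun j => f j.castSucc) (fun j => g j.castSucc) h0 fun p => hs p.castSucc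
    rw [List.ofFn_succ, List.prod_cons]
    simp only [Fin.rev_succ]
    rw [h, Fin.rev_zero, ← Fin.succ_last, hs]

variable {K B : Type*} [Field K] [Ring B] [Algebra K B] {m : ℕ}

theorem orderedOps_below_zero {P : Type*} [Fintype P] [LinearOrder P] {I : P → Fin (m + 1)}
    (hI : Monotone I) {t : Fin (m + 1) → P → B} (ht : ∀ j a b, Commute (t j a) (t j b))
    {x : P → P} (hx : Function.Injective x) :
    orderedOps t (belowColour I 0) (fun a => x a.1)
      = commProd (t 0) (ht 0) ((blockSet I 0).image x) := by
  rw [(colourStep_zero hI).orderedOps_split (x := fun a => x a.1) (ht 0)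
    (hx.comp Subtype.val_injective)]
  have h1 [DecidableEq (Below I 0)] :
      (univ \ univ.image (Fin.elim0 : Fin 0 → Below I 0)).image (fun a => x a.1)
      = (blockSet I 0).image x := by
    rw [← image_val_sdiff_zero, image_image]
    rfl
  have h2 : orderedOps t (belowColour I 0 ∘ (Fin.elim0 : Fin 0 → Below I 0))
      ((fun a : Below I 0 => x a.1) ∘ Fin.elim0) = 1 := by
    simp [orderedOps, descProd]
  rw [@h1, h2, mul_one]

theorem orderedOps_below_succ {P : Type*} [Fintype P] [LinearOrder P] {I : P → Fin (m + 1)}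
    (hI : Monotone I) {t : Fin (m + 1) → P → B} (ht : ∀ j a b, Commute (t j a) (t j b))
    {x : P → P} (hx : Function.Injective x) (p : Fin m) :
    orderedOps t (belowColour I p.succ) (fun a => x a.1)
      = commProd (t p.succ) (ht p.succ) ((blockSet I p.succ).image x)
        * orderedOps t (belowColour I p.castSucc) (fun a => x a.1) := by
  rw [(colourStep_belowIncl hI p).orderedOps_split (x := fun a => x a.1) (ht p.succ)
    (hx.comp Subtype.val_injective)]
  have h1 [DecidableEq (Below I p.succ)] : (univ \ univ.image (belowIncl I p)).image (fun a => x a.1)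
      = (blockSet I p.succ).image x := by
    rw [← image_val_sdiff_belowIncl, image_image]
    rfl
  rw [@h1]
  rfl

variable (n : Fin (m + 1) → ℕ) {t : Fin (m + 1) → Idx n → B}

theorem image_mkIdx (j : Fin (m + 1)) : univ.image (mkIdx n j) = blockSet (block n) j := by
  ext i
  simp only [mem_image, mem_univ, true_and, blockSet, mem_filter]
  constructor
  · rintro ⟨a, rfl⟩
    rfl
  · rintro rfl
    exact ⟨(ofLex i).2, rfl⟩

theorem mkIdx_injective (j : Fin (m + 1)) : Function.Injective (mkIdx n j) := fun a b h => by
  have := congrArg ofLex h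
  simpa [mkIdx] using this

theorem prod_ofFn_mkIdx (ht : ∀ j a b, Commute (t j a) (t j b)) {x : Idx n → Idx n}
    (hx : Function.Injective x) (j : Fin (m + 1)) :
    (List.ofFn fun a : Fin (n j) => t j (x (mkIdx n j a))).prod
      = commProd (t j) (ht j) ((blockSet (block n) j).image x) := by
  have hn : (List.ofFn fun a : Fin (n j) => x (mkIdx n j a)).Nodup :=
    List.nodup_ofFn.2 (hx.comp (mkIdx_injective n j))
  have hs : (List.ofFn fun a : Fin (n j) => x (mkIdx n j a)).toFinset
      = (blockSet (block n) j).image x := by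
    rw [← image_mkIdx, image_image]
    ext i
    simp [List.mem_ofFn]
  have h := noncommProd_toFinset _ (t j) (fun a _ b _ _ => ht j a b) hn
  rw [List.map_ofFn] at h
  refine h.symm.trans ?_
  rw [commProd]
  congr 1

theorem orderedProd_eq_partialProd (ht : ∀ j a b, Commute (t j a) (t j b)) :
    orderedProd n t = partialProd (block n) t ht (Fin.last m) := by
  have h : ∀ j, (List.ofFn fun a : Fin (n j) => t j (mkIdx n j a)).prod
      = commProd (t j) (ht j) (blockSet (block n) j) := fun j => by
    have := prod_ofFn_mkIdx n ht Function.injective_id j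
    rwa [image_id] at this
  rw [orderedProd]
  simp only [h]
  exact prod_ofFn_of_step _ (partialProd (block n) t ht) rfl fun p => partialProd_succ _ _ _ p

theorem reversedProd_eq_orderedOps (ht : ∀ j a b, Commute (t j a) (t j b)) {x : Idx n → Idx n}
    (hx : Function.Injective x) : reversedProd n (fun j i => t j (x i))
      = orderedOps t (belowColour (block n) (Fin.last m)) fun a => x a.1 := by
  rw [reversedProd]
  simp only [prod_ofFn_mkIdx n ht hx]
  exact prod_ofFn_rev_of_step (fun j => commProd (t j) (ht j) ((blockSet (block n) j).image x))
    (fun p => orderedOps t (belowColour (block n) p) fun a => x a.1)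
    (orderedOps_below_zero (monotone_block n) ht hx)
    fun p => orderedOps_below_succ (monotone_block n) ht hx p

theorem card_colourPerms_block :
    #(colourPerms (block n)) = blockOrderings (block n) (Fin.last m) := by
  have h := DomMulAct.stabilizer_card (block n)
  rw [Fintype.card_subtype] at h
  rw [blockOrderings, filter_true_of_mem fun j _ => Fin.le_last j]
  convert h using 2
  · ext σ
    simp [mem_colourPerms, funext_iff]
  · rename_i j _
    rw [Fintype.card_subtype, blockSet]

theorem crossKernel_lastPerm (q : K) (u : Idx n → K) (τ : Equiv.Perm (Idx n)) :
    crossKernel q (belowColour (block n) (Fin.last m))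
        (fun a => u (lastPerm (block n) τ a).1)
      = crossKernel q (block n) fun i => u (τ i) := by
  let e : Below (block n) (Fin.last m) ≃ Idx n :=
    Equiv.subtypeUnivEquiv fun i => Fin.le_last (block n i)
  refine Fintype.prod_equiv e _ _ fun a => ?_
  exact prod_equiv e (fun b => by
    simp only [mem_filter, mem_univ, true_and]
    exact Iff.rfl) fun b _ => rfl

/-- The multiple commutation relation. -/
theorem orderedProd_eq_sum [CharZero K] {q : K} (hq : q ≠ 0) {u : Idx n → K}
    (hu : Function.Injective u) (hu0 : ∀ a, u a ≠ 0) (hqu : ∀ a b, q * u a - q⁻¹ * u b ≠ 0)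
    (ht : ∀ j a b, Commute (t j a) (t j b)) (hex : ∀ j k, j < k → Exchange q u (t k) (t j))
    (τ : BlockPartition n → Equiv.Perm (Idx n)) (hτ : ∀ (c : BlockPartition n) i, c.1 (τ c i) = block n i) :
    orderedProd n t = ∑ c, coefficient q n u (fun i => u (τ c i))
      • reversedProd n fun j i => t j (τ c i) := by
  obtain ⟨hinv, hfree, hid⟩ :=
    blockOrderings_smul_partialProd (monotone_block n) hq hu hu0 hqu ht hex (Fin.last m)
  let F (σ : Equiv.Perm (Idx n)) : B :=
    coefficient q n u (fun i => u (σ i)) • reversedProd n fun j i => t j (σ i)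
  have hF : blockOrderings (block n) (Fin.last m) • orderedProd n t = ∑ σ, F σ := by
    rw [orderedProd_eq_partialProd n ht, hid]
    let e : Below (block n) (Fin.last m) ≃ Idx n :=
      Equiv.subtypeUnivEquiv fun i => Fin.le_last (block n i)
    refine (Fintype.sum_equiv e.symm.permCongr _ _ fun σ => ?_).symm
    have : e.symm.permCongr σ = lastPerm (block n) σ := rfl
    simp only [F]
    rw [this, crossKernel_lastPerm, coefficient_eq n hqu,
      reversedProd_eq_orderedOps n ht σ.injective]
    rfl
  -- In particular the coefficient does not depend on the order chosen inside each set of the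
  -- partition.
  have hperm : ∀ (σ : Equiv.Perm (Idx n)), ∀ γ ∈ colourPerms (block n), F (σ * γ) = F σ := by
    intro σ γ hγ
    have hγ' : lastPerm (block n) γ ∈ colourPerms (belowColour (block n) (Fin.last m)) :=
      mem_colourPerms.2 fun b => mem_colourPerms.1 hγ b.1
    have h1 : lastPerm (block n) (σ * γ) = lastPerm (block n) σ * lastPerm (block n) γ := rfl
    have h2 := hfree (fun a => σ a.1) (σ.injective.comp Subtype.val_injective) _ hγ'
    have h3 := crossKernel_comp q (fun i => u (σ i)) (mem_colourPerms.1 hγ)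
    simp only [F]
    rw [coefficient_eq n hqu, coefficient_eq n hqu, h1, hinv _ _ hγ',
      reversedProd_eq_orderedOps n ht (σ * γ).injective,
      reversedProd_eq_orderedOps n ht σ.injective]
    congr 1
    exact congrArg (· * _) h3
  -- The orderings inducing a given partition form the coset of `τ c` by the Young subgroup, on
  -- which `F` is constant.
  have hsum : ∑ σ, F σ = ∑ c, blockOrderings (block n) (Fin.last m) • F (τ c) := by
    have hc : ∀ σ : Equiv.Perm (Idx n), ∀ j,
        (univ.filter fun i => block n (σ.symm i) = j).card = n j := fun σ j => by
      rw [← card_image_of_injective _ σ.symm.injective]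
      have : (univ.filter fun i => block n (σ.symm i) = j).image σ.symm
          = blockSet (block n) j := by
        ext i
        simp only [mem_image, mem_filter, mem_univ, true_and, blockSet]
        exact ⟨fun ⟨a, ha, hi⟩ => hi ▸ ha, fun h => ⟨σ i, by simpa using h, by simp⟩⟩
      rw [this, ← image_mkIdx, card_image_of_injective _ (mkIdx_injective n j), card_univ,
        Fintype.card_fin]
    rw [← sum_fiberwise univ (fun σ : Equiv.Perm (Idx n) =>
      (⟨fun i => block n (σ.symm i), hc σ⟩ : BlockPartition n))]
    refine sum_congr rfl fun c _ => ?_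
    rw [← card_colourPerms_block, ← sum_const]
    symm
    refine sum_equiv (Equiv.mulLeft (τ c)) (fun γ => ?_) fun γ hγ => ?_
    · simp only [mem_colourPerms, mem_filter, mem_univ, true_and, Equiv.coe_mulLeft, Subtype.ext_iff]
      constructor
      · intro h
        funext i
        have h1 := hτ c (γ ((τ c * γ).symm i))
        have h2 : τ c (γ ((τ c * γ).symm i)) = i := (τ c * γ).apply_symm_apply i
        rw [h2, h] at h1
        exact h1.symm
      · intro h b
        have h1 := congrFun h (τ c (γ b))
        have h2 : (τ c * γ).symm (τ c (γ b)) = b := (τ c * γ).symm_apply_apply b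
        simp only [h2] at h1
        rw [← hτ c, ← h1]
    · exact (hperm _ _ hγ).symm
  have h0 : (blockOrderings (block n) (Fin.last m) : K) ≠ 0 := by
    rw [← card_colourPerms_block]
    exact card_colourPerms_ne_zero _
  have h := congrArg (fun y => (blockOrderings (block n) (Fin.last m) : K)⁻¹ • y) (hF.trans hsum)
  simp only [← smul_sum, ← Nat.cast_smul_eq_nsmul K, smul_smul, inv_mul_cancel₀ h0, one_smul] at h
  exact h

end

end QAffine

namespace QAffine

open Finset
open scoped Kronecker

/-! ### The exchange relations contained in the RTT relation -/

section

theorem trigR_apply (N : ℕ) {K : Type*} [Field K] (q u v : K) (k l i j : Fin N) :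
    trigR N q u v (k, l) (i, j)
      = (if k = i ∧ l = j then if i = j then q * u - q⁻¹ * v else u - v else 0)
        + if k = j ∧ l = i then if j < i then (q - q⁻¹) * v else
            if i < j then (q - q⁻¹) * u else 0 else 0 := by
  have single (a b c d : Fin N) :
      (Matrix.single a b (1 : K) ⊗ₖ Matrix.single c d (1 : K)) (k, l) (i, j)
        = if a = k ∧ b = i ∧ c = l ∧ d = j then 1 else 0 := by
    simp only [Matrix.kroneckerMap_apply, Matrix.single_apply, ite_and]
    split_ifs <;> simp
  have pair (k l : Fin N) (c : K) (F : Fin N → Fin N → K)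
      (hF : ∀ a b, F a b = if a = k then if b = l then c else 0 else 0) :
      ∑ a, ∑ b with a < b, F a b = if k < l then c else 0 := by
    simp only [hF, sum_filter]
    rw [sum_eq_single k (fun a _ ha => by simp [ha]) (by simp),
      sum_eq_single l (fun b _ hb => by simp [hb]) (by simp)]
    simp
  have h1 : (∑ a : Fin N, Matrix.single a a (1 : K) ⊗ₖ Matrix.single a a (1 : K)) (k, l) (i, j)
      = if k = i ∧ l = j ∧ i = j then 1 else 0 := by
    simp only [Matrix.sum_apply, single]
    rw [sum_eq_single k (fun a _ ha => by simp [ha]) (by simp)]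
    congr 1
    grind
  have h2 : (∑ a : Fin N, ∑ b : Fin N with a < b,
      (Matrix.single a a (1 : K) ⊗ₖ Matrix.single b b (1 : K)
        + Matrix.single b b (1 : K) ⊗ₖ Matrix.single a a (1 : K))) (k, l) (i, j)
      = if k = i ∧ l = j ∧ i ≠ j then 1 else 0 := by
    simp only [Matrix.sum_apply, Matrix.add_apply, single, sum_add_distrib]
    rw [pair k l (if k = i ∧ l = j then 1 else 0) _ fun a b => by grind,
      pair l k (if k = i ∧ l = j then 1 else 0) _ fun a b => by grind]
    grind
  have h3 : (∑ a : Fin N, ∑ b : Fin N with a < b,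
      Matrix.single a b (1 : K) ⊗ₖ Matrix.single b a (1 : K)) (k, l) (i, j)
      = if k = j ∧ l = i ∧ j < i then 1 else 0 := by
    simp only [Matrix.sum_apply, single]
    rw [pair k l (if k = j ∧ l = i then 1 else 0) _ fun a b => by grind]
    grind
  have h4 : (∑ a : Fin N, ∑ b : Fin N with a < b,
      Matrix.single b a (1 : K) ⊗ₖ Matrix.single a b (1 : K)) (k, l) (i, j)
      = if k = j ∧ l = i ∧ i < j then 1 else 0 := by
    simp only [Matrix.sum_apply, single]
    rw [pair l k (if k = j ∧ l = i then 1 else 0) _ fun a b => by grind]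
    grind
  simp only [trigR, Matrix.add_apply, Matrix.smul_apply, h1, h2, h3, h4, smul_eq_mul, mul_ite,
    mul_one, mul_zero]
  grind

variable {m : ℕ} {A : Type*} [Ring A] [Algebra ℂ A]

omit [Algebra ℂ A] in
theorem kronecker_one_mul_apply {N : ℕ} (X Y : Matrix (Fin N) (Fin N) A) (k l i j : Fin N) :
    ((X ⊗ₖ (1 : Matrix (Fin N) (Fin N) A)) * ((1 : Matrix (Fin N) (Fin N) A) ⊗ₖ Y)) (k, l) (i, j)
      = X k i * Y l j := by
  simp [Matrix.mul_apply, Fintype.sum_prod_type, Matrix.kroneckerMap_apply, Matrix.one_apply]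

omit [Algebra ℂ A] in
theorem one_kronecker_mul_apply {N : ℕ} (X Y : Matrix (Fin N) (Fin N) A) (k l i j : Fin N) :
    (((1 : Matrix (Fin N) (Fin N) A) ⊗ₖ Y) * (X ⊗ₖ (1 : Matrix (Fin N) (Fin N) A))) (k, l) (i, j)
      = Y l j * X k i := by
  simp [Matrix.mul_apply, Fintype.sum_prod_type, Matrix.kroneckerMap_apply, Matrix.one_apply]

/-- On an output pair `(p, p)` the R-matrix is diagonal, so a single product survives. This is why
the entries of one row satisfy closed relations. -/
theorem trigRIn_mul_apply {N : ℕ} (q u v : ℂ) (X Y : Matrix (Fin N) (Fin N) A) (p i j : Fin N) :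
    (trigRIn N A q u v * (X ⊗ₖ (1 : Matrix (Fin N) (Fin N) A))
        * ((1 : Matrix (Fin N) (Fin N) A) ⊗ₖ Y)) (p, p) (i, j)
      = (q * u - q⁻¹ * v) • (X p i * Y p j) := by
  rw [mul_assoc, Matrix.mul_apply, Fintype.sum_prod_type, sum_eq_single p, sum_eq_single p]
  · rw [kronecker_one_mul_apply, trigRIn, Matrix.map_apply, trigR_apply, Algebra.smul_def]
    simp
  · intro l _ hl
    rw [trigRIn, Matrix.map_apply, trigR_apply]
    simp [hl.symm]
  · simp
  · intro k _ hk
    refine sum_eq_zero fun l _ => ?_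
    rw [trigRIn, Matrix.map_apply, trigR_apply]
    simp [hk.symm]
  · simp

theorem mul_trigRIn_apply_self {N : ℕ} (q u v : ℂ) (X Y : Matrix (Fin N) (Fin N) A)
    (p i : Fin N) :
    (((1 : Matrix (Fin N) (Fin N) A) ⊗ₖ Y) * (X ⊗ₖ (1 : Matrix (Fin N) (Fin N) A))
        * trigRIn N A q u v) (p, p) (i, i)
      = (q * u - q⁻¹ * v) • (Y p i * X p i) := by
  rw [Matrix.mul_apply, Fintype.sum_prod_type, sum_eq_single i, sum_eq_single i]
  · rw [one_kronecker_mul_apply, trigRIn, Matrix.map_apply, trigR_apply, Algebra.smul_def,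
      Algebra.commutes]
    simp
  · intro l _ hl
    rw [trigRIn, Matrix.map_apply, trigR_apply]
    simp [hl]
  · simp
  · intro k _ hk
    refine sum_eq_zero fun l _ => ?_
    rw [trigRIn, Matrix.map_apply, trigR_apply]
    simp [hk]
  · simp

theorem mul_trigRIn_apply_of_lt {N : ℕ} (q u v : ℂ) (X Y : Matrix (Fin N) (Fin N) A)
    (p : Fin N) {i j : Fin N} (hij : j < i) :
    (((1 : Matrix (Fin N) (Fin N) A) ⊗ₖ Y) * (X ⊗ₖ (1 : Matrix (Fin N) (Fin N) A))
        * trigRIn N A q u v) (p, p) (i, j)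
      = (u - v) • (Y p j * X p i) + ((q - q⁻¹) * v) • (Y p i * X p j) := by
  have h : ∀ k l, trigRIn N A q u v (k, l) (i, j)
      = (if k = i then if l = j then algebraMap ℂ A (u - v) else 0 else 0)
        + if k = j then if l = i then algebraMap ℂ A ((q - q⁻¹) * v) else 0 else 0 := fun k l => by
    rw [trigRIn, Matrix.map_apply, trigR_apply]
    simp only [hij.ne', hij, if_false, if_true, ite_and, map_add, apply_ite (algebraMap ℂ A),
      map_zero]
  rw [Matrix.mul_apply, Fintype.sum_prod_type]
  simp only [one_kronecker_mul_apply, h, mul_add, sum_add_distrib, mul_ite, mul_zero,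
    Algebra.smul_def, Algebra.commutes]
  simp [sum_ite_irrel]

theorem RTT.commute_relation {N : ℕ} {q u v : ℂ} {X Y : Matrix (Fin N) (Fin N) A}
    (h : RTT q u v X Y) (p i : Fin N) :
    (q * u - q⁻¹ * v) • (X p i * Y p i) = (q * u - q⁻¹ * v) • (Y p i * X p i) := by
  rw [← trigRIn_mul_apply, ← mul_trigRIn_apply_self, h]

theorem RTT.exchange_relation {N : ℕ} {q u v : ℂ} {X Y : Matrix (Fin N) (Fin N) A}
    (h : RTT q u v X Y) (p : Fin N) {i j : Fin N} (hij : j < i) :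
    (q * u - q⁻¹ * v) • (X p i * Y p j)
      = (u - v) • (Y p j * X p i) + ((q - q⁻¹) * v) • (Y p i * X p j) := by
  rw [← trigRIn_mul_apply, ← mul_trigRIn_apply_of_lt _ _ _ _ _ _ hij, h]

/-- The multiple commutation relation for an L-operator with a complex spectral parameter. -/
theorem orderedProd_eq_sum_of_RTT {q : ℂ} (hq : q ≠ 0) (n : Fin (m + 1) → ℕ)
    (τ : BlockPartition n → Equiv.Perm (Idx n))
    (hτ : ∀ (c : BlockPartition n) (i : Idx n), c.1 (τ c i) = block n i) {Ω : Set ℂ}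
    {T : ℂ → Matrix (Fin (m + 1)) (Fin (m + 1)) A}
    (hT : ∀ u ∈ Ω, ∀ v ∈ Ω, RTT q u v (T u) (T v)) {u : Idx n → ℂ} (huΩ : ∀ i, u i ∈ Ω)
    (hu : Function.Injective u) (hqu : ∀ i k, q * u i ≠ q⁻¹ * u k) :
    orderedProd n (fun j i => T (u i) (Fin.last m) j)
      = ∑ c : BlockPartition n, coefficient q n u (fun i => u (τ c i)) •
          reversedProd n (fun j i => T (u (τ c i)) (Fin.last m) j) := by
  have hqu' : ∀ a b, q * u a - q⁻¹ * u b ≠ 0 := fun a b => sub_ne_zero.2 (hqu a b)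
  -- The case `i = k` of the genericity condition excludes zero as a spectral value.
  refine orderedProd_eq_sum n hq hu (fun a h => hqu a a (by rw [h, mul_zero, mul_zero])) hqu'
    (t := fun j i => T (u i) (Fin.last m) j) (fun j a b => ?_) (fun j k hjk a b _ => ?_) τ hτ
  · exact smul_right_injective A (hqu' a b)
      ((hT _ (huΩ a) _ (huΩ b)).commute_relation (Fin.last m) j)
  · rw [(hT _ (huΩ b) _ (huΩ a)).exchange_relation (Fin.last m) hjk, add_sub_cancel_right]

end

/-! ### Formal series in two of the variables -/

section

variable {ι A : Type*} [DecidableEq ι] [Ring A] [Algebra ℂ A]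

/-- The series `∑ F(-k,-l) X_a^k X_b^l`. -/
noncomputable def pairSeries (a b : ι) (F : ℤ → ℤ → A) : MvPowerSeries ι A := fun e =>
  if e = Finsupp.single a (e a) + Finsupp.single b (e b) then F (-(e a : ℤ)) (-(e b : ℤ)) else 0

omit [Algebra ℂ A] in
theorem coeff_pairSeries (a b : ι) (F : ℤ → ℤ → A) (e : ι →₀ ℕ) :
    MvPowerSeries.coeff e (pairSeries a b F)
      = if e = Finsupp.single a (e a) + Finsupp.single b (e b)
          then F (-(e a : ℤ)) (-(e b : ℤ)) else 0 := rfl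

omit [Algebra ℂ A] in
theorem pairSeries_swap (a b : ι) (F : ℤ → ℤ → A) :
    pairSeries a b F = pairSeries b a fun r s => F s r := by
  ext e
  rw [coeff_pairSeries, coeff_pairSeries, add_comm]

omit [Algebra ℂ A] in
theorem seriesAt_mul_seriesAt {a b : ι} (hab : a ≠ b) (f g : ℤ → A) :
    seriesAt (fun k : ℕ => f (-k)) a * seriesAt (fun k : ℕ => g (-k)) b
      = pairSeries a b fun r s => f r * g s := by
  have hc : ∀ (h : ℤ → A) (c : ι) (e : ι →₀ ℕ),
      MvPowerSeries.coeff e (seriesAt (fun k : ℕ => h (-k)) c)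
        = if e = Finsupp.single c (e c) then h (-(e c : ℤ)) else 0 := fun h c e => rfl
  ext e
  rw [MvPowerSeries.coeff_mul, coeff_pairSeries]
  simp only [hc]
  have key : ∀ p : (ι →₀ ℕ) × (ι →₀ ℕ), p ∈ antidiagonal e → p.1 = Finsupp.single a (p.1 a) →
      p.2 = Finsupp.single b (p.2 b) → p.1 a = e a ∧ p.2 b = e b := by
    intro p hp h1 h2
    rw [HasAntidiagonal.mem_antidiagonal] at hp
    rw [← hp, Finsupp.add_apply, Finsupp.add_apply]
    have e1 : p.1 b = 0 := by rw [h1]; simp [hab.symm]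
    have e2 : p.2 a = 0 := by rw [h2]; simp [hab]
    rw [e1, e2]
    simp
  split_ifs with he
  · rw [sum_eq_single (Finsupp.single a (e a), Finsupp.single b (e b))]
    · simp
    · intro p hp hne
      by_cases h1 : p.1 = Finsupp.single a (p.1 a)
      · by_cases h2 : p.2 = Finsupp.single b (p.2 b)
        · obtain ⟨h3, h4⟩ := key p hp h1 h2
          rw [h3] at h1
          rw [h4] at h2
          exact absurd (Prod.ext h1 h2) hne
        · rw [if_neg h2, mul_zero]
      · rw [if_neg h1, zero_mul]
    · intro h
      exact absurd (HasAntidiagonal.mem_antidiagonal.2 he.symm) h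
  · refine sum_eq_zero fun p hp => ?_
    by_cases h1 : p.1 = Finsupp.single a (p.1 a)
    · by_cases h2 : p.2 = Finsupp.single b (p.2 b)
      · obtain ⟨h3, h4⟩ := key p hp h1 h2
        rw [h3] at h1
        rw [h4] at h2
        refine absurd ?_ he
        rw [← h1, ← h2]
        exact (HasAntidiagonal.mem_antidiagonal.1 hp).symm
      · rw [if_neg h2, mul_zero]
    · rw [if_neg h1, zero_mul]

omit [Algebra ℂ A] in
theorem seriesAt_mul_seriesAt_swap {a b : ι} (hab : a ≠ b) (f g : ℤ → A) :
    seriesAt (fun k : ℕ => g (-k)) b * seriesAt (fun k : ℕ => f (-k)) a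
      = pairSeries a b fun r s => g s * f r := by
  rw [seriesAt_mul_seriesAt hab.symm, pairSeries_swap]

/-- The scalar polynomials as a ring of series. -/
noncomputable def scalarHom (ι A : Type*) [Ring A] [Algebra ℂ A] : MvPolynomial ι ℂ →+* MvPowerSeries ι A :=
  (MvPowerSeries.map (algebraMap ℂ A)).comp MvPolynomial.coeToMvPowerSeries.ringHom

omit [DecidableEq ι] in
theorem scalarHom_apply (D : MvPolynomial ι ℂ) : scalarHom ι A D = scalarSeries A D := rfl

omit [DecidableEq ι] in
theorem scalarHom_commutes (D : MvPolynomial ι ℂ) (s : MvPowerSeries ι A) :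
    scalarHom ι A D * s = s * scalarHom ι A D := by
  classical
  ext e
  rw [MvPowerSeries.coeff_mul, MvPowerSeries.coeff_mul]
  refine sum_equiv (Equiv.prodComm _ _) (fun p => ?_) fun p _ => Algebra.commutes _ _
  simp [HasAntidiagonal.mem_antidiagonal, add_comm]

omit [DecidableEq ι] in
theorem scalarHom_C_mul (c : ℂ) (s : MvPowerSeries ι A) :
    scalarHom ι A (MvPolynomial.C c) * s = c • s := by
  have : scalarHom ι A (MvPolynomial.C c) = MvPowerSeries.C (algebraMap ℂ A c) := by
    rw [scalarHom_apply, scalarSeries, MvPolynomial.coe_C, MvPowerSeries.map_C]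
  ext e
  rw [this, MvPowerSeries.coeff_C_mul, ← Algebra.smul_def]
  rfl

/-- Multiplication by X_a shifts the mode index; the hypothesis on the mode of u_a^1 is what makes
the shifted series have no spurious constant term in X_a. -/
theorem scalarHom_X_mul_pairSeries {a b : ι} (hab : a ≠ b) {F : ℤ → ℤ → A}
    (hF : ∀ s, F 1 s = 0) : scalarHom ι A (MvPolynomial.X a) * pairSeries a b F
      = pairSeries a b fun r s => F (r + 1) s := by
  have h : scalarHom ι A (MvPolynomial.X a)
      = MvPowerSeries.monomial (Finsupp.single a 1) 1 := by
    rw [scalarHom_apply, scalarSeries, MvPolynomial.coe_X, MvPowerSeries.map_X]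
    rfl
  ext e
  rw [h, MvPowerSeries.coeff_monomial_mul, coeff_pairSeries, coeff_pairSeries, one_mul]
  by_cases hle : Finsupp.single a 1 ≤ e
  · rw [if_pos hle]
    obtain ⟨d, hd⟩ := exists_add_of_le hle
    have ea : e a = 1 + d a := by simp [hd]
    have eb : e b = d b := by simp [hd, hab]
    have hiff : d = Finsupp.single a (d a) + Finsupp.single b (d b)
        ↔ e = Finsupp.single a (e a) + Finsupp.single b (e b) := by
      rw [ea, eb, hd, Finsupp.single_add, add_assoc, add_right_inj]
    rw [show e - Finsupp.single a 1 = d by rw [hd, add_tsub_cancel_left], if_congr hiff rfl rfl,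
      ea, eb]
    congr 2
    push_cast
    ring
  · rw [if_neg hle]
    have h0 : e a = 0 := by
      by_contra hne
      exact hle (Finsupp.single_le_iff.2 (Nat.one_le_iff_ne_zero.2 hne))
    simp [h0, hF]

theorem scalarHom_X_mul_pairSeries_right {a b : ι} (hab : a ≠ b) {F : ℤ → ℤ → A}
    (hF : ∀ r, F r 1 = 0) : scalarHom ι A (MvPolynomial.X b) * pairSeries a b F
      = pairSeries a b fun r s => F r (s + 1) := by
  rw [pairSeries_swap a b, scalarHom_X_mul_pairSeries hab.symm hF, pairSeries_swap]

omit [DecidableEq ι] in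
-- A linear functional on `A`, applied coefficientwise, reduces the claim to series over `ℂ`, which
-- form a domain; functionals separate the points of `A`.
theorem scalarHom_mul_eq_zero {D : MvPolynomial ι ℂ} (hD : D ≠ 0) {s : MvPowerSeries ι A}
    (h : scalarHom ι A D * s = 0) : s = 0 := by
  classical
  have hD' : (D : MvPowerSeries ι ℂ) ≠ 0 := fun h0 => hD (MvPolynomial.coe_eq_zero_iff.1 h0)
  ext e
  rw [MvPowerSeries.coeff_zero]
  refine (Module.forall_dual_apply_eq_zero_iff ℂ _).1 fun φ => ?_
  let s' : MvPowerSeries ι ℂ := fun e => φ (MvPowerSeries.coeff e s)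
  have hs' : (D : MvPowerSeries ι ℂ) * s' = 0 := by
    ext e
    have he := congrArg (fun f => φ (MvPowerSeries.coeff e f)) h
    simp only [MvPowerSeries.coeff_mul, map_sum, map_zero] at he
    rw [MvPowerSeries.coeff_mul, map_zero, ← he]
    refine sum_congr rfl fun p _ => ?_
    rw [scalarHom_apply, scalarSeries, MvPowerSeries.coeff_map, ← Algebra.smul_def, map_smul]
    rfl
  have := (mul_eq_zero.1 hs').resolve_left hD'
  exact congrArg (MvPowerSeries.coeff e) this

end

end QAffine

namespace QAffine

open Finset
open scoped TensorProduct

/-! ### The identity of formal series -/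

section

variable {ι A : Type*} [DecidableEq ι] [Ring A] [Algebra ℂ A]

theorem seriesAt_commute_relation {a b : ι} (hab : a ≠ b) {q : ℂ} {f : ℤ → A} (hf : f 1 = 0)
    (h : ∀ r s, q • (f r * f (s + 1)) - q⁻¹ • (f (r + 1) * f s)
      = q • (f (s + 1) * f r) - q⁻¹ • (f s * f (r + 1))) :
    scalarHom ι A (MvPolynomial.C q * MvPolynomial.X b - MvPolynomial.C q⁻¹ * MvPolynomial.X a)
        * (seriesAt (fun k : ℕ => f (-k)) a * seriesAt (fun k : ℕ => f (-k)) b)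
      = scalarHom ι A (MvPolynomial.C q * MvPolynomial.X b
          - MvPolynomial.C q⁻¹ * MvPolynomial.X a)
        * (seriesAt (fun k : ℕ => f (-k)) b * seriesAt (fun k : ℕ => f (-k)) a) := by
  rw [seriesAt_mul_seriesAt hab, seriesAt_mul_seriesAt_swap hab]
  simp only [map_sub, map_mul, sub_mul, mul_assoc]
  rw [scalarHom_X_mul_pairSeries hab (by simp [hf]),
    scalarHom_X_mul_pairSeries_right hab (by simp [hf]),
    scalarHom_X_mul_pairSeries hab (by simp [hf]),
    scalarHom_X_mul_pairSeries_right hab (by simp [hf])]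
  simp only [scalarHom_C_mul]
  ext e
  have hc : ∀ (c : ℂ) (x : MvPowerSeries ι A), MvPowerSeries.coeff e (c • x)
      = c • MvPowerSeries.coeff e x := fun _ _ => rfl
  simp only [map_sub, hc, coeff_pairSeries]
  split_ifs
  · exact h _ _
  · simp

/-- The relation in the spectral variables multiplied by X_a X_b, which clears the inverses and
makes every scalar a polynomial; comparing coefficients gives back the mode relation. -/
theorem seriesAt_exchange_relation {a b : ι} (hab : a ≠ b) {q : ℂ} {f g : ℤ → A} (hf : f 1 = 0)
    (hg : g 1 = 0)
    (h : ∀ r s, q • (f r * g (s + 1)) - q⁻¹ • (f (r + 1) * g s)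
      = g (s + 1) * f r - g s * f (r + 1) + (q - q⁻¹) • (f s * g (r + 1))) :
    scalarHom ι A (MvPolynomial.C q * MvPolynomial.X b - MvPolynomial.C q⁻¹ * MvPolynomial.X a)
        * (seriesAt (fun k : ℕ => f (-k)) a * seriesAt (fun k : ℕ => g (-k)) b)
      = scalarHom ι A (MvPolynomial.X b - MvPolynomial.X a)
          * (seriesAt (fun k : ℕ => g (-k)) b * seriesAt (fun k : ℕ => f (-k)) a)
        + scalarHom ι A (MvPolynomial.C (q - q⁻¹) * MvPolynomial.X a)
          * (seriesAt (fun k : ℕ => f (-k)) b * seriesAt (fun k : ℕ => g (-k)) a) := by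
  rw [seriesAt_mul_seriesAt hab, seriesAt_mul_seriesAt_swap hab, seriesAt_mul_seriesAt_swap hab]
  simp only [map_sub, map_mul (scalarHom ι A), sub_mul, mul_assoc]
  rw [scalarHom_X_mul_pairSeries hab (by simp [hf]),
    scalarHom_X_mul_pairSeries_right hab (by simp [hg]),
    scalarHom_X_mul_pairSeries hab (by simp [hf]),
    scalarHom_X_mul_pairSeries_right hab (by simp [hg]),
    scalarHom_X_mul_pairSeries hab (by simp [hg])]
  simp only [scalarHom_C_mul]
  ext e
  have hc : ∀ (c : ℂ) (x : MvPowerSeries ι A), MvPowerSeries.coeff e (c • x)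
      = c • MvPowerSeries.coeff e x := fun _ _ => rfl
  simp only [map_sub, map_add, hc, coeff_pairSeries]
  split_ifs
  · have := h (-(e a : ℤ)) (-(e b : ℤ))
    rw [sub_smul] at this
    exact this
  · simp

omit [DecidableEq ι] in
theorem uVar_ne_zero (a : ι) : (uVar a : FractionRing (MvPolynomial ι ℂ)) ≠ 0 :=
  inv_ne_zero ((map_ne_zero_iff _ (IsFractionRing.injective (MvPolynomial ι ℂ) _)).2
    (MvPolynomial.X_ne_zero a))

omit [DecidableEq ι] in
theorem uVar_injective : Function.Injective (uVar : ι → FractionRing (MvPolynomial ι ℂ)) :=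
  fun _ _ h => MvPolynomial.X_injective
    (IsFractionRing.injective (MvPolynomial ι ℂ) (FractionRing (MvPolynomial ι ℂ)) (inv_injective h))

omit [DecidableEq ι] in
-- After clearing inverses, evaluating all variables at 1 would give `q = q⁻¹`. This also covers `a
-- = b`.
theorem uVar_kernel_ne_zero {q : ℂ} (hq0 : q ≠ 0) (hq1 : q ^ 2 ≠ 1) (a b : ι) :
    algebraMap ℂ (FractionRing (MvPolynomial ι ℂ)) q * uVar a
      - (algebraMap ℂ (FractionRing (MvPolynomial ι ℂ)) q)⁻¹ * uVar b ≠ 0 := by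
  intro h
  have ha := uVar_ne_zero a
  have hb := uVar_ne_zero b
  have h1 : algebraMap (MvPolynomial ι ℂ) (FractionRing (MvPolynomial ι ℂ))
      (MvPolynomial.C q * MvPolynomial.X b - MvPolynomial.C q⁻¹ * MvPolynomial.X a) = 0 := by
    have h2 : ∀ c : ι, algebraMap (MvPolynomial ι ℂ) (FractionRing (MvPolynomial ι ℂ))
        (MvPolynomial.X c) = (uVar c)⁻¹ := fun c => (inv_inv _).symm
    have h3 : ∀ c : ℂ, algebraMap (MvPolynomial ι ℂ) (FractionRing (MvPolynomial ι ℂ))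
        (MvPolynomial.C c) = algebraMap ℂ (FractionRing (MvPolynomial ι ℂ)) c := fun c =>
      (IsScalarTower.algebraMap_apply ℂ (MvPolynomial ι ℂ) _ c).symm
    rw [map_sub, map_mul, map_mul, h2, h2, h3, h3, map_inv₀]
    have h4 := congrArg (· * ((uVar a)⁻¹ * (uVar b)⁻¹)) h
    simp only [zero_mul] at h4
    rw [← h4]
    field_simp
  have h5 := (map_eq_zero_iff _ (IsFractionRing.injective (MvPolynomial ι ℂ) _)).1 h1
  have h6 := congrArg (MvPolynomial.eval fun _ => (1 : ℂ)) h5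
  simp only [map_sub, map_mul, MvPolynomial.eval_C, MvPolynomial.eval_X, mul_one, map_zero] at h6
  apply hq1
  rw [sub_eq_zero] at h6
  rw [sq]
  nth_rewrite 2 [h6]
  exact mul_inv_cancel₀ hq0

end

section

variable {m : ℕ} (n : Fin (m + 1) → ℕ)

theorem map_orderedProd {B B' : Type*} [Monoid B] [Monoid B'] (f : B →* B')
    (t : Fin (m + 1) → Idx n → B) :
    f (orderedProd n t) = orderedProd n fun j i => f (t j i) := by
  simp only [orderedProd, map_list_prod, List.map_ofFn, Function.comp_def]

theorem map_reversedProd {B B' : Type*} [Monoid B] [Monoid B'] (f : B →* B')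
    (t : Fin (m + 1) → Idx n → B) :
    f (reversedProd n t) = reversedProd n fun j i => f (t j i) := by
  simp only [reversedProd, map_list_prod, List.map_ofFn, Function.comp_def]

theorem inverse_variable_identities {F : Type*} [Field F] {a b : F} (ha : a ≠ 0) (hb : b ≠ 0)
    (q c : F) : q * b⁻¹ - q⁻¹ * a⁻¹ = a⁻¹ * b⁻¹ * (q * a - q⁻¹ * b) ∧
      b⁻¹ - a⁻¹ = a⁻¹ * b⁻¹ * (a - b) ∧ c * a⁻¹ = a⁻¹ * b⁻¹ * (c * b) := by
  have h1 : a⁻¹ * a = 1 := inv_mul_cancel₀ ha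
  have h2 : b⁻¹ * b = 1 := inv_mul_cancel₀ hb
  refine ⟨?_, ?_, ?_⟩
  · linear_combination (-q * b⁻¹) * h1 + q⁻¹ * a⁻¹ * h2
  · linear_combination (-b⁻¹) * h1 + a⁻¹ * h2
  · linear_combination (-c * a⁻¹) * h2

theorem smul_cancel {F V : Type*} [Field F] [AddCommGroup V] [Module F V] {c : F} (hc : c ≠ 0)
    {x y : V} (h : c • x = c • y) : x = y :=
  smul_right_injective V hc h

/-- The multiple commutation relation for formal series satisfying the exchange relations. -/
theorem formalRelation_of_modes {A : Type*} [Ring A] [Algebra ℂ A] {q : ℂ} (hq0 : q ≠ 0)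
    (hq1 : q ^ 2 ≠ 1) (τ : BlockPartition n → Equiv.Perm (Idx n))
    (hτ : ∀ (c : BlockPartition n) (i : Idx n), c.1 (τ c i) = block n i)
    (f : Fin (m + 1) → ℤ → A) (hf : ∀ j, f j 1 = 0)
    (hcomm : ∀ j r s, q • (f j r * f j (s + 1)) - q⁻¹ • (f j (r + 1) * f j s)
      = q • (f j (s + 1) * f j r) - q⁻¹ • (f j s * f j (r + 1)))
    (hexch : ∀ i j, j < i → ∀ r s, q • (f i r * f j (s + 1)) - q⁻¹ • (f i (r + 1) * f j s)
      = f j (s + 1) * f i r - f j s * f i (r + 1) + (q - q⁻¹) • (f i s * f j (r + 1))) :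
    FormalRelation q n τ fun j (k : ℕ) => f j (-k) := by
  intro D G hG
  let R := MvPolynomial (Idx n) ℂ
  let F := FractionRing R
  let S := MvPowerSeries (Idx n) A
  let algRS : Algebra R S := RingHom.toAlgebra' (scalarHom (Idx n) A) scalarHom_commutes
  have hsmul : ∀ (c : R) (s : S), c • s = scalarHom (Idx n) A c * s := fun c s =>
    Algebra.smul_def c s
  let incl : S →ₐ[R] F ⊗[R] S := Algebra.TensorProduct.includeRight
  -- Extending scalars to `F` is localization at the nonzero polynomials, so its kernel is torsion,
  -- and there is none by `scalarHom_mul_eq_zero`.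
  have hloc : IsLocalizedModule (nonZeroDivisors R) (TensorProduct.mk R F S 1) :=
    (isLocalizedModule_iff_isBaseChange (nonZeroDivisors R) F _).2 (TensorProduct.isBaseChange R S F)
  have hinj : Function.Injective incl := by
    rw [injective_iff_map_eq_zero]
    intro s hs
    have hs' : TensorProduct.mk R F S 1 s = TensorProduct.mk R F S 1 0 := by
      rw [map_zero]; exact hs
    obtain ⟨c, hc⟩ := (IsLocalizedModule.eq_iff_exists (nonZeroDivisors R) _).1 hs'
    rw [smul_zero] at hc
    exact scalarHom_mul_eq_zero (nonZeroDivisors.coe_ne_zero c) ((hsmul _ _).symm.trans hc)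
  have hincl : ∀ (c : R) (s : S), incl (scalarHom (Idx n) A c * s) = algebraMap R F c • incl s :=
    fun c s => by rw [← hsmul, map_smul, algebraMap_smul]
  let x (j : Fin (m + 1)) (i : Idx n) : S := seriesAt (fun k : ℕ => f j (-k)) i
  have hX : ∀ c : Idx n, algebraMap R F (MvPolynomial.X c) = (uVar c)⁻¹ :=
    fun c => (inv_inv _).symm
  have hC : ∀ c : ℂ, algebraMap R F (MvPolynomial.C c) = algebraMap ℂ F c := fun c =>
    (IsScalarTower.algebraMap_apply ℂ R F c).symm
  set Q := algebraMap ℂ F q with hQ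
  have hne := uVar_kernel_ne_zero (ι := Idx n) hq0 hq1
  have hker : ∀ a b : Idx n, algebraMap R F (MvPolynomial.C q * MvPolynomial.X b
      - MvPolynomial.C q⁻¹ * MvPolynomial.X a)
      = (uVar a)⁻¹ * (uVar b)⁻¹ * (Q * uVar a - Q⁻¹ * uVar b) := fun a b => by
    rw [map_sub, map_mul, map_mul, hX, hX, hC, hC, map_inv₀, ← hQ]
    exact (inverse_variable_identities (uVar_ne_zero a) (uVar_ne_zero b) Q 0).1
  have hu0 : ∀ a b : Idx n, (uVar a)⁻¹ * (uVar b)⁻¹ ≠ (0 : F) := fun a b =>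
    mul_ne_zero (inv_ne_zero (uVar_ne_zero a)) (inv_ne_zero (uVar_ne_zero b))
  have hmain := orderedProd_eq_sum n (q := Q) (u := (uVar : Idx n → F))
    (t := fun j i => incl (x j i)) ((map_ne_zero _).2 hq0) uVar_injective uVar_ne_zero hne
    (fun j a b => by
      obtain rfl | hab := eq_or_ne a b
      · exact Commute.refl _
      have h := congrArg incl (seriesAt_commute_relation hab (hf j) (hcomm j))
      rw [hincl, hincl, hker, map_mul incl, map_mul incl] at h
      exact smul_cancel (mul_ne_zero (hu0 a b) (hne a b)) h)
    (fun j k hjk a b hab => by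
      have h := congrArg incl (seriesAt_exchange_relation hab.symm (hf k) (hf j) (hexch k j hjk))
      rw [map_add, hincl, hincl, hincl, hker, map_mul incl, map_mul incl, map_mul incl] at h
      refine smul_cancel (hu0 b a) ?_
      obtain ⟨-, i1, i2⟩ := inverse_variable_identities (uVar_ne_zero b) (uVar_ne_zero a) Q
        (Q - Q⁻¹)
      have e1 : algebraMap R F (MvPolynomial.X a - MvPolynomial.X b)
          = (uVar b)⁻¹ * (uVar a)⁻¹ * (uVar b - uVar a) := by
        rw [map_sub, hX, hX, i1]
      have e2 : algebraMap R F (MvPolynomial.C (q - q⁻¹) * MvPolynomial.X b)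
          = (uVar b)⁻¹ * (uVar a)⁻¹ * ((Q - Q⁻¹) * uVar a) := by
        rw [map_mul, hX, hC, map_sub, map_inv₀, ← hQ]
        exact i2
      rw [e1, e2] at h
      simp only [smul_sub, smul_smul]
      exact eq_sub_of_add_eq h.symm) τ hτ
  apply hinj
  rw [map_sum, ← scalarHom_apply, hincl]
  have h1 := map_orderedProd n (incl : S →* F ⊗[R] S) x
  have h2 : ∀ c, incl (reversedProd n fun j i => x j (τ c i))
      = reversedProd n fun j i => incl (x j (τ c i)) := fun c =>
    map_reversedProd n (incl : S →* F ⊗[R] S) fun j i => x j (τ c i)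
  refine (congrArg (algebraMap R F D • ·) (h1.trans hmain)).trans ?_
  simp only [smul_sum, smul_smul]
  refine sum_congr rfl fun c _ => ?_
  rw [← scalarHom_apply, hincl, hG c]
  exact congrArg _ (h2 c).symm

/-- The modes of the last row of the image of `T(u)`. -/
noncomputable def rowMode {N : ℕ} {A : Type*} [Ring A] [Algebra ℂ A]
    (ψ : FreeAlgebra ℂ (Gen N) →ₐ[ℂ] A) (p j : Fin N) (r : ℤ) : A := ψ (modeT N r p j)

section

variable {N : ℕ} {A : Type*} [Ring A] [Algebra ℂ A] {q : ℂ} {ψ : FreeAlgebra ℂ (Gen N) →ₐ[ℂ] A}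

theorem rowMode_one (p j : Fin N) : rowMode ψ p j 1 = 0 := by
  simp [rowMode, modeT]

theorem rowMode_neg (p j : Fin N) (k : ℕ) :
    rowMode ψ p j (-k) = ψ (FreeAlgebra.ι ℂ (Gen.T p j k)) := by
  simp [rowMode, modeT]

theorem rowMode_commute_relation (hψ : ∀ x y, Rel N q x y → ψ x = ψ y) (p j : Fin N) (r s : ℤ) :
    q • (rowMode ψ p j r * rowMode ψ p j (s + 1)) - q⁻¹ • (rowMode ψ p j (r + 1) * rowMode ψ p j s)
      = q • (rowMode ψ p j (s + 1) * rowMode ψ p j r)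
        - q⁻¹ • (rowMode ψ p j s * rowMode ψ p j (r + 1)) := by
  -- The coefficient of u^(r+1) v^(s+1) involves exactly the mode pairs (r, s+1) and (r+1, s), as R
  -- is homogeneous of degree one.
  have h := hψ _ _ (Rel.TT (r + 1) (s + 1) (p, p) (j, j))
  rw [rttLeft, rttRight, Matrix.add_apply, Matrix.add_apply, trigRIn_mul_apply, trigRIn_mul_apply,
    mul_trigRIn_apply_self, mul_trigRIn_apply_self] at h
  simpa [rowMode, sub_eq_add_neg] using h

theorem rowMode_exchange_relation (hψ : ∀ x y, Rel N q x y → ψ x = ψ y) (p : Fin N) {i j : Fin N}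
    (hij : j < i) (r s : ℤ) :
    q • (rowMode ψ p i r * rowMode ψ p j (s + 1)) - q⁻¹ • (rowMode ψ p i (r + 1) * rowMode ψ p j s)
      = rowMode ψ p j (s + 1) * rowMode ψ p i r - rowMode ψ p j s * rowMode ψ p i (r + 1)
        + (q - q⁻¹) • (rowMode ψ p i s * rowMode ψ p j (r + 1)) := by
  have h := hψ _ _ (Rel.TT (r + 1) (s + 1) (p, p) (i, j))
  rw [rttLeft, rttRight, Matrix.add_apply, Matrix.add_apply, trigRIn_mul_apply, trigRIn_mul_apply,
    mul_trigRIn_apply_of_lt _ _ _ _ _ _ hij, mul_trigRIn_apply_of_lt _ _ _ _ _ _ hij] at h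
  simpa [rowMode, sub_eq_add_neg, add_assoc] using h

end

theorem formalRelation_of_hom {A : Type*} [Ring A] [Algebra ℂ A] {q : ℂ} (hq0 : q ≠ 0)
    (hq1 : q ^ 2 ≠ 1) (τ : BlockPartition n → Equiv.Perm (Idx n))
    (hτ : ∀ (c : BlockPartition n) (i : Idx n), c.1 (τ c i) = block n i)
    (ρ : Uq (m + 1) q →ₐ[ℂ] A) :
    FormalRelation q n τ fun j r => ρ (genT (m + 1) q (Fin.last m) j r) := by
  let ψ := ρ.comp (RingQuot.mkAlgHom ℂ (Rel (m + 1) q))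
  have hψ : ∀ x y, Rel (m + 1) q x y → ψ x = ψ y := fun x y h =>
    congrArg ρ (RingQuot.mkAlgHom_rel ℂ h)
  have h := formalRelation_of_modes n hq0 hq1 τ hτ (fun j => rowMode ψ (Fin.last m) j)
    (fun j => rowMode_one _ j) (fun j => rowMode_commute_relation hψ _ j)
    fun i j hij => rowMode_exchange_relation hψ _ hij
  simp only [rowMode_neg] at h
  exact h

end

end QAffine

theorem theorem3p1 (m : ℕ) (q : ℂ) (hq0 : q ≠ 0) (hq1 : q ^ 2 ≠ 1) (n : Fin (m + 1) → ℕ)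
    (τ : QAffine.BlockPartition n → Equiv.Perm (QAffine.Idx n))
    (hτ : ∀ (c : QAffine.BlockPartition n) (i : QAffine.Idx n), c.1 (τ c i) = QAffine.block n i) :
    -- the relation in the quantum affine algebra
    QAffine.FormalRelation q n τ
        (fun j r => QAffine.genT (m + 1) q (Fin.last m) j r) ∧
    -- with the same coefficients in every representation of it
    (∀ (A : Type*) [Ring A] [Algebra ℂ A] (ρ : QAffine.Uq (m + 1) q →ₐ[ℂ] A),
      QAffine.FormalRelation q n τ
        (fun j r => ρ (QAffine.genT (m + 1) q (Fin.last m) j r))) ∧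
    -- and for every L-operator depending on a complex spectral parameter
    (∀ (A : Type*) [Ring A] [Algebra ℂ A] (Ω : Set ℂ)
      (T : ℂ → Matrix (Fin (m + 1)) (Fin (m + 1)) A),
      (∀ u ∈ Ω, ∀ v ∈ Ω, QAffine.RTT q u v (T u) (T v)) →
      ∀ u : QAffine.Idx n → ℂ, (∀ i, u i ∈ Ω) → Function.Injective u →
        (∀ i k, q * u i ≠ q⁻¹ * u k) →
        QAffine.orderedProd n (fun j i => T (u i) (Fin.last m) j)
          = ∑ c : QAffine.BlockPartition n,
              QAffine.coefficient q n u (fun i => u (τ c i)) •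
                QAffine.reversedProd n (fun j i => T (u (τ c i)) (Fin.last m) j)) := by
  refine ⟨?_, ?_, ?_⟩
  · exact QAffine.formalRelation_of_hom n hq0 hq1 τ hτ (AlgHom.id ℂ _)
  · intro A _ _ ρ
    exact QAffine.formalRelation_of_hom n hq0 hq1 τ hτ ρ
  · intro A _ _ Ω T hT u huΩ hu hqu
    exact QAffine.orderedProd_eq_sum_of_RTT hq0 n τ hτ hT huΩ hu hqu
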